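/- A one-pass quantum streaming algorithm keeps, between consecutive updates, a classical bit string and a quantum register. It starts with a quantum operation (quantum instrument, possibly randomised) on the empty register. For each arriving update it applies a quantum operation chosen by the update and the current classical memory, and it applies one last operation at the end of the stream. It then outputs a real number determined by its classical memory. Its space in a run is the greatest number of classical bits plus qubits held at any time, between operations, during the run. An insertion-only stream of a simple graph lists every edge of the graph exactly once, in an arbitrary (adversarial) order. For a graph $G$ let $m$ be the number of its edges, $T$ the number of its triangles, and $\Delta_E$ the greatest number of triangles that share one edge. Theorem. There is a universal constant $K > 0$ such that the following holds for all $\varepsilon, \delta \in (0,1]$ and all natural numbers $n, \hat m, \hat T, \hat\Delta$ with $\hat T \ge 1$. There is a one-pass quantum streaming algorithm, depending only on $n, \hat m, \hat T, \hat\Delta, \varepsilon, \delta$, such that on every insertion-only stream of every graph $G$ on $n$ vertices with $m \le \hat m$, $T \ge \hat T$ and $\Delta_E \le \hat\Delta$, its output $X$ satisfies \[ \Pr\bigl[\,|X - T| \le \varepsilon T\,\bigr] \ge 1 - \delta , \] and the expectation of its space, in classical bits and qubits together, is at most \[ K \cdot \frac{\hat m^{8/5}}{\hat T^{6/5}}\,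 \hat\Delta^{4/5} \cdot \log n \cdot \frac{1}{\varepsilon^{2}} \log \frac{1}{\delta} . \] In particular, with $\hat m = m$, $\hat T = T$, $\hat\Delta = \Delta_E$ (or with estimates within constant factors of these), the expected space is $O\bigl( \frac{m^{8/5}}{T^{6/5}} \Delta_E^{4/5} \log n \cdot \frac{1}{\varepsilon^2} \log\frac1\delta \bigr)$ quantum and classical bits. -/

import Mathlib

open scoped Matrix

noncomputable section

/-- A quantum operation applied to a register of `q` qubits that leaves behind a classical record
in `Mem` and a register of `qubits c` qubits, where `c` is the new record: a finite family of Kraus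
operators (one for every outcome, each outcome carrying the new record) satisfying the completeness
relation. Measurements, unitaries, allocating and discarding qubits, coin flips, and mixtures of
these are all of this form. The computational basis of `q` qubits is `Fin q → Bool`. -/
structure QuantumOperation {Mem : Type} (qubits : Mem → ℕ) (q : ℕ) where
  /-- The finite set of outcomes. -/
  Outcome : Type
  [fintypeOutcome : Fintype Outcome]
  /-- The classical memory after the given outcome. -/
  mem : Outcome → Mem
  /-- The Kraus operator of the given outcome. -/
  kraus : (r : Outcome) → Matrix (Fin (qubits (mem r)) → Bool) (Fin q → Bool) ℂ
  complete : ∑ r, (kraus r)ᴴ * kraus r = 1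

attribute [instance] QuantumOperation.fintypeOutcome

/-- A one-pass quantum streaming algorithm for streams of updates from `U`. All it keeps between two
consecutive updates is a classical memory, written as a bit string `code c`, and a quantum register
of `qubits c` qubits. It starts with an operation on the empty register, applies one operation for
each update (chosen by the update and the current classical memory) and one at the end of the
stream, and then outputs a number that is a function of the classical memory alone. All randomness
comes from the operations; randomness that is to be used again has to be kept in the memory. -/
structure QuantumStreamingAlgorithm (U : Type) where
  /-- The possible contents of the classical memory. -/
  Mem : Type
  /-- The bit string that represents the classical memory. -/
  code : Mem → List Bool
  code_injective : Function.Injective code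
  /-- The number of qubits held along with the given classical memory. -/
  qubits : Mem → ℕ
  init : QuantumOperation qubits 0
  update : (c : Mem) → U → QuantumOperation qubits (qubits c)
  final : (c : Mem) → QuantumOperation qubits (qubits c)
  output : Mem → ℝ

namespace QuantumStreamingAlgorithm

variable {U : Type} (A : QuantumStreamingAlgorithm U)

/-- The number of classical bits plus the number of qubits in use. -/
def space (c : A.Mem) : ℕ := (A.code c).length + A.qubits c

/-- The contribution to the expectation of `F` of all runs that have reached the classical memory
`c`, the peak space `s` and the unnormalised quantum state `ψ`, when the given updates are still to
come. The squared norm of `ψ` is the probability of getting there, and `F` is evaluated at the last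
classical memory and the peak space of the whole run. -/
def expectFrom (F : A.Mem → ℕ → ℝ) :
    List U → (c : A.Mem) → ((Fin (A.qubits c) → Bool) → ℂ) → ℕ → ℝ
  | [], c, ψ, s =>
      ∑ r : (A.final c).Outcome,
        (∑ x, ‖((A.final c).kraus r *ᵥ ψ) x‖ ^ 2) *
          F ((A.final c).mem r) (max s (A.space ((A.final c).mem r)))
  | u :: us, c, ψ, s =>
      ∑ r : (A.update c u).Outcome,
        expectFrom F us ((A.update c u).mem r) ((A.update c u).kraus r *ᵥ ψ)
          (max s (A.space ((A.update c u).mem r)))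

/-- The expectation, over a run of `A` on the stream `σ`, of a function `F` of the last classical
memory and of the peak space. -/
def expect (F : A.Mem → ℕ → ℝ) (σ : List U) : ℝ :=
  ∑ r : A.init.Outcome,
    A.expectFrom F σ (A.init.mem r) (A.init.kraus r *ᵥ fun _ => 1) (A.space (A.init.mem r))

open Classical in
/-- The probability that the output of `A` on the stream `σ` has the property `P`. -/
def prob (σ : List U) (P : ℝ → Prop) : ℝ :=
  A.expect (fun c _ => if P (A.output c) then 1 else 0) σ

/-- The expected peak space (classical bits plus qubits) of `A` on the stream `σ`. -/
def expectedSpace (σ : List U) : ℝ :=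
  A.expect (fun _ s => (s : ℝ)) σ

end QuantumStreamingAlgorithm

/-- `σ` is an insertion-only stream of the graph `G`: it lists every edge of `G` exactly once, in an
arbitrary order. -/
def IsGraphStream {n : ℕ} (G : SimpleGraph (Fin n)) (σ : List (Sym2 (Fin n))) : Prop :=
  σ.Nodup ∧ ∀ e, e ∈ σ ↔ e ∈ G.edgeSet

open Classical in
/-- The number of triangles of `G`. -/
def triangleCount {n : ℕ} (G : SimpleGraph (Fin n)) : ℕ :=
  (G.cliqueFinset 3).card

open Classical in
/-- The greatest number of triangles of `G` that share one edge. -/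
def maxTrianglesPerEdge {n : ℕ} (G : SimpleGraph (Fin n)) : ℕ :=
  G.edgeFinset.sup fun e => ((G.cliqueFinset 3).filter fun t => ∀ v ∈ e, v ∈ t).card

end

/-!
The number of triangles is written as the sum of two weighted counts, and each is estimated with
standard deviation `O(T)` by an algorithm that is good at it: a quantum one for the triangles whose
edges arrive close together, a classical one for the others.

Identify a triangle with its last edge `uv` in the stream and the opposite vertex `w`. The *age* of
a directed edge `xw` counts the updates that touch `x` and come after it, and `a(τ)` is the total
age of `uw` and `vw` when `uv` arrives. For `γ² = 1 - 1 / k` we have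
`T = ∑ γ ^ a(τ) + ∑ (1 - γ ^ a(τ))`.

*Quantum part* (`wedgeDetector`). A register of `O(log n)` qubits holds a superposition of the
directed edges `xw` seen so far with amplitudes proportional to `γ ^ age`, and a basis state for the
amplitude that is not yet used (`historyState`). At the update `uv` every pair `uw`, `vw` is
measured weakly in the two states `|uw⟩ ± |vw⟩`, and the sign of a detection becomes the sign of the
output `± k M`. As `(a + b)² - (a - b)² = 4 a b`, this is unbiased for the first sum. What survives
the measurement is exactly the same kind of superposition, with the amplitudes at `u` and at `v`
decreased by `γ` (`advance_historyState`): the disturbance caused by the measurements is the decay.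
The average of `(k M / T)²` copies has variance at most `T²` (`estimates_wedgeDetector`).

*Classical part* (`recorder`). Select each vertex `w` with probability `p` and each pair `(x, w)`
with probability `q`, by four-wise independent hash functions. Store the directed edges `xw` for
which both are selected, with their ages, and count the triangles for which `uw` and `vw` are stored
and `a(τ)` is at least a random threshold, which is at most `d` with probability `1 - γ ^ d`. The
count divided by `p q²` is unbiased for the second sum. Two triangles are dependent only through the
threshold, a common apex or a common edge. The sum over the triangles at one apex `w` is at most
`2 M D / k` (`sum_totalAge_le`, with `1 - γ ^ a ≤ a / k`); this is the gain over counting all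
triangles, and it allows a small `p`. The expected number of stored edges is `2 p q M`
(`expect_sq_sum_contribution_le`, `estimates_recorder`).

The choice `k ^ 5 = T² D² / M` balances the two: both parts then use
`(k M / T)² = M ^ (8 / 5) / T ^ (6 / 5) * D ^ (4 / 5)` words, up to a constant
(`exists_decayScale`, `exists_probabilities`). If `k < 1`, this is enough to store the whole graph.

Finally, averages of `O(1 / ε²)` copies, Chebyshev's inequality and medians of `O(log (1 / δ))`
averages give the stated accuracy. For `δ` near `1`, where `log (1 / δ)` is close to `0`, the
algorithm is run with probability proportional to `1 - δ` only (`exists_amplification`).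
-/

open scoped Matrix

noncomputable section

/-! ### Squared norms and runs of a streaming algorithm -/

/-- The squared Euclidean norm of an (unnormalised) quantum state. -/
def normSqSum {X : Type*} [Fintype X] (ψ : X → ℂ) : ℝ := ∑ x, ‖ψ x‖ ^ 2

lemma normSqSum_nonneg {X : Type*} [Fintype X] (ψ : X → ℂ) : 0 ≤ normSqSum ψ :=
  Finset.sum_nonneg fun _ _ => by positivity

lemma coe_normSqSum {X : Type*} [Fintype X] (ψ : X → ℂ) :
    ((normSqSum ψ : ℝ) : ℂ) = star ψ ⬝ᵥ ψ := by
  simp [normSqSum, dotProduct, Complex.conj_mul']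

lemma star_dotProduct_conjTranspose_mul {X Y : Type*} [Fintype X] [Fintype Y]
    (K : Matrix Y X ℂ) (ψ : X → ℂ) :
    star ψ ⬝ᵥ ((Kᴴ * K) *ᵥ ψ) = ((normSqSum (K *ᵥ ψ) : ℝ) : ℂ) := by
  rw [coe_normSqSum, Matrix.star_mulVec, ← Matrix.dotProduct_mulVec, Matrix.mulVec_mulVec]

namespace QuantumOperation

variable {Mem : Type} {qubits : Mem → ℕ} {q : ℕ}

/-- A quantum operation preserves total probability. -/
lemma sum_normSqSum (O : QuantumOperation qubits q) (ψ : (Fin q → Bool) → ℂ) :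
    ∑ r, normSqSum (O.kraus r *ᵥ ψ) = normSqSum ψ := by
  have h : ((∑ r, normSqSum (O.kraus r *ᵥ ψ) : ℝ) : ℂ) = (normSqSum ψ : ℝ) := by
    push_cast
    simp_rw [← star_dotProduct_conjTranspose_mul]
    rw [coe_normSqSum, ← dotProduct_sum, ← Matrix.sum_mulVec, O.complete, Matrix.one_mulVec]
  exact_mod_cast h

/-- The operation that leaves the register alone and keeps the record `c`. -/
abbrev idle (qubits : Mem → ℕ) (c : Mem) : QuantumOperation qubits (qubits c) where
  Outcome := Unit
  mem _ := c
  kraus _ := 1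
  complete := by simp

end QuantumOperation

namespace QuantumStreamingAlgorithm

variable {U : Type} (A : QuantumStreamingAlgorithm U)

lemma expectFrom_nil (F : A.Mem → ℕ → ℝ) (c : A.Mem) (ψ) (s : ℕ) :
    A.expectFrom F [] c ψ s = ∑ r : (A.final c).Outcome, normSqSum ((A.final c).kraus r *ᵥ ψ) *
      F ((A.final c).mem r) (max s (A.space ((A.final c).mem r))) := rfl

lemma expectFrom_cons (F : A.Mem → ℕ → ℝ) (u : U) (us : List U) (c : A.Mem) (ψ) (s : ℕ) :
    A.expectFrom F (u :: us) c ψ s = ∑ r : (A.update c u).Outcome,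
        A.expectFrom F us ((A.update c u).mem r) ((A.update c u).kraus r *ᵥ ψ)
          (max s (A.space ((A.update c u).mem r))) := rfl

lemma expectFrom_const_mul (a : ℝ) (F : A.Mem → ℕ → ℝ) (us : List U) (c : A.Mem) (ψ) (s : ℕ) :
    A.expectFrom (fun c s => a * F c s) us c ψ s = a * A.expectFrom F us c ψ s := by
  induction us generalizing c s with
  | nil => simp only [expectFrom_nil, Finset.mul_sum]; exact Finset.sum_congr rfl fun _ _ => by ring
  | cons u us ih => simp only [expectFrom_cons, Finset.mul_sum, ih]

lemma expectFrom_sum {ι : Type*} (t : Finset ι) (F : ι → A.Mem → ℕ → ℝ) (us : List U) (c : A.Mem)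
    (ψ) (s : ℕ) :
    A.expectFrom (fun c s => ∑ i ∈ t, F i c s) us c ψ s =
      ∑ i ∈ t, A.expectFrom (F i) us c ψ s := by
  induction us generalizing c s with
  | nil => simp only [expectFrom_nil, Finset.mul_sum]; exact Finset.sum_comm
  | cons u us ih => simp only [expectFrom_cons, ih]; exact Finset.sum_comm

lemma expectFrom_add (F F' : A.Mem → ℕ → ℝ) (us : List U) (c : A.Mem) (ψ) (s : ℕ) :
    A.expectFrom (fun c s => F c s + F' c s) us c ψ s =
      A.expectFrom F us c ψ s + A.expectFrom F' us c ψ s := by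
  induction us generalizing c s with
  | nil => simp only [expectFrom_nil, mul_add, Finset.sum_add_distrib]
  | cons u us ih => simp only [expectFrom_cons, ih, Finset.sum_add_distrib]

lemma expectFrom_mono {F F' : A.Mem → ℕ → ℝ} (h : ∀ c s, F c s ≤ F' c s) (us : List U) (c : A.Mem)
    (ψ) (s : ℕ) : A.expectFrom F us c ψ s ≤ A.expectFrom F' us c ψ s := by
  induction us generalizing c s with
  | nil =>
    simp only [expectFrom_nil]
    exact Finset.sum_le_sum fun r _ => mul_le_mul_of_nonneg_left (h _ _) (normSqSum_nonneg _)
  | cons u us ih => simp only [expectFrom_cons]; exact Finset.sum_le_sum fun r _ => ih _ _ _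

lemma expectFrom_const (a : ℝ) (us : List U) (c : A.Mem) (ψ) (s : ℕ) :
    A.expectFrom (fun _ _ => a) us c ψ s = a * normSqSum ψ := by
  induction us generalizing c s with
  | nil =>
    rw [expectFrom_nil, ← Finset.sum_mul, QuantumOperation.sum_normSqSum, mul_comm]
  | cons u us ih =>
    simp only [expectFrom_cons, ih]
    rw [← Finset.mul_sum, QuantumOperation.sum_normSqSum]

/-- If every memory has space at most `B`, so has every run. -/
lemma expectFrom_peak_le {B : ℕ} (hB : ∀ c, A.space c ≤ B) (us : List U) (c : A.Mem) (ψ)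
    {s : ℕ} (hs : s ≤ B) :
    A.expectFrom (fun _ s => (s : ℝ)) us c ψ s ≤ B * normSqSum ψ := by
  induction us generalizing c s with
  | nil =>
    rw [expectFrom_nil, ← QuantumOperation.sum_normSqSum (A.final c), Finset.mul_sum]
    refine Finset.sum_le_sum fun r _ => ?_
    rw [mul_comm]
    refine mul_le_mul_of_nonneg_right ?_ (normSqSum_nonneg _)
    exact_mod_cast max_le hs (hB _)
  | cons u us ih =>
    rw [expectFrom_cons, ← QuantumOperation.sum_normSqSum (A.update c u), Finset.mul_sum]
    exact Finset.sum_le_sum fun r _ => ih _ _ (max_le hs (hB _))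

lemma sum_init : ∑ r, normSqSum (A.init.kraus r *ᵥ fun _ => 1) = 1 := by
  rw [QuantumOperation.sum_normSqSum]; simp [normSqSum]

section expect

variable (σ : List U)

lemma expect_const_mul (a : ℝ) (F : A.Mem → ℕ → ℝ) :
    A.expect (fun c s => a * F c s) σ = a * A.expect F σ := by
  simp only [expect, expectFrom_const_mul, Finset.mul_sum]

lemma expect_add (F F' : A.Mem → ℕ → ℝ) :
    A.expect (fun c s => F c s + F' c s) σ = A.expect F σ + A.expect F' σ := by
  simp only [expect, expectFrom_add, Finset.sum_add_distrib]

lemma expect_mono {F F' : A.Mem → ℕ → ℝ} (h : ∀ c s, F c s ≤ F' c s) :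
    A.expect F σ ≤ A.expect F' σ :=
  Finset.sum_le_sum fun _ _ => A.expectFrom_mono h _ _ _ _

lemma expect_const (a : ℝ) : A.expect (fun _ _ => a) σ = a := by
  simp only [expect, expectFrom_const]
  rw [← Finset.mul_sum, sum_init, mul_one]

lemma expectedSpace_nonneg : 0 ≤ A.expectedSpace σ := by
  rw [← A.expect_const σ 0]
  exact A.expect_mono σ fun _ s => s.cast_nonneg

lemma expectedSpace_le_of_space_le {B : ℕ} (hB : ∀ c, A.space c ≤ B) : A.expectedSpace σ ≤ B := by
  refine (Finset.sum_le_sum fun r _ => A.expectFrom_peak_le hB σ _ _ (hB _)).trans ?_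
  rw [← Finset.mul_sum, sum_init, mul_one]

/-- Changing the output function does not change the runs. -/
lemma expect_with_output (g : A.Mem → ℝ) (F : A.Mem → ℕ → ℝ) :
    ({ A with output := g } : QuantumStreamingAlgorithm U).expect F σ = A.expect F σ := by
  have key : ∀ (us : List U) (c : A.Mem) (ψ : (Fin (A.qubits c) → Bool) → ℂ) (s : ℕ),
      ({ A with output := g } : QuantumStreamingAlgorithm U).expectFrom F us c ψ s =
        A.expectFrom F us c ψ s := by
    intro us
    induction us with
    | nil => intro c ψ s; rfl
    | cons u us ih => intro c ψ s; exact Finset.sum_congr rfl fun r _ => ih _ _ _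
  exact Finset.sum_congr rfl fun r _ => key _ _ _ _

end expect

end QuantumStreamingAlgorithm

/-! ### Self-delimiting codes -/

/-- A self-delimiting form of a bit string: a `true` before each bit, and `false` at the end. -/
def delimit (l : List Bool) : List Bool := l.flatMap (fun b => [true, b]) ++ [false]

lemma length_delimit (l : List Bool) : (delimit l).length = 2 * l.length + 1 := by
  induction l with
  | nil => rfl
  | cons b l ih => simp only [delimit, List.flatMap_cons, List.length_append, List.length_cons,
      List.length_nil] at ih ⊢; omega

lemma delimit_append_inj {l l' m m' : List Bool} (h : delimit l ++ m = delimit l' ++ m') :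
    l = l' ∧ m = m' := by
  induction l generalizing l' with
  | nil =>
    cases l' with
    | nil => simpa [delimit] using h
    | cons b l' => simp [delimit] at h
  | cons a l ih =>
    cases l' with
    | nil => simp [delimit] at h
    | cons b l' =>
      have h' : a = b ∧ delimit l ++ m = delimit l' ++ m' := by simpa [delimit] using h
      exact ⟨by rw [h'.1, (ih h'.2).1], (ih h'.2).2⟩

/-- A binary code for lists of natural numbers. -/
def encodeNats : List ℕ → List Bool
  | [] => []
  | k :: l => delimit k.bits ++ encodeNats l

lemma bits_injective : Function.Injective Nat.bits := fun a b h =>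
  Nat.eq_of_testBit_eq fun i => by rw [Nat.testBit_eq_inth, Nat.testBit_eq_inth, h]

lemma encodeNats_injective : Function.Injective encodeNats := by
  intro l l' h
  induction l generalizing l' with
  | nil =>
    cases l' with
    | nil => rfl
    | cons b l' => simp [encodeNats, delimit] at h
  | cons a l ih =>
    cases l' with
    | nil => simp [encodeNats, delimit] at h
    | cons b l' =>
      obtain ⟨h1, h2⟩ := delimit_append_inj h
      rw [bits_injective h1, ih h2]

/-- Numbers below `2 ^ L` take at most `2 * L + 1` bits each. -/
lemma length_encodeNats_le {L : ℕ} {l : List ℕ} (h : ∀ k ∈ l, k < 2 ^ L) :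
    (encodeNats l).length ≤ (2 * L + 1) * l.length := by
  induction l with
  | nil => simp [encodeNats]
  | cons k l ih =>
    have h1 : k.bits.length ≤ L := by
      rw [Nat.size_eq_bits_len]; exact Nat.size_le.2 (h k (by simp))
    have h2 := ih fun k hk => h k (by simp [hk])
    simp only [encodeNats, List.length_append, length_delimit, List.length_cons]
    nlinarith

/-! ### Running two algorithms side by side -/

open scoped Kronecker

/-- Splitting the basis of `a + b` qubits into those of `a` and of `b` qubits. -/
def splitQubits (a b : ℕ) : (Fin (a + b) → Bool) ≃ (Fin a → Bool) × (Fin b → Bool) :=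
  (Fin.appendEquiv a b).symm

/-- The product state on `a + b` qubits. -/
def tensorState {a b : ℕ} (ψ : (Fin a → Bool) → ℂ) (φ : (Fin b → Bool) → ℂ) :
    (Fin (a + b) → Bool) → ℂ :=
  fun x => ψ (splitQubits a b x).1 * φ (splitQubits a b x).2

lemma normSqSum_tensorState {a b : ℕ} (ψ : (Fin a → Bool) → ℂ) (φ : (Fin b → Bool) → ℂ) :
    normSqSum (tensorState ψ φ) = normSqSum ψ * normSqSum φ := by
  unfold normSqSum tensorState
  rw [Finset.sum_mul_sum, ← Fintype.sum_prod_type',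
    ← (splitQubits a b).sum_comp (fun p => ‖ψ p.1‖ ^ 2 * ‖φ p.2‖ ^ 2)]
  exact Finset.sum_congr rfl fun x _ => by rw [norm_mul, mul_pow]

namespace QuantumOperation

variable {Mem₁ Mem₂ : Type} {qubits₁ : Mem₁ → ℕ} {qubits₂ : Mem₂ → ℕ} {q₁ q₂ : ℕ}

/-- Two operations applied to the two parts of a register. -/
abbrev tensor (O₁ : QuantumOperation qubits₁ q₁) (O₂ : QuantumOperation qubits₂ q₂) :
    QuantumOperation (fun c : Mem₁ × Mem₂ => qubits₁ c.1 + qubits₂ c.2) (q₁ + q₂) where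
  Outcome := O₁.Outcome × O₂.Outcome
  mem r := (O₁.mem r.1, O₂.mem r.2)
  kraus r := (O₁.kraus r.1 ⊗ₖ O₂.kraus r.2).submatrix (splitQubits _ _) (splitQubits _ _)
  complete := by
    simp_rw [Matrix.conjTranspose_submatrix, Matrix.submatrix_mul_equiv,
      Matrix.conjTranspose_kronecker, ← Matrix.mul_kronecker_mul]
    have h : ∑ r : O₁.Outcome × O₂.Outcome,
        ((O₁.kraus r.1)ᴴ * O₁.kraus r.1) ⊗ₖ ((O₂.kraus r.2)ᴴ * O₂.kraus r.2) = 1 := by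
      rw [← Matrix.one_kronecker_one, ← O₁.complete, ← O₂.complete]
      ext x y
      rw [Matrix.kronecker_apply, Matrix.sum_apply, Matrix.sum_apply, Matrix.sum_apply,
        Finset.sum_mul_sum, ← Fintype.sum_prod_type']
      exact Finset.sum_congr rfl fun r _ => rfl
    ext x y
    have h2 := congrFun (congrFun h (splitQubits _ _ x)) (splitQubits _ _ y)
    rw [Matrix.sum_apply] at h2 ⊢
    simpa [Matrix.one_apply] using h2

lemma tensor_kraus_mulVec (O₁ : QuantumOperation qubits₁ q₁) (O₂ : QuantumOperation qubits₂ q₂)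
    (r : O₁.Outcome × O₂.Outcome) (ψ : (Fin q₁ → Bool) → ℂ) (φ : (Fin q₂ → Bool) → ℂ) :
    (tensor O₁ O₂).kraus r *ᵥ tensorState ψ φ =
      tensorState (O₁.kraus r.1 *ᵥ ψ) (O₂.kraus r.2 *ᵥ φ) := by
  funext x
  simp only [Matrix.mulVec, dotProduct, tensorState]
  rw [Finset.sum_mul_sum, ← Fintype.sum_prod_type', ← (splitQubits _ _).sum_comp]
  refine Finset.sum_congr rfl fun y _ => ?_
  rw [Matrix.submatrix_apply, Matrix.kronecker_apply]
  ring

end QuantumOperation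

namespace QuantumStreamingAlgorithm

variable {U : Type}

/-- Two algorithms run side by side with independent randomness. The code of the first memory is
made self-delimiting. The output is left to be chosen afterwards. -/
abbrev pair (A B : QuantumStreamingAlgorithm U) : QuantumStreamingAlgorithm U where
  Mem := A.Mem × B.Mem
  code c := delimit (A.code c.1) ++ B.code c.2
  code_injective := fun c c' h => by
    obtain ⟨h1, h2⟩ := delimit_append_inj h
    exact Prod.ext (A.code_injective h1) (B.code_injective h2)
  qubits c := A.qubits c.1 + B.qubits c.2
  init := A.init.tensor B.init
  update c u := (A.update c.1 u).tensor (B.update c.2 u)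
  final c := (A.final c.1).tensor (B.final c.2)
  output _ := 0

variable (A B : QuantumStreamingAlgorithm U)

lemma space_pair_le (c : (A.pair B).Mem) :
    (A.pair B).space c ≤ 2 * A.space c.1 + B.space c.2 + 1 := by
  simp only [space, List.length_append, length_delimit]
  omega

/-- The two components of a pair run independently, and the peak space is at most the combination of
the two peaks. -/
lemma expectFrom_pair_le {F : (A.pair B).Mem → ℕ → ℝ} (hF : ∀ c, Monotone (F c)) (us : List U)
    (a : A.Mem) (b : B.Mem) (ψ : (Fin (A.qubits a) → Bool) → ℂ)
    (φ : (Fin (B.qubits b) → Bool) → ℂ) {s s₁ s₂ : ℕ} (hs : s ≤ 2 * s₁ + s₂ + 1) :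
    (A.pair B).expectFrom F us (a, b) (tensorState ψ φ) s ≤
      A.expectFrom (fun a' t₁ => B.expectFrom (fun b' t₂ => F (a', b') (2 * t₁ + t₂ + 1))
        us b φ s₂) us a ψ s₁ := by
  induction us generalizing a b s s₁ s₂ with
  | nil =>
    simp only [expectFrom_nil, Finset.mul_sum]
    rw [← Fintype.sum_prod_type']
    refine Finset.sum_le_sum fun r _ => ?_
    have h1 : ((A.pair B).final (a, b)).kraus r *ᵥ tensorState ψ φ = _ :=
      QuantumOperation.tensor_kraus_mulVec (A.final a) (B.final b) r ψ φ
    rw [h1]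
    refine (congrArg (· * _) (normSqSum_tensorState _ _)).trans_le ?_
    rw [mul_assoc]
    refine mul_le_mul_of_nonneg_left (mul_le_mul_of_nonneg_left (hF _ ?_)
      (normSqSum_nonneg _)) (normSqSum_nonneg _)
    have := space_pair_le A B ((A.final a).mem r.1, (B.final b).mem r.2)
    dsimp only at this ⊢
    omega
  | cons u us ih =>
    simp only [expectFrom_cons]
    simp only [expectFrom_sum]
    rw [← Fintype.sum_prod_type']
    refine Finset.sum_le_sum fun r _ => ?_
    have h1 : ((A.pair B).update (a, b) u).kraus r *ᵥ tensorState ψ φ = _ :=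
      QuantumOperation.tensor_kraus_mulVec (A.update a u) (B.update b u) r ψ φ
    rw [h1]
    refine ih _ _ _ _ ?_
    have := space_pair_le A B ((A.update a u).mem r.1, (B.update b u).mem r.2)
    dsimp only at this ⊢
    omega

lemma expect_pair_le {F : (A.pair B).Mem → ℕ → ℝ} (hF : ∀ c, Monotone (F c)) (σ : List U) :
    (A.pair B).expect F σ ≤
      A.expect (fun a t₁ => B.expect (fun b t₂ => F (a, b) (2 * t₁ + t₂ + 1)) σ) σ := by
  simp only [expect, expectFrom_sum]
  rw [← Fintype.sum_prod_type']
  refine Finset.sum_le_sum fun r _ => ?_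
  have h1 := QuantumOperation.tensor_kraus_mulVec A.init B.init r (fun _ => 1) (fun _ => 1)
  have h2 : (tensorState (fun _ => 1) (fun _ => 1) : (Fin (0 + 0) → Bool) → ℂ) = fun _ => 1 := by
    funext x; simp [tensorState]
  rw [h2] at h1
  have h3 := expectFrom_pair_le A B hF σ (A.init.mem r.1) (B.init.mem r.2)
    (A.init.kraus r.1 *ᵥ fun _ => 1) (B.init.kraus r.2 *ᵥ fun _ => 1)
    (space_pair_le A B ((A.pair B).init.mem r))
  rw [← h1] at h3
  exact h3

lemma expect_pair (f : A.Mem → B.Mem → ℝ) (σ : List U) :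
    (A.pair B).expect (fun c _ => f c.1 c.2) σ =
      A.expect (fun a _ => B.expect (fun b _ => f a b) σ) σ := by
  refine le_antisymm (expect_pair_le A B (fun _ _ _ _ => le_rfl) σ) ?_
  have h := expect_pair_le A B (F := fun c _ => (-1) * f c.1 c.2) (fun _ _ _ _ => le_rfl) σ
  simp only [expect_const_mul] at h
  linarith

lemma expectedSpace_pair_le (σ : List U) :
    (A.pair B).expectedSpace σ ≤ 2 * A.expectedSpace σ + B.expectedSpace σ + 1 := by
  refine (expect_pair_le A B (fun _ _ _ h => Nat.cast_le.2 h) σ).trans_eq ?_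
  have h : ∀ t₁ : ℕ, B.expect (fun _ t₂ => ((2 * t₁ + t₂ + 1 : ℕ) : ℝ)) σ =
      2 * (t₁ : ℝ) + (B.expectedSpace σ + 1) := by
    intro t₁
    have := B.expect_add σ (fun _ _ => 2 * (t₁ : ℝ) + 1) (fun _ t₂ => (t₂ : ℝ))
    rw [expect_const] at this
    rw [expectedSpace, add_comm (B.expect _ σ), ← add_assoc, ← this]
    congr 1; funext _ t₂; push_cast; ring
  simp only [h]
  have := A.expect_add σ (fun _ t => 2 * (t : ℝ)) (fun _ _ => B.expectedSpace σ + 1)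
  rw [expect_const, expect_const_mul] at this
  rw [this]; simp only [expectedSpace]; ring

/-! ### Sums of independent estimates -/

/-- On the stream `σ` the output of `A` has mean `μ` and variance at most `V`, and the expected
space is at most `S`. -/
structure Estimates (A : QuantumStreamingAlgorithm U) (σ : List U) (μ V S : ℝ) : Prop where
  mean : A.expect (fun c _ => A.output c) σ = μ
  variance : A.expect (fun c _ => (A.output c - μ) ^ 2) σ ≤ V
  space : A.expectedSpace σ ≤ S

/-- Scaling the output. -/
abbrev scale (a : ℝ) (A : QuantumStreamingAlgorithm U) : QuantumStreamingAlgorithm U :=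
  { A with output := fun c => a * A.output c }

/-- Adding the outputs of two independent algorithms. -/
abbrev add (A B : QuantumStreamingAlgorithm U) : QuantumStreamingAlgorithm U :=
  { A.pair B with output := fun c => A.output c.1 + B.output c.2 }

/-- An algorithm that holds nothing and outputs `0`. -/
abbrev null (U : Type) : QuantumStreamingAlgorithm U where
  Mem := Unit
  code _ := []
  code_injective := fun _ _ _ => rfl
  qubits _ := 0
  init := .idle _ ()
  update c _ := .idle _ c
  final c := .idle _ c
  output _ := 0

/-- The sum of the outputs of `N` independent copies of `A`. -/
def nsum (A : QuantumStreamingAlgorithm U) : ℕ → QuantumStreamingAlgorithm U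
  | 0 => null U
  | N + 1 => A.add (nsum A N)

variable {A B} {σ : List U} {μ ν V W S T : ℝ}

lemma expect_affine_sq (x y : ℝ) (f : A.Mem → ℝ) :
    A.expect (fun c _ => (f c - x + y) ^ 2) σ =
      A.expect (fun c _ => (f c - x) ^ 2) σ + 2 * y * (A.expect (fun c _ => f c) σ - x) + y ^ 2 := by
  have h : (fun (c : A.Mem) (_ : ℕ) => (f c - x + y) ^ 2) =
      fun c _ => (f c - x) ^ 2 + (2 * y * f c + (y ^ 2 - 2 * y * x)) := by
    funext c _; ring
  rw [h, A.expect_add, A.expect_add, A.expect_const, A.expect_const_mul]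
  ring

lemma Estimates.scale (h : A.Estimates σ μ V S) (a : ℝ) :
    (A.scale a).Estimates σ (a * μ) (a ^ 2 * V) S where
  mean := by
    refine (A.expect_with_output σ _ _).trans ?_
    exact (A.expect_const_mul σ a (fun c _ => A.output c)).trans (by rw [h.mean])
  variance := by
    refine (A.expect_with_output σ _ _).trans_le ?_
    have : (fun (c : A.Mem) (_ : ℕ) => ((A.scale a).output c - a * μ) ^ 2) =
        fun c _ => a ^ 2 * (A.output c - μ) ^ 2 := by
      funext c _; ring
    refine (congrArg (fun F => A.expect F σ) this).trans_le ?_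
    rw [A.expect_const_mul]
    exact mul_le_mul_of_nonneg_left h.variance (sq_nonneg a)
  space := (A.expect_with_output σ _ _).trans_le h.space

lemma Estimates.add (h : A.Estimates σ μ V S) (h' : B.Estimates σ ν W T) :
    (A.add B).Estimates σ (μ + ν) (V + W) (2 * S + T + 1) where
  mean := by
    refine ((A.pair B).expect_with_output σ _ _).trans ?_
    refine (expect_pair A B (fun a b => A.output a + B.output b) σ).trans ?_
    simp only [expect_add, expect_const, h.mean, h'.mean]
  variance := by
    refine ((A.pair B).expect_with_output σ _ _).trans_le ?_
    refine (expect_pair A B (fun a b => (A.output a + B.output b - (μ + ν)) ^ 2) σ).trans_le ?_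
    have h1 : ∀ a, B.expect (fun b _ => (A.output a + B.output b - (μ + ν)) ^ 2) σ =
        (A.output a - μ) ^ 2 + B.expect (fun b _ => (B.output b - ν) ^ 2) σ := by
      intro a
      have := expect_affine_sq (A := B) (σ := σ) ν (A.output a - μ) B.output
      rw [h'.mean, sub_self, mul_zero, add_zero, add_comm] at this
      rw [← this]
      congr 1; funext b _; ring
    simp only [h1, expect_add, expect_const]
    exact add_le_add h.variance h'.variance
  space := by
    refine ((A.pair B).expect_with_output σ _ _).trans_le ?_
    refine (expectedSpace_pair_le A B σ).trans ?_
    linarith [h.space, h'.space]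

lemma expect_null (F : Unit → ℕ → ℝ) : (null U).expect F σ = F () 0 := by
  have hs : ∀ c, (null U).space c = 0 := fun _ => rfl
  have key : ∀ us : List U, ∀ ψ, (null U).expectFrom F us () ψ 0 = normSqSum ψ * F () 0 := by
    intro us
    induction us with
    | nil =>
      intro ψ
      rw [expectFrom_nil]
      refine (Fintype.sum_unique (ι := Unit) _).trans ?_
      simp [hs, null, QuantumOperation.idle]
    | cons u us ih =>
      intro ψ
      rw [expectFrom_cons]
      refine (Fintype.sum_unique (ι := Unit) _).trans ?_
      rw [hs, max_self]
      refine (ih _).trans ?_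
      simp [null, QuantumOperation.idle]
  refine (Fintype.sum_unique (ι := Unit) _).trans ?_
  refine (key σ _).trans ?_
  simp [null, QuantumOperation.idle, normSqSum]

lemma estimates_null : (null U).Estimates σ 0 0 0 where
  mean := expect_null _
  variance := by refine (expect_null _).trans_le ?_; simp
  space := by refine (expect_null _).trans_le ?_; simp

lemma Estimates.nsum (h : A.Estimates σ μ V S) (N : ℕ) :
    (A.nsum N).Estimates σ (N * μ) (N * V) (N * (2 * S + 1)) := by
  induction N with
  | zero =>
    rw [Nat.cast_zero, zero_mul, zero_mul, zero_mul]
    exact estimates_null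
  | succ N ih =>
    have := h.add ih
    have e1 : ((N + 1 : ℕ) : ℝ) * μ = μ + N * μ := by push_cast; ring
    have e2 : ((N + 1 : ℕ) : ℝ) * V = V + N * V := by push_cast; ring
    have e3 : ((N + 1 : ℕ) : ℝ) * (2 * S + 1) = 2 * S + N * (2 * S + 1) + 1 := by push_cast; ring
    rw [e1, e2, e3]
    exact this

/-- Averaging `N` independent copies divides the variance by `N`. -/
lemma Estimates.average (h : A.Estimates σ μ V S) {N : ℕ} (hN : 0 < N) :
    ((A.nsum N).scale (N : ℝ)⁻¹).Estimates σ μ (V / N) (N * (2 * S + 1)) := by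
  have hN' : (N : ℝ) ≠ 0 := by positivity
  have := (h.nsum N).scale (N : ℝ)⁻¹
  rwa [inv_mul_cancel_left₀ hN', show ((N : ℝ)⁻¹) ^ 2 * (N * V) = V / N by field_simp] at this

end QuantumStreamingAlgorithm

/-! ### Amplification of the success probability -/

/-- A median of a list of reals: the least entry that is at least as large as half of the list. -/
def median (l : List ℝ) : ℝ := sInf {x | x ∈ l ∧ l.length ≤ 2 * l.countP (· ≤ x)}

open Classical in
lemma median_mem_Icc {l : List ℝ} {a b : ℝ} {P : ℝ → Prop} (hP : ∀ x, P x ↔ ¬ (a ≤ x ∧ x ≤ b))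
    (h : 2 * l.countP (fun x => P x) < l.length) : a ≤ median l ∧ median l ≤ b := by
  set S := {x | x ∈ l ∧ l.length ≤ 2 * l.countP (· ≤ x)} with hS
  have hfin : S.Finite := (List.finite_toSet l).subset fun x hx => hx.1
  have hcount : l.length = l.countP (fun x => P x) + l.countP (fun x => ¬ P x) := by
    rw [List.length_eq_countP_add_countP (fun x => decide (P x))]
    simp
  have hne : ((l.filter fun x => ¬ P x).toFinset).Nonempty := by
    have : 0 < l.countP (fun x => ¬ P x) := by omega
    obtain ⟨x, hx, hx'⟩ := List.countP_pos_iff.1 this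
    exact ⟨x, by simpa using ⟨hx, by simpa using hx'⟩⟩
  -- The greatest entry in `[a, b]` dominates more than half of the list.
  obtain ⟨y, hy, hmax⟩ := Finset.exists_max_image _ id hne
  have hy' : y ∈ l ∧ ¬ P y := by simpa using hy
  have hyab : a ≤ y ∧ y ≤ b := by simpa [hP] using hy'.2
  have hyS : y ∈ S := by
    refine ⟨hy'.1, ?_⟩
    have : l.countP (fun x => ¬ P x) ≤ l.countP (fun x => decide (x ≤ y)) := by
      refine List.countP_mono_left fun x hx hx' => ?_
      have := hmax x (by simpa using ⟨hx, by simpa using hx'⟩)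
      simpa using this
    omega
  have hm : median l ∈ S := Set.Nonempty.csInf_mem ⟨y, hyS⟩ hfin
  refine ⟨?_, (csInf_le hfin.bddBelow hyS).trans hyab.2⟩
  by_contra hlt
  have : l.countP (fun x => decide (x ≤ median l)) ≤ l.countP (fun x => P x) := by
    refine List.countP_mono_left fun x hx hx' => ?_
    have h1 : x ≤ median l := by simpa using hx'
    have h2 : x < a := by linarith
    have h3 : P x := (hP x).2 fun h => by linarith [h.1]
    simpa using h3
  have := hm.2
  omega

namespace QuantumStreamingAlgorithm

variable {U : Type} {A : QuantumStreamingAlgorithm U} {σ : List U}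

/-- The separate outputs of `N` independent copies. -/
def outputs (A : QuantumStreamingAlgorithm U) : (N : ℕ) → (A.nsum N).Mem → List ℝ
  | 0, _ => []
  | N + 1, c => A.output c.1 :: outputs A N c.2

lemma length_outputs (N : ℕ) (c : (A.nsum N).Mem) : (A.outputs N c).length = N := by
  induction N with
  | zero => rfl
  | succ N ih => exact congrArg (· + 1) (ih c.2)

lemma expectedSpace_nsum_le (N : ℕ) :
    (A.nsum N).expectedSpace σ ≤ N * (2 * A.expectedSpace σ + 1) :=
  ((⟨rfl, le_rfl, le_rfl⟩ : A.Estimates σ _ _ _).nsum N).space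

open Classical in
lemma expect_pow_countP (P : ℝ → Prop) (z : ℝ) (N : ℕ) :
    (A.nsum N).expect (fun c _ => z ^ (A.outputs N c).countP (fun x => P x)) σ =
      (A.expect (fun c _ => if P (A.output c) then z else 1) σ) ^ N := by
  induction N with
  | zero => exact expect_null _
  | succ N ih =>
    refine ((A.pair (A.nsum N)).expect_with_output σ _ _).trans ?_
    have h : (fun (c : A.Mem × (A.nsum N).Mem) (_ : ℕ) =>
        z ^ (A.outputs (N + 1) c).countP (fun x => P x)) =
        fun c _ => (if P (A.output c.1) then z else 1) *
          z ^ (A.outputs N c.2).countP (fun x => P x) := by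
      funext c _
      simp only [outputs, List.countP_cons, pow_add, decide_eq_true_eq]
      split_ifs <;> simp [mul_comm]
    refine (congrArg (fun F => (A.pair (A.nsum N)).expect F σ) h).trans ?_
    refine (expect_pair A (A.nsum N) (fun a b => (if P (A.output a) then z else 1) *
      z ^ (A.outputs N b).countP (fun x => P x)) σ).trans ?_
    simp only [expect_const_mul, ih]
    rw [pow_succ', mul_comm (A.expect _ _), ← expect_const_mul]
    congr 1; funext c _; ring

/-- The median of the outputs of `N` independent copies. -/
abbrev medianOf (A : QuantumStreamingAlgorithm U) (N : ℕ) : QuantumStreamingAlgorithm U :=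
  { A.nsum N with output := fun c => median (A.outputs N c) }

open Classical in
/-- The median of `N` copies, each of which misses the target with probability at most `1 / 16`,
misses it with probability at most `2⁻ᴺ`. -/
lemma prob_medianOf {μ r : ℝ}
    (h : A.expect (fun c _ => if |A.output c - μ| ≤ r then 0 else 1) σ ≤ 1 / 16) (N : ℕ) :
    1 - (1 / 2) ^ N ≤ (A.medianOf N).prob σ (fun x => |x - μ| ≤ r) := by
  obtain ⟨P, hP⟩ : ∃ P : ℝ → Prop, ∀ x, P x ↔ ¬ (μ - r ≤ x ∧ x ≤ μ + r) := ⟨_, fun _ => Iff.rfl⟩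
  have hP' : ∀ x, P x ↔ ¬ |x - μ| ≤ r := fun x => by
    rw [hP, abs_le]; refine not_congr ⟨fun h => ⟨by linarith [h.1], by linarith [h.2]⟩,
      fun h => ⟨by linarith [h.1], by linarith [h.2]⟩⟩
  have h1 : A.expect (fun c _ => if P (A.output c) then (16 : ℝ) else 1) σ ≤ 2 := by
    have e : (fun (c : A.Mem) (_ : ℕ) => if P (A.output c) then (16 : ℝ) else 1) =
        fun c _ => 15 * (if |A.output c - μ| ≤ r then 0 else 1) + 1 := by
      funext c _; simp only [hP']; split_ifs <;> norm_num
    rw [e, expect_add, expect_const, expect_const_mul]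
    linarith
  have h0 : 0 ≤ A.expect (fun c _ => if P (A.output c) then (16 : ℝ) else 1) σ := by
    rw [← A.expect_const σ 0]
    exact A.expect_mono σ fun c _ => by split_ifs <;> norm_num
  have h2 : (A.nsum N).expect (fun c _ => (16 : ℝ) ^ (A.outputs N c).countP (fun x => P x)) σ ≤
      2 ^ N := by
    rw [expect_pow_countP]; exact pow_le_pow_left₀ h0 h1 N
  -- Missing the target needs at least `N / 2` bad copies: apply Markov's inequality to `16 ^ bad`.
  have h3 : (A.nsum N).expect (fun c _ => 1 + (-(1 / 4) ^ N) *
      (16 : ℝ) ^ (A.outputs N c).countP (fun x => P x)) σ ≤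
      (A.medianOf N).prob σ (fun x => |x - μ| ≤ r) := by
    rw [prob]
    refine le_of_le_of_eq ?_ ((A.nsum N).expect_with_output σ _ _).symm
    refine (A.nsum N).expect_mono σ fun c _ => ?_
    dsimp only
    split_ifs with hg
    · have : (0 : ℝ) ≤ (1 / 4) ^ N * 16 ^ (A.outputs N c).countP (fun x => P x) := by positivity
      linarith
    · have hbad : N ≤ 2 * (A.outputs N c).countP (fun x => P x) := by
        by_contra hlt
        have := median_mem_Icc hP (l := A.outputs N c)
          (by rw [length_outputs]; exact not_le.1 hlt)
        exact hg (abs_le.2 ⟨by linarith [this.1], by linarith [this.2]⟩)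
      have h4 : (4 : ℝ) ^ N ≤ 16 ^ (A.outputs N c).countP (fun x => P x) := by
        rw [show (16 : ℝ) = 4 ^ 2 by norm_num, ← pow_mul]
        exact pow_le_pow_right₀ (by norm_num) hbad
      have h5 : (1 / 4 : ℝ) ^ N * 4 ^ N = 1 := by rw [← mul_pow]; norm_num
      have : (1 / 4 : ℝ) ^ N * 4 ^ N ≤ (1 / 4) ^ N * 16 ^ (A.outputs N c).countP (fun x => P x) :=
        mul_le_mul_of_nonneg_left h4 (by positivity)
      linarith
  rw [expect_add, expect_const, expect_const_mul] at h3
  have h6 : (1 / 4 : ℝ) ^ N * 2 ^ N = (1 / 2) ^ N := by rw [← mul_pow]; norm_num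
  have h7 := mul_le_mul_of_nonneg_left h2 (show (0 : ℝ) ≤ (1 / 4) ^ N by positivity)
  linarith

open Classical in
/-- Chebyshev's inequality. -/
lemma Estimates.expect_miss_le {μ V S r : ℝ} (h : A.Estimates σ μ V S) (hr : 0 < r)
    (hV : V ≤ r ^ 2 / 16) :
    A.expect (fun c _ => if |A.output c - μ| ≤ r then 0 else 1) σ ≤ 1 / 16 := by
  calc _ ≤ A.expect (fun c _ => (r ^ 2)⁻¹ * (A.output c - μ) ^ 2) σ := by
        refine A.expect_mono σ fun c _ => ?_
        split_ifs with hc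
        · positivity
        · rw [inv_mul_eq_div, le_div_iff₀ (by positivity), one_mul, ← sq_abs (A.output c - μ)]
          exact pow_le_pow_left₀ hr.le (not_le.1 hc).le 2
    _ ≤ (r ^ 2)⁻¹ * (r ^ 2 / 16) := by
        rw [expect_const_mul]
        exact mul_le_mul_of_nonneg_left (h.variance.trans hV) (by positivity)
    _ = 1 / 16 := by field_simp

/-! ### Mixing with the algorithm that does nothing -/

lemma expectFrom_smul (A : QuantumStreamingAlgorithm U) (F : A.Mem → ℕ → ℝ) (a : ℂ) (us : List U)
    (c : A.Mem) (ψ) (s : ℕ) :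
    A.expectFrom F us c (a • ψ) s = ‖a‖ ^ 2 * A.expectFrom F us c ψ s := by
  induction us generalizing c s with
  | nil =>
    simp only [expectFrom_nil, Finset.mul_sum, Matrix.mulVec_smul]
    refine Finset.sum_congr rfl fun r _ => ?_
    rw [← mul_assoc]
    congr 1
    simp only [normSqSum, Finset.mul_sum, Pi.smul_apply, smul_eq_mul, norm_mul, mul_pow]
  | cons u us ih => simp only [expectFrom_cons, Finset.mul_sum, Matrix.mulVec_smul, ih]

end QuantumStreamingAlgorithm

/-- Recording that the algorithm is being run. -/
abbrev QuantumOperation.liftSome {Mem : Type} {qubits : Mem → ℕ} {q : ℕ}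
    (O : QuantumOperation qubits q) :
    QuantumOperation (fun c : Option Mem => c.elim 0 qubits) q where
  Outcome := O.Outcome
  mem r := some (O.mem r)
  kraus r := O.kraus r
  complete := O.complete

/-- With probability `p` perform `O`, otherwise nothing. -/
abbrev QuantumOperation.orNone {Mem : Type} {qubits : Mem → ℕ} (O : QuantumOperation qubits 0)
    (p : ℝ) (hp : 0 ≤ p) (hp' : p ≤ 1) :
    QuantumOperation (fun c : Option Mem => c.elim 0 qubits) 0 where
  Outcome := Option O.Outcome
  mem r := r.map O.mem
  kraus r := match r with
    | none => (Real.sqrt (1 - p) : ℂ) • (1 : Matrix (Fin 0 → Bool) (Fin 0 → Bool) ℂ)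
    | some r => (Real.sqrt p : ℂ) • O.kraus r
  complete := by
    have h1 : ((Real.sqrt (1 - p) : ℝ) : ℂ) * (Real.sqrt (1 - p) : ℝ) = 1 - p := by
      rw [← Complex.ofReal_mul, Real.mul_self_sqrt (by linarith)]; simp
    have h2 : ((Real.sqrt p : ℝ) : ℂ) * (Real.sqrt p : ℝ) = p := by
      rw [← Complex.ofReal_mul, Real.mul_self_sqrt hp]
    have h3 : ((Real.sqrt (1 - p) : ℂ) • (1 : Matrix (Fin 0 → Bool) (Fin 0 → Bool) ℂ))ᴴ *
        ((Real.sqrt (1 - p) : ℂ) • (1 : Matrix (Fin 0 → Bool) (Fin 0 → Bool) ℂ)) =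
        (1 - p : ℂ) • 1 := by
      rw [Matrix.conjTranspose_smul, Matrix.smul_mul, Matrix.mul_smul, smul_smul, Complex.star_def,
        Complex.conj_ofReal, h1, Matrix.conjTranspose_one, Matrix.mul_one]
    have h4 : ∑ r, ((Real.sqrt p : ℂ) • O.kraus r)ᴴ * ((Real.sqrt p : ℂ) • O.kraus r) =
        (p : ℂ) • 1 := by
      simp only [Matrix.conjTranspose_smul, Matrix.smul_mul, Matrix.mul_smul, smul_smul,
        Complex.star_def, Complex.conj_ofReal, h2]
      rw [← Finset.smul_sum, O.complete]
    refine (Fintype.sum_option _).trans ((congrArg₂ (· + ·) h3 h4).trans ?_)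
    rw [← add_smul]; simp

namespace QuantumStreamingAlgorithm

variable {U : Type}

/-- With probability `p` run `A`, otherwise hold nothing at all during the whole stream. -/
abbrev mix (A : QuantumStreamingAlgorithm U) (p : ℝ) (hp : 0 ≤ p) (hp' : p ≤ 1) :
    QuantumStreamingAlgorithm U where
  Mem := Option A.Mem
  code c := c.elim [] fun c => true :: A.code c
  code_injective := by
    rintro (_ | c) (_ | c') h
    · rfl
    · simp at h
    · simp at h
    · simp only [Option.elim_some, List.cons.injEq, true_and] at h
      rw [A.code_injective h]
  qubits c := c.elim 0 A.qubits
  init := A.init.orNone p hp hp'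
  update c u := match c with
    | none => .idle _ none
    | some c => (A.update c u).liftSome
  final c := match c with
    | none => .idle _ none
    | some c => (A.final c).liftSome
  output c := c.elim 0 A.output

variable (A : QuantumStreamingAlgorithm U) {p : ℝ} (hp : 0 ≤ p) (hp' : p ≤ 1)

lemma expectFrom_mix_none (F : Option A.Mem → ℕ → ℝ) (us : List U) (ψ : (Fin 0 → Bool) → ℂ) :
    (A.mix p hp hp').expectFrom F us none ψ 0 = normSqSum ψ * F none 0 := by
  induction us generalizing ψ with
  | nil =>
    refine (Fintype.sum_unique (ι := Unit) _).trans ?_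
    exact congrArg (fun v => normSqSum v * F none 0) (Matrix.one_mulVec ψ)
  | cons u us ih =>
    refine (Fintype.sum_unique (ι := Unit) _).trans ?_
    have : (A.mix p hp hp').space none = 0 := rfl
    rw [show max 0 ((A.mix p hp hp').space _) = 0 from this]
    refine (ih _).trans ?_
    exact congrArg (fun v => normSqSum v * F none 0) (Matrix.one_mulVec ψ)

lemma expectFrom_mix_some {F : Option A.Mem → ℕ → ℝ} (hF : ∀ c, Monotone (F c)) (us : List U)
    (c : A.Mem) (ψ : (Fin (A.qubits c) → Bool) → ℂ) {s t : ℕ} (hs : s ≤ t + 1) :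
    (A.mix p hp hp').expectFrom F us (some c) ψ s ≤
      A.expectFrom (fun c t => F (some c) (t + 1)) us c ψ t := by
  have hsp : ∀ c, (A.mix p hp hp').space (some c) = A.space c + 1 := fun c => by
    simp [space]; omega
  induction us generalizing c s t with
  | nil =>
    refine Finset.sum_le_sum fun r _ => mul_le_mul_of_nonneg_left (hF _ ?_) (normSqSum_nonneg _)
    have := hsp ((A.final c).mem r)
    dsimp only at this ⊢
    omega
  | cons u us ih =>
    refine Finset.sum_le_sum fun r _ => ih _ _ ?_
    have := hsp ((A.update c u).mem r)
    dsimp only at this ⊢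
    omega

lemma expect_mix_le {F : Option A.Mem → ℕ → ℝ} (hF : ∀ c, Monotone (F c)) (σ : List U) :
    (A.mix p hp hp').expect F σ ≤
      (1 - p) * F none 0 + p * A.expect (fun c t => F (some c) (t + 1)) σ := by
  refine (Fintype.sum_option _).trans_le (add_le_add (le_of_eq ?_) ?_)
  · refine (A.expectFrom_mix_none hp hp' F σ _).trans ?_
    have h : normSqSum (((Real.sqrt (1 - p) : ℂ) • (1 : Matrix (Fin 0 → Bool) (Fin 0 → Bool) ℂ)) *ᵥ
        fun _ => 1) = 1 - p := by
      rw [Matrix.smul_mulVec, Matrix.one_mulVec]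
      simp [normSqSum, abs_of_nonneg, Real.sqrt_nonneg, Real.sq_sqrt (sub_nonneg.2 hp')]
    exact congrArg (· * F none 0) h
  · rw [expect, Finset.mul_sum]
    refine Finset.sum_le_sum fun r _ => ?_
    refine (A.expectFrom_mix_some hp hp' hF σ (A.init.mem r) _ (t := A.space (A.init.mem r))
      ?_).trans_eq ?_
    · simp [space]; omega
    · have h := A.expectFrom_smul (fun c t => F (some c) (t + 1)) (Real.sqrt p : ℂ) σ
        (A.init.mem r) (A.init.kraus r *ᵥ fun _ => 1) (A.space (A.init.mem r))
      rw [← Matrix.smul_mulVec] at h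
      refine h.trans ?_
      congr 1
      simp [abs_of_nonneg, Real.sqrt_nonneg, Real.sq_sqrt hp]

lemma expectedSpace_mix_le (σ : List U) :
    (A.mix p hp hp').expectedSpace σ ≤ p * (A.expectedSpace σ + 1) := by
  refine (A.expect_mix_le hp hp' (fun _ _ _ h => Nat.cast_le.2 h) σ).trans_eq ?_
  have := A.expect_add σ (fun _ t => (t : ℝ)) (fun _ _ => 1)
  rw [expect_const] at this
  simp only [Nat.cast_zero, mul_zero, zero_add, Nat.cast_add, Nat.cast_one, this, expectedSpace]

open Classical in
lemma le_prob_mix (σ : List U) (P : ℝ → Prop) :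
    p * A.prob σ P ≤ (A.mix p hp hp').prob σ P := by
  have h := A.expect_mix_le hp hp' (F := fun c _ =>
    (-1) * if P ((A.mix p hp hp').output c) then 1 else 0) (fun _ _ _ _ => le_rfl) σ
  simp only [expect_const_mul] at h
  have h' : (-1) * (A.mix p hp hp').prob σ P ≤
      (1 - p) * ((-1) * if P 0 then 1 else 0) + p * ((-1) * A.prob σ P) := h
  have h1 : (0 : ℝ) ≤ (1 - p) * if P 0 then 1 else 0 :=
    mul_nonneg (by linarith) (by split_ifs <;> norm_num)
  linarith

open Classical in
/-- From failure probability `1 / 16` to failure probability `δ` at the cost of a factor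
`O(log (1 / δ))`. For `δ` close to `1` this factor is below `1`: then nothing is stored at all with
most of the probability. -/
theorem exists_amplification (A : QuantumStreamingAlgorithm U) {δ : ℝ} (hδ : 0 < δ) (hδ' : δ ≤ 1) :
    ∃ A' : QuantumStreamingAlgorithm U, ∀ (σ : List U) (μ r : ℝ),
      A.expect (fun c _ => if |A.output c - μ| ≤ r then 0 else 1) σ ≤ 1 / 16 →
        1 - δ ≤ A'.prob σ (fun x => |x - μ| ≤ r) ∧
        A'.expectedSpace σ ≤ 8 * (A.expectedSpace σ + 1) * Real.log (1 / δ) := by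
  have hlog : 1 - δ ≤ Real.log (1 / δ) := by
    have := Real.log_le_sub_one_of_pos hδ
    rw [one_div, Real.log_inv]; linarith
  rcases le_total δ (1 / 2) with hd | hd
  · have hl : (1 : ℝ) / 2 ≤ Real.log (1 / δ) := by linarith
    set L := Real.log (1 / δ) with hL
    have hlog2 : (0.69 : ℝ) < Real.log 2 := by linarith [Real.log_two_gt_d9]
    have hlog2' : Real.log 2 ≤ L := by
      refine Real.log_le_log (by norm_num) ?_
      rw [le_div_iff₀ hδ]; linarith
    set N := ⌈L / Real.log 2⌉₊ with hN
    have hN1 : L / Real.log 2 ≤ N := Nat.le_ceil _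
    have hN2 : (N : ℝ) < L / Real.log 2 + 1 := Nat.ceil_lt_add_one (by positivity)
    have hN3 : (N : ℝ) ≤ 3 * L := by
      have : L / Real.log 2 + 1 ≤ 3 * L := by
        rw [div_add_one (by positivity), div_le_iff₀ (by positivity)]
        nlinarith
      linarith
    refine ⟨A.medianOf N, fun σ μ r h => ⟨le_trans ?_ (prob_medianOf h N), ?_⟩⟩
    · have : Real.log ((1 / 2 : ℝ) ^ N) ≤ Real.log δ := by
        rw [Real.log_pow, one_div, Real.log_inv]
        rw [div_le_iff₀ (by positivity)] at hN1
        rw [hL, one_div, Real.log_inv] at hN1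
        linarith
      have := (Real.log_le_log_iff (by positivity) hδ).1 this
      linarith
    · refine ((A.nsum N).expect_with_output σ _ _).trans_le ?_
      refine (expectedSpace_nsum_le N).trans ?_
      have hS := A.expectedSpace_nonneg σ
      nlinarith [mul_le_mul_of_nonneg_right hN3 (show 0 ≤ 2 * A.expectedSpace σ + 1 by linarith)]
  · refine ⟨(A.medianOf 1).mix (2 * (1 - δ)) (by linarith) (by linarith),
      fun σ μ r h => ⟨?_, ?_⟩⟩
    · refine le_trans ?_ (le_prob_mix _ _ _ σ _)
      have := prob_medianOf h 1
      nlinarith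
    · refine (expectedSpace_mix_le _ _ _ σ).trans ?_
      have : (A.medianOf 1).expectedSpace σ ≤ 2 * A.expectedSpace σ + 1 := by
        refine ((A.nsum 1).expect_with_output σ _ _).trans_le ?_
        have := expectedSpace_nsum_le (A := A) (σ := σ) 1
        rwa [Nat.cast_one, one_mul] at this
      have h1 : (0 : ℝ) ≤ 1 - δ := by linarith
      have hS := A.expectedSpace_nonneg σ
      calc 2 * (1 - δ) * ((A.medianOf 1).expectedSpace σ + 1)
          ≤ 2 * (1 - δ) * (2 * A.expectedSpace σ + 1 + 1) := by gcongr
        _ ≤ 2 * Real.log (1 / δ) * (2 * A.expectedSpace σ + 1 + 1) := by gcongr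
        _ ≤ _ := by nlinarith [A.expectedSpace_nonneg σ]

end QuantumStreamingAlgorithm

/-! ### Algorithms that are deterministic up to a random seed -/

namespace QuantumOperation

/-- Drawing a random record from the distribution `μ` on `Ω`. -/
abbrev sample {Ω Mem : Type} [Fintype Ω] (μ : Ω → ℝ) (hμ : ∀ ω, 0 ≤ μ ω) (hμ' : ∑ ω, μ ω = 1)
    (mem : Ω → Mem) : QuantumOperation (fun _ : Mem => 0) 0 where
  Outcome := Ω
  mem := mem
  kraus ω := (Real.sqrt (μ ω) : ℂ) • (1 : Matrix (Fin 0 → Bool) (Fin 0 → Bool) ℂ)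
  complete := by
    simp only [Matrix.conjTranspose_smul, Matrix.mul_smul, smul_smul,
      Matrix.conjTranspose_one, Matrix.mul_one, Complex.star_def, Complex.conj_ofReal]
    rw [← Finset.sum_smul]
    have : ∑ ω, ((Real.sqrt (μ ω) : ℝ) : ℂ) * (Real.sqrt (μ ω) : ℝ) = 1 := by
      simp only [← Complex.ofReal_mul, Real.mul_self_sqrt (hμ _), ← Complex.ofReal_sum, hμ',
        Complex.ofReal_one]
    rw [this, one_smul]

end QuantumOperation

namespace QuantumStreamingAlgorithm

variable {U Ω Q : Type} [Fintype Ω] (μ : Ω → ℝ) (hμ : ∀ ω, 0 ≤ μ ω) (hμ' : ∑ ω, μ ω = 1)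
  (q₀ : Q) (step : Ω → Q → U → Q) (code : Ω × Q → List Bool) (hcode : Function.Injective code)
  (out : Ω × Q → ℝ)

/-- The classical algorithm that draws a seed `ω` with probability `μ ω`, keeps it, and then
evolves deterministically from the state `q₀` by `step ω`. -/
abbrev seeded : QuantumStreamingAlgorithm U where
  Mem := Ω × Q
  code := code
  code_injective := hcode
  qubits _ := 0
  init := .sample μ hμ hμ' fun ω => (ω, q₀)
  update c u := .sample (Ω := Unit) (fun _ => 1) (by simp) (by simp)
    fun _ => (c.1, step c.1 c.2 u)
  final c := .idle _ c
  output := out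

lemma normSqSum_sqrt_smul {x : ℝ} (hx : 0 ≤ x) (ψ : (Fin 0 → Bool) → ℂ) :
    normSqSum (((Real.sqrt x : ℂ) • (1 : Matrix (Fin 0 → Bool) (Fin 0 → Bool) ℂ)) *ᵥ ψ) =
      x * normSqSum ψ := by
  rw [Matrix.smul_mulVec, Matrix.one_mulVec]
  simp [normSqSum, abs_of_nonneg, Real.sqrt_nonneg, mul_pow, Real.sq_sqrt hx]

lemma expectFrom_seeded (f : Ω × Q → ℝ) (us : List U) (ω : Ω) (q : Q) (ψ : (Fin 0 → Bool) → ℂ)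
    (s : ℕ) :
    (seeded μ hμ hμ' q₀ step code hcode out).expectFrom (fun c _ => f c) us (ω, q) ψ s =
      normSqSum ψ * f (ω, us.foldl (step ω) q) := by
  induction us generalizing q ψ s with
  | nil =>
    refine (Fintype.sum_unique (ι := Unit) _).trans ?_
    exact congrArg (fun v => normSqSum v * f (ω, q)) (Matrix.one_mulVec ψ)
  | cons u us ih =>
    refine (Fintype.sum_unique (ι := Unit) _).trans ?_
    refine (ih _ _ _).trans ?_
    rw [normSqSum_sqrt_smul zero_le_one, one_mul, List.foldl_cons]

lemma expect_seeded (f : Ω × Q → ℝ) (σ : List U) :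
    (seeded μ hμ hμ' q₀ step code hcode out).expect (fun c _ => f c) σ =
      ∑ ω, μ ω * f (ω, σ.foldl (step ω) q₀) := by
  refine Finset.sum_congr rfl fun ω _ => ?_
  refine (expectFrom_seeded μ hμ hμ' q₀ step code hcode out f σ ω q₀ _ _).trans ?_
  rw [normSqSum_sqrt_smul (hμ ω)]
  simp [normSqSum]

lemma expectFrom_seeded_peak_le {B : ℕ} (us : List U) (ω : Ω) (q : Q) (ψ : (Fin 0 → Bool) → ℂ)
    {s : ℕ} (hs : s ≤ B) (h : ∀ τ, τ <+: us → (code (ω, τ.foldl (step ω) q)).length ≤ B) :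
    (seeded μ hμ hμ' q₀ step code hcode out).expectFrom (fun _ s => (s : ℝ)) us (ω, q) ψ s ≤
      normSqSum ψ * B := by
  induction us generalizing q ψ s with
  | nil =>
    refine (Fintype.sum_unique (ι := Unit) _).trans_le ?_
    refine (congrArg (fun v => normSqSum v * _) (Matrix.one_mulVec ψ)).trans_le ?_
    refine mul_le_mul_of_nonneg_left ?_ (normSqSum_nonneg _)
    exact Nat.cast_le.2 (max_le hs (h [] List.prefix_rfl))
  | cons u us ih =>
    refine (Fintype.sum_unique (ι := Unit) _).trans_le ?_
    refine (ih _ _ (max_le hs (h [u] (by simp))) fun τ hτ => ?_).trans_eq ?_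
    · exact h (u :: τ) (List.cons_prefix_cons.2 ⟨rfl, hτ⟩)
    · rw [normSqSum_sqrt_smul zero_le_one, one_mul]

lemma expectedSpace_seeded_le (B : Ω → ℕ) (σ : List U)
    (h : ∀ ω τ, τ <+: σ → (code (ω, τ.foldl (step ω) q₀)).length ≤ B ω) :
    (seeded μ hμ hμ' q₀ step code hcode out).expectedSpace σ ≤ ∑ ω, μ ω * B ω := by
  refine Finset.sum_le_sum fun ω _ => ?_
  refine (expectFrom_seeded_peak_le μ hμ hμ' q₀ step code hcode out σ ω q₀ _
    (h ω [] List.nil_prefix) (h ω)).trans_eq ?_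
  rw [normSqSum_sqrt_smul (hμ ω)]
  simp [normSqSum]

end QuantumStreamingAlgorithm

/-! ### Completing a family of Kraus operators -/

namespace QuantumOperation

open scoped ComplexOrder MatrixOrder Matrix.Norms.L2Operator in
lemma exists_conjTranspose_mul_self_eq {X ι : Type*} [Fintype X] [DecidableEq X] [Fintype ι]
    {Y : ι → Type*} [∀ i, Fintype (Y i)] (K : ∀ i, Matrix (Y i) X ℂ)
    (hK : ∀ ψ, ∑ i, normSqSum (K i *ᵥ ψ) ≤ normSqSum ψ) :
    ∃ B : Matrix X X ℂ, Bᴴ * B = 1 - ∑ i, (K i)ᴴ * K i := by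
  have hpos : (1 - ∑ i, (K i)ᴴ * K i).PosSemidef := by
    refine Matrix.PosSemidef.of_dotProduct_mulVec_nonneg ?_ fun ψ => ?_
    · simp [Matrix.IsHermitian, Matrix.conjTranspose_sub, Matrix.conjTranspose_sum,
        Matrix.conjTranspose_mul]
    · have : star ψ ⬝ᵥ ((1 - ∑ i, (K i)ᴴ * K i) *ᵥ ψ) =
          ((normSqSum ψ - ∑ i, normSqSum (K i *ᵥ ψ) : ℝ) : ℂ) := by
        rw [Matrix.sub_mulVec, dotProduct_sub, Matrix.one_mulVec, ← coe_normSqSum,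
          Matrix.sum_mulVec, dotProduct_sum]
        push_cast
        simp only [star_dotProduct_conjTranspose_mul]
      rw [this]
      exact_mod_cast sub_nonneg.2 (hK ψ)
  obtain ⟨B, hB⟩ := CStarAlgebra.nonneg_iff_eq_star_mul_self.mp hpos.nonneg
  exact ⟨B, by rw [hB, Matrix.star_eq_conjTranspose]⟩

/-- Kraus operators with `∑ Kᴴ K ≤ 1`, completed by outcomes that destroy the register and leave the
record `junk`. These are the rows of a matrix `B` with `Bᴴ B = 1 - ∑ Kᴴ K`, put in the row of the
all-`false` basis state in case `junk` comes with qubits. -/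
def ofContraction {Mem : Type} {qubits : Mem → ℕ} {q : ℕ} {ι : Type} [Fintype ι] (mem : ι → Mem)
    (K : ∀ i, Matrix (Fin (qubits (mem i)) → Bool) (Fin q → Bool) ℂ) (junk : Mem)
    (hK : ∀ ψ, ∑ i, normSqSum (K i *ᵥ ψ) ≤ normSqSum ψ) : QuantumOperation qubits q where
  Outcome := ι ⊕ (Fin q → Bool)
  mem := Sum.elim mem fun _ => junk
  kraus r := match r with
    | .inl i => K i
    | .inr x => Matrix.of fun a y =>
        if a = fun _ => false then (exists_conjTranspose_mul_self_eq K hK).choose x y else 0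
  complete := by
    refine (Fintype.sum_sum_type _).trans ?_
    have h1 := (exists_conjTranspose_mul_self_eq K hK).choose_spec
    set B := (exists_conjTranspose_mul_self_eq K hK).choose
    have h2 : ∑ x : Fin q → Bool,
        (Matrix.of fun (a : Fin (qubits junk) → Bool) y => if a = fun _ => false then B x y else 0)ᴴ *
        (Matrix.of fun (a : Fin (qubits junk) → Bool) y =>
          if a = fun _ => false then B x y else 0) = Bᴴ * B := by
      ext y z
      simp [Matrix.sum_apply, Matrix.mul_apply, Matrix.conjTranspose_apply]
    refine (congrArg (_ + ·) (h2.trans h1)).trans ?_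
    exact add_sub_cancel _ _

/-- Summing over the outcomes of `ofContraction` a quantity that vanishes on `junk`. -/
lemma sum_ofContraction {Mem : Type} {qubits : Mem → ℕ} {q : ℕ} {ι : Type} [Fintype ι]
    (mem : ι → Mem) (K : ∀ i, Matrix (Fin (qubits (mem i)) → Bool) (Fin q → Bool) ℂ) (junk : Mem)
    (hK : ∀ ψ, ∑ i, normSqSum (K i *ᵥ ψ) ≤ normSqSum ψ)
    (Φ : (c : Mem) → ((Fin (qubits c) → Bool) → ℂ) → ℝ) (hΦ : ∀ φ, Φ junk φ = 0)
    (ψ : (Fin q → Bool) → ℂ) :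
    ∑ r, Φ ((ofContraction mem K junk hK).mem r) ((ofContraction mem K junk hK).kraus r *ᵥ ψ) =
      ∑ i, Φ (mem i) (K i *ᵥ ψ) := by
  refine (Fintype.sum_sum_type _).trans ?_
  refine (congrArg (_ + ·) (Finset.sum_eq_zero fun x _ => hΦ _)).trans (add_zero _)

end QuantumOperation

/-! ### Ages of edges and sums over the history of a stream -/

/-- The sum of `f h e` over the updates `e` of a stream, where `h` is the history at `e`: the updates
before `e`, the latest one first. The first argument is the history at the start. -/
def overHistory {U R : Type*} [AddCommMonoid R] (f : List U → U → R) : List U → List U → R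
  | _, [] => 0
  | h, e :: us => f h e + overHistory f (e :: h) us

/-- The number of updates of the history that touch `x` and came after the edge `xw`. -/
def age {n : ℕ} : List (Sym2 (Fin n)) → Fin n → Fin n → ℕ
  | [], _, _ => 0
  | e :: h, x, w => if e = s(x, w) then 0 else age h x w + if x ∈ e then 1 else 0

/-- The amplitude of the directed edge `xw`, up to normalisation: it starts as `1` and decays by the
factor `γ` with each update that touches `x`. -/
def amplitude {n : ℕ} (γ : ℝ) (h : List (Sym2 (Fin n))) (x w : Fin n) : ℝ :=
  if s(x, w) ∈ h then γ ^ age h x w else 0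

lemma amplitude_cons {n : ℕ} (γ : ℝ) (e : Sym2 (Fin n)) (h : List (Sym2 (Fin n))) (x w : Fin n) :
    amplitude γ (e :: h) x w =
      if e = s(x, w) then 1 else (if x ∈ e then γ else 1) * amplitude γ h x w := by
  unfold amplitude
  by_cases he : e = s(x, w)
  · simp [he, age]
  · by_cases hx : x ∈ e <;> by_cases hh : s(x, w) ∈ h <;>
      simp [he, Ne.symm he, age, hx, hh, pow_succ']

/-! ### The quantum register and its updates -/

/-- The classical memory of the quantum algorithm: either the register is still in use and `j`
updates have been seen, or a pair of edges has been detected with sign `b`, or the run has failed. -/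
inductive DetectorMem (M : ℕ)
  | alive (j : Fin (M + 1))
  | done (b : Bool)
  | junk

namespace DetectorMem

variable {M : ℕ}

/-- A list of numbers that determines the memory. -/
def toNats : DetectorMem M → List ℕ
  | alive j => [2, j]
  | done b => [b.toNat]
  | junk => []

lemma toNats_injective : Function.Injective (toNats (M := M)) := by
  rintro (j | b | _) (j' | b' | _) h <;> simp [toNats] at h ⊢
  · exact Fin.ext h
  · cases b <;> cases b' <;> simp_all

end DetectorMem

/-- The register has a basis state `none` for what has not been assigned to an edge yet, and one for
each directed edge. -/
abbrev EdgeBasis (n : ℕ) : Type := Option (Fin n × Fin n)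

/-- The number of qubits that hold the edge basis. -/
def registerSize (n : ℕ) : ℕ := 2 * Nat.size n

/-- The edge basis among the computational basis states. -/
def edgeBasis (n : ℕ) : EdgeBasis n ↪ (Fin (registerSize n) → Bool) :=
  (Function.Embedding.nonempty_of_card_le (by
    have h : n < 2 ^ Nat.size n := Nat.lt_size_self n
    have h' : 2 ^ registerSize n = 2 ^ Nat.size n * 2 ^ Nat.size n := by
      rw [registerSize, two_mul, pow_add]
    simp only [Fintype.card_option, Fintype.card_prod, Fintype.card_fin, Fintype.card_fun,
      Fintype.card_bool, h']
    nlinarith)).some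

/-- The part of a register state in the edge basis. -/
def restrict (n : ℕ) : ((Fin (registerSize n) → Bool) → ℂ) →ₗ[ℂ] (EdgeBasis n → ℂ) :=
  LinearMap.funLeft ℂ ℂ (edgeBasis n)

/-- A state on the edge basis as a state of the register. -/
def embed (n : ℕ) : (EdgeBasis n → ℂ) →ₗ[ℂ] ((Fin (registerSize n) → Bool) → ℂ) :=
  Function.ExtendByZero.linearMap ℂ (edgeBasis n)

lemma restrict_embed {n : ℕ} (φ : EdgeBasis n → ℂ) : restrict n (embed n φ) = φ := by
  funext x
  exact (edgeBasis n).injective.extend_apply φ 0 x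

lemma normSqSum_restrict_le {n : ℕ} (ψ : (Fin (registerSize n) → Bool) → ℂ) :
    normSqSum (restrict n ψ) ≤ normSqSum ψ := by
  have : normSqSum (restrict n ψ) = ∑ y ∈ Finset.univ.map (edgeBasis n), ‖ψ y‖ ^ 2 := by
    rw [Finset.sum_map]; rfl
  rw [this]
  exact Finset.sum_le_sum_of_subset_of_nonneg (Finset.subset_univ _) fun _ _ _ => by positivity

lemma normSqSum_embed {n : ℕ} (φ : EdgeBasis n → ℂ) : normSqSum (embed n φ) = normSqSum φ := by
  have h1 : normSqSum φ = ∑ y ∈ Finset.univ.map (edgeBasis n), ‖embed n φ y‖ ^ 2 := by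
    rw [Finset.sum_map]
    refine Finset.sum_congr rfl fun x _ => ?_
    rw [show embed n φ (edgeBasis n x) = φ x from (edgeBasis n).injective.extend_apply φ 0 x]
  rw [h1]
  refine (Finset.sum_subset (Finset.subset_univ _) fun y _ hy => ?_).symm
  have : embed n φ y = 0 := Function.extend_apply' _ _ _ fun ⟨x, hx⟩ => hy (by simp [← hx])
  simp [this]

section operators

variable {n M : ℕ} (γ β : ℝ) (e : Sym2 (Fin n)) (j : ℕ)

/-- What happens to the register at the update `e` if nothing is detected, when `j` updates came
before: the directed edges that start at an endpoint of `e` decay, and part of the amplitude of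
`none` moves to the two directions of `e`. -/
def advance (M : ℕ) : (EdgeBasis n → ℂ) →ₗ[ℂ] (EdgeBasis n → ℂ) where
  toFun φ x := match x with
    | none => (Real.sqrt ((M - j - 1) / (M - j)) : ℂ) * φ none
    | some p => if e = s(p.1, p.2) then (Real.sqrt (1 / (2 * (M - j))) : ℂ) * φ none
        else ((if p.1 ∈ e then γ else 1 : ℝ) : ℂ) * φ (some p)
  map_add' φ φ' := by
    funext x
    rcases x with _ | p
    · simp [mul_add]
    · dsimp only [Pi.add_apply]; split_ifs <;> ring
  map_smul' a φ := by
    funext x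
    rcases x with _ | p
    · simp; ring
    · dsimp only [Pi.smul_apply, smul_eq_mul, RingHom.id_apply]; split_ifs <;> ring

/-- The amplitude with which the update `e = uv` detects `uw` and `vw`, with either sign. The register
is used up by a detection. -/
def detect (b : Bool) (w : Fin n) : (EdgeBasis n → ℂ) →ₗ[ℂ] ((Fin 0 → Bool) → ℂ) where
  toFun φ _ := (Real.sqrt (β / 2) : ℂ) *
    (φ (some (e.out.1, w)) + (if b then 1 else -1) * φ (some (e.out.2, w)))
  map_add' φ φ' := by funext _; dsimp only [Pi.add_apply]; ring
  map_smul' a φ := by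
    funext _; dsimp only [Pi.smul_apply, smul_eq_mul, RingHom.id_apply]; ring

variable {e}

lemma out_ne (he : ¬ e.IsDiag) : e.out.1 ≠ e.out.2 := fun h => he (by
  rw [← Quot.out_eq e]; exact h)

lemma mk_out : s(e.out.1, e.out.2) = e := Quot.out_eq e

lemma mem_iff_out {x : Fin n} : x ∈ e ↔ x = e.out.1 ∨ x = e.out.2 := by
  conv_lhs => rw [← mk_out (e := e)]
  exact Sym2.mem_iff

lemma sum_normSq_detect (hβ : 0 ≤ β) (he : ¬ e.IsDiag) (φ : EdgeBasis n → ℂ) :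
    ∑ r : Bool × Fin n, normSqSum (detect β e r.1 r.2 φ) =
      β * ∑ p : Fin n × Fin n, if p.1 ∈ e then ‖φ (some p)‖ ^ 2 else 0 := by
  have h1 : ∀ w, ∑ b : Bool, normSqSum (detect β e b w φ) =
      β * (‖φ (some (e.out.1, w))‖ ^ 2 + ‖φ (some (e.out.2, w))‖ ^ 2) := by
    intro w
    have := parallelogram_law_with_norm ℝ (φ (some (e.out.1, w))) (φ (some (e.out.2, w)))
    simp only [Fintype.sum_bool, normSqSum, detect, LinearMap.coe_mk, AddHom.coe_mk,
      Finset.univ_unique, Finset.sum_const, Finset.card_singleton, one_smul, norm_mul,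
      Complex.norm_real, mul_pow, Real.norm_eq_abs, sq_abs, Real.sq_sqrt (show 0 ≤ β / 2 by linarith),
      if_true, Bool.false_eq_true, if_false, one_mul, neg_mul, ← sub_eq_add_neg]
    linear_combination β / 2 * this
  have h2 : ∀ x w, (if x ∈ e then ‖φ (some (x, w))‖ ^ 2 else 0) =
      (if x = e.out.1 then ‖φ (some (x, w))‖ ^ 2 else 0) +
        if x = e.out.2 then ‖φ (some (x, w))‖ ^ 2 else 0 := by
    intro x w
    have := out_ne he
    by_cases hx : x = e.out.1
    · simp [mem_iff_out, hx, this]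
    · simp [mem_iff_out, hx]
  rw [Fintype.sum_prod_type_right, Fintype.sum_prod_type_right, Finset.mul_sum]
  refine Finset.sum_congr rfl fun w _ => ?_
  rw [h1]
  simp only [h2, Finset.sum_add_distrib, Finset.sum_ite_eq', Finset.mem_univ, if_true]

lemma normSqSum_advance_le (hj : j < M) (φ : EdgeBasis n → ℂ) :
    normSqSum (advance γ e j M φ) ≤ ‖φ none‖ ^ 2 +
      ∑ p : Fin n × Fin n, (if p.1 ∈ e then γ ^ 2 else 1) * ‖φ (some p)‖ ^ 2 := by
  have hj' : (0 : ℝ) < M - j := by have : (j : ℝ) < M := by exact_mod_cast hj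
                                   linarith
  have hj1 : (0 : ℝ) ≤ M - j - 1 := by
    have : (j : ℝ) + 1 ≤ M := by exact_mod_cast hj
    linarith
  have h1 : ∀ p : Fin n × Fin n, ‖advance γ e j M φ (some p)‖ ^ 2 ≤
      (if e = s(p.1, p.2) then 1 / (2 * (M - j)) * ‖φ none‖ ^ 2 else 0) +
        (if p.1 ∈ e then γ ^ 2 else 1) * ‖φ (some p)‖ ^ 2 := by
    intro p
    have hnn : 0 ≤ (if p.1 ∈ e then γ ^ 2 else 1) * ‖φ (some p)‖ ^ 2 := by
      split_ifs <;> positivity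
    by_cases hp : e = s(p.1, p.2)
    · simp only [advance, LinearMap.coe_mk, AddHom.coe_mk, if_pos hp, norm_mul, Complex.norm_real,
        mul_pow, Real.norm_eq_abs, sq_abs]
      rw [Real.sq_sqrt (by positivity)]
      exact le_add_of_nonneg_right hnn
    · simp only [advance, LinearMap.coe_mk, AddHom.coe_mk, if_neg hp, norm_mul, Complex.norm_real,
        mul_pow, Real.norm_eq_abs, sq_abs, zero_add]
      by_cases hx : p.1 ∈ e <;> simp [hx]
  have h2 : ∑ p : Fin n × Fin n, (if e = s(p.1, p.2) then 1 / (2 * (M - j)) * ‖φ none‖ ^ 2 else 0) ≤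
      1 / (M - j : ℝ) * ‖φ none‖ ^ 2 := by
    rw [← Finset.sum_filter, Finset.sum_const, nsmul_eq_mul]
    have : (Finset.univ.filter fun p : Fin n × Fin n => e = s(p.1, p.2)).card ≤ 2 := by
      refine (Finset.card_le_card (t := {(e.out.1, e.out.2), (e.out.2, e.out.1)})
        fun p hp => ?_).trans Finset.card_le_two
      have hp' : s(e.out.1, e.out.2) = s(p.1, p.2) := by rw [mk_out]; simpa using hp
      rcases Sym2.eq_iff.1 hp' with h | h
      · simp [Prod.ext_iff, h.1, h.2]
      · simp [Prod.ext_iff, h.1, h.2]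
    calc _ ≤ (2 : ℝ) * (1 / (2 * (M - j)) * ‖φ none‖ ^ 2) := by
          gcongr
          exact_mod_cast this
      _ = _ := by field_simp
  have h3 : ‖advance γ e j M φ none‖ ^ 2 = (M - j - 1) / (M - j : ℝ) * ‖φ none‖ ^ 2 := by
    simp only [advance, LinearMap.coe_mk, AddHom.coe_mk, norm_mul, Complex.norm_real,
        mul_pow, Real.norm_eq_abs, sq_abs]
    rw [Real.sq_sqrt (by positivity)]
  rw [normSqSum, Fintype.sum_option, h3]
  have h4 := (Finset.sum_le_sum fun p (_ : p ∈ Finset.univ) => h1 p).trans_eq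
    Finset.sum_add_distrib
  have h5 : (M - j - 1) / (M - j : ℝ) * ‖φ none‖ ^ 2 + 1 / (M - j : ℝ) * ‖φ none‖ ^ 2 =
      ‖φ none‖ ^ 2 := by
    rw [← add_mul, ← add_div, sub_add_cancel, div_self hj'.ne', one_mul]
  linarith

/-- Detection and survival together do not increase the total probability. -/
lemma advance_detect_contraction (hβ : 0 ≤ β) (hγβ : γ ^ 2 + β = 1) (he : ¬ e.IsDiag) (hj : j < M)
    (φ : EdgeBasis n → ℂ) :
    normSqSum (advance γ e j M φ) + ∑ r : Bool × Fin n, normSqSum (detect β e r.1 r.2 φ) ≤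
      normSqSum φ := by
  have h1 := normSqSum_advance_le γ (e := e) j hj φ
  rw [sum_normSq_detect β hβ he, Finset.mul_sum]
  have h2 : normSqSum φ = ‖φ none‖ ^ 2 +
      ((∑ p : Fin n × Fin n, (if p.1 ∈ e then γ ^ 2 else 1) * ‖φ (some p)‖ ^ 2) +
      ∑ p : Fin n × Fin n, β * if p.1 ∈ e then ‖φ (some p)‖ ^ 2 else 0) := by
    rw [normSqSum, Fintype.sum_option, ← Finset.sum_add_distrib]
    congr 1
    refine Finset.sum_congr rfl fun p _ => ?_
    split_ifs
    · rw [← add_mul, hγβ, one_mul]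
    · simp
  linarith

/-- The state of the register after the history `h`, as long as nothing has been detected. -/
def historyState (γ : ℝ) (M : ℕ) (h : List (Sym2 (Fin n))) : EdgeBasis n → ℂ
  | none => (Real.sqrt ((M - h.length) / M) : ℝ)
  | some p => (Real.sqrt (1 / (2 * M)) * amplitude γ h p.1 p.2 : ℝ)

lemma advance_historyState (e : Sym2 (Fin n)) {h : List (Sym2 (Fin n))} (hj : h.length < M) :
    advance γ e h.length M (historyState γ M h) = historyState γ M (e :: h) := by
  have hj' : (0 : ℝ) < M - h.length := by
    have : (h.length : ℝ) < M := by exact_mod_cast hj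
    linarith
  have hM : (0 : ℝ) < M := by exact_mod_cast Nat.zero_lt_of_lt hj
  have hj1 : (0 : ℝ) ≤ M - h.length - 1 := by
    have : (h.length : ℝ) + 1 ≤ M := by exact_mod_cast hj
    linarith
  funext x
  rcases x with _ | p
  · simp only [advance, historyState, LinearMap.coe_mk, AddHom.coe_mk]
    rw [← Complex.ofReal_mul, ← Real.sqrt_mul (by positivity)]
    congr 2
    rw [List.length_cons]
    push_cast
    field_simp
    ring
  · simp only [advance, historyState, LinearMap.coe_mk, AddHom.coe_mk, amplitude_cons]
    by_cases hp : e = s(p.1, p.2)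
    · rw [if_pos hp, if_pos hp, ← Complex.ofReal_mul, ← Real.sqrt_mul (by positivity), mul_one]
      congr 2
      field_simp
    · rw [if_neg hp, if_neg hp, ← Complex.ofReal_mul]
      congr 1
      ring

end operators

/-! ### The quantum algorithm -/

open QuantumStreamingAlgorithm

section detector

variable {n : ℕ}

/-- The number of qubits held along with the given memory. -/
abbrev detectorQubits (n : ℕ) {M : ℕ} : DetectorMem M → ℕ
  | .alive _ => registerSize n
  | .done _ => 0
  | .junk => 0

/-- The memories after the outcomes of an update: `none` if nothing has been detected. -/
abbrev detectorNext {M j : ℕ} (hj : j < M) : Option (Bool × Fin n) → DetectorMem M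
  | none => .alive ⟨j + 1, by omega⟩
  | some r => .done r.1

/-- The Kraus operators of an update. -/
abbrev detectorKraus (γ β : ℝ) (e : Sym2 (Fin n)) {M j : ℕ} (hj : j < M) :
    (r : Option (Bool × Fin n)) →
      Matrix (Fin (detectorQubits n (detectorNext hj r)) → Bool) (Fin (registerSize n) → Bool) ℂ
  | none => LinearMap.toMatrix' (embed n ∘ₗ advance γ e j M ∘ₗ restrict n)
  | some r => LinearMap.toMatrix' (detect β e r.1 r.2 ∘ₗ restrict n)

lemma detectorKraus_none (M : ℕ) (γ β : ℝ) (e : Sym2 (Fin n)) {j : ℕ} (hj : j < M) (ψ) :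
    detectorKraus γ β e hj none *ᵥ ψ = embed n (advance γ e j M (restrict n ψ)) :=
  LinearMap.toMatrix'_mulVec _ _

lemma detectorKraus_some (M : ℕ) (γ β : ℝ) (e : Sym2 (Fin n)) {j : ℕ} (hj : j < M) (r) (ψ) :
    detectorKraus γ β e hj (some r) *ᵥ ψ = detect β e r.1 r.2 (restrict n ψ) :=
  LinearMap.toMatrix'_mulVec _ _

lemma detectorKraus_contraction {M : ℕ} {γ β : ℝ} (hβ : 0 ≤ β) (hγβ : γ ^ 2 + β = 1)
    {e : Sym2 (Fin n)} (he : ¬ e.IsDiag) {j : ℕ} (hj : j < M) (ψ) :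
    ∑ r, normSqSum (detectorKraus γ β e hj r *ᵥ ψ) ≤ normSqSum ψ := by
  refine (Fintype.sum_option _).trans_le ?_
  refine (congrArg₂ (· + ·) (congrArg normSqSum (detectorKraus_none M γ β e hj ψ))
    (Finset.sum_congr rfl fun r _ =>
      congrArg normSqSum (detectorKraus_some M γ β e hj r ψ))).trans_le ?_
  rw [normSqSum_embed]
  exact (advance_detect_contraction γ β j hβ hγβ he hj _).trans (normSqSum_restrict_le ψ)

/-- The register starts in the basis state `none`. -/
abbrev startKraus (n : ℕ) :
    Unit → Matrix (Fin (registerSize n) → Bool) (Fin 0 → Bool) ℂ :=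
  fun _ => Matrix.of fun y _ => embed n (Pi.single none 1) y

lemma startKraus_mulVec (n : ℕ) (ψ : (Fin 0 → Bool) → ℂ) :
    startKraus n () *ᵥ ψ = (ψ fun _ => false) • embed n (Pi.single none 1) := by
  funext y
  simp only [startKraus, Matrix.mulVec, dotProduct, Matrix.of_apply, Fintype.sum_unique, Pi.smul_apply,
    smul_eq_mul]
  rw [mul_comm]
  exact congrArg (fun z => ψ z * embed n (Pi.single none 1) y) (Subsingleton.elim _ _)

lemma startKraus_contraction (n : ℕ) (ψ : (Fin 0 → Bool) → ℂ) :
    ∑ r, normSqSum (startKraus n r *ᵥ ψ) ≤ normSqSum ψ := by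
  have h : normSqSum (Pi.single none 1 : EdgeBasis n → ℂ) = 1 := by
    simp [normSqSum, Pi.single_apply, apply_ite]
  refine (Fintype.sum_unique (ι := Unit) _).trans_le ?_
  refine (congrArg normSqSum (startKraus_mulVec n ψ)).trans_le ?_
  have h2 : normSqSum ((ψ fun _ => false) • embed n (Pi.single none 1)) =
      ‖ψ fun _ => false‖ ^ 2 * normSqSum (embed n (Pi.single none 1)) := by
    simp only [normSqSum, Finset.mul_sum, Pi.smul_apply, smul_eq_mul, norm_mul, mul_pow]
  rw [h2, normSqSum_embed, h]
  rw [mul_one, normSqSum, Fintype.sum_unique]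
  exact le_of_eq (congrArg (fun z => ‖ψ z‖ ^ 2) (Subsingleton.elim _ _))

open Classical in
/-- The quantum algorithm. Updates that cannot occur in a stream of at most `M` edges of a simple
graph are ignored. The output is unbiased for the number of triangles, each weighted by the product
of the amplitudes that its two earlier edges have when its last edge arrives. -/
abbrev wedgeDetector (n M : ℕ) {γ β : ℝ} (hβ : 0 ≤ β) (hγβ : γ ^ 2 + β = 1) :
    QuantumStreamingAlgorithm (Sym2 (Fin n)) where
  Mem := DetectorMem M
  code c := encodeNats c.toNats
  code_injective := encodeNats_injective.comp DetectorMem.toNats_injective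
  qubits := detectorQubits n
  init := .ofContraction (fun _ => .alive 0) (startKraus n) .junk (startKraus_contraction n)
  update c e := match c with
    | .alive j => if h : ¬ e.IsDiag ∧ j.val < M then
        .ofContraction (detectorNext h.2) (detectorKraus γ β e h.2) .junk
          (detectorKraus_contraction hβ hγβ h.1 h.2)
        else .idle (detectorQubits n) (.alive j)
    | .done b => .idle (detectorQubits n) (.done b)
    | .junk => .idle (detectorQubits n) .junk
  final c := .idle (detectorQubits n) c
  output c := match c with
    | .alive _ => 0
    | .done b => (if b then 1 else -1) * (M / β)
    | .junk => 0

variable {M : ℕ} {γ β : ℝ} (hβ : 0 ≤ β) (hγβ : γ ^ 2 + β = 1)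

lemma expectFrom_done (G : DetectorMem M → ℝ) (us : List (Sym2 (Fin n))) (b : Bool)
    (ψ : (Fin 0 → Bool) → ℂ) (s : ℕ) :
    (wedgeDetector n M hβ hγβ).expectFrom (fun c _ => G c) us (.done b) ψ s =
      normSqSum ψ * G (.done b) := by
  induction us generalizing ψ s with
  | nil =>
    refine (Fintype.sum_unique (ι := Unit) _).trans ?_
    exact congrArg (fun v => normSqSum v * G (.done b)) (Matrix.one_mulVec ψ)
  | cons u us ih =>
    refine (Fintype.sum_unique (ι := Unit) _).trans ?_
    refine (ih _ _).trans ?_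
    exact congrArg (fun v => normSqSum v * G (.done b)) (Matrix.one_mulVec ψ)

lemma expectFrom_junk {G : DetectorMem M → ℝ} (hG : G .junk = 0) (us : List (Sym2 (Fin n)))
    (ψ : (Fin 0 → Bool) → ℂ) (s : ℕ) :
    (wedgeDetector n M hβ hγβ).expectFrom (fun c _ => G c) us .junk ψ s = 0 := by
  induction us generalizing ψ s with
  | nil =>
    refine (Fintype.sum_unique (ι := Unit) _).trans ?_
    exact (congrArg (_ * ·) hG).trans (mul_zero _)
  | cons u us ih =>
    refine (Fintype.sum_unique (ι := Unit) _).trans ?_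
    exact ih _ _

lemma normSqSum_detect_historyState (hβ : 0 ≤ β) (e : Sym2 (Fin n)) (h : List (Sym2 (Fin n)))
    (b : Bool) (w : Fin n) :
    normSqSum (detect β e b w (historyState γ M h)) = β / 2 * (1 / (2 * M)) *
      (amplitude γ h e.out.1 w + (if b then 1 else -1) * amplitude γ h e.out.2 w) ^ 2 := by
  have : detect β e b w (historyState γ M h) = fun _ => ((Real.sqrt (β / 2) *
      (Real.sqrt (1 / (2 * M)) * (amplitude γ h e.out.1 w +
        (if b then 1 else -1) * amplitude γ h e.out.2 w)) : ℝ) : ℂ) := by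
    funext y
    simp only [detect, historyState, LinearMap.coe_mk, AddHom.coe_mk]
    cases b <;> simp only [Bool.false_eq_true, if_true, if_false] <;> push_cast <;> ring
  rw [this]
  simp only [normSqSum, Complex.norm_real, Finset.univ_unique, Finset.sum_const,
    Finset.card_singleton, one_smul, norm_mul, mul_pow, Real.norm_eq_abs, sq_abs]
  rw [Real.sq_sqrt (by linarith), Real.sq_sqrt (by positivity)]
  ring

/-- The contribution of the runs that have not detected anything yet. -/
lemma expectFrom_alive {G : DetectorMem M → ℝ} (hG : ∀ j, G (.alive j) = 0) (hG' : G .junk = 0)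
    (us h : List (Sym2 (Fin n))) (hus : ∀ e ∈ us, ¬ e.IsDiag) (j : Fin (M + 1))
    (hj : h.length = j) (hM : h.length + us.length ≤ M) (s : ℕ) :
    (wedgeDetector n M hβ hγβ).expectFrom (fun c _ => G c) us (.alive j)
        (embed n (historyState γ M h)) s =
      overHistory (fun h e => ∑ r : Bool × Fin n,
        normSqSum (detect β e r.1 r.2 (historyState γ M h)) * G (.done r.1)) h us := by
  induction us generalizing h j s with
  | nil =>
    refine (Fintype.sum_unique (ι := Unit) _).trans ?_
    exact (congrArg (_ * ·) (hG j)).trans (mul_zero _)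
  | cons e us ih =>
    obtain ⟨j, hjM⟩ := j
    dsimp only at hj
    subst hj
    have hc : ¬ e.IsDiag ∧ h.length < M :=
      ⟨hus e (by simp), by rw [List.length_cons] at hM; omega⟩
    rw [expectFrom_cons]
    have hupd : (wedgeDetector n M hβ hγβ).update (.alive ⟨h.length, hjM⟩) e =
        .ofContraction (detectorNext hc.2) (detectorKraus γ β e hc.2) .junk
          (detectorKraus_contraction hβ hγβ hc.1 hc.2) := dif_pos hc
    rw [hupd]
    refine (QuantumOperation.sum_ofContraction (detectorNext hc.2) (detectorKraus γ β e hc.2) .junk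
      (detectorKraus_contraction hβ hγβ hc.1 hc.2)
      (fun c ψ => (wedgeDetector n M hβ hγβ).expectFrom (fun c _ => G c) us c ψ
        (max s ((wedgeDetector n M hβ hγβ).space c)))
      (fun φ => expectFrom_junk hβ hγβ hG' us φ _) _).trans ?_
    refine (Fintype.sum_option _).trans ?_
    rw [overHistory, add_comm]
    refine congrArg₂ (· + ·) (Finset.sum_congr rfl fun r _ => ?_) ?_
    · refine (expectFrom_done hβ hγβ G us r.1 _ _).trans ?_
      refine congrArg (fun v => normSqSum v * G (.done r.1)) ?_
      refine (detectorKraus_some M γ β e hc.2 r _).trans ?_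
      rw [restrict_embed]
    · have h1 := detectorKraus_none M γ β e hc.2 (embed n (historyState γ M h))
      rw [restrict_embed, advance_historyState γ e hc.2] at h1
      refine (congrArg (fun v => (wedgeDetector n M hβ hγβ).expectFrom (fun c _ => G c) us
        (detectorNext hc.2 none) v _) h1).trans ?_
      refine ih (e :: h) (fun e he => hus e (by simp [he])) _ (by simp) ?_ _
      rw [List.length_cons] at hM ⊢
      omega

lemma expect_wedgeDetector (hM : 0 < M) {G : DetectorMem M → ℝ} (hG : ∀ j, G (.alive j) = 0)
    (hG' : G .junk = 0) (σ : List (Sym2 (Fin n))) (hσ : ∀ e ∈ σ, ¬ e.IsDiag) (hσM : σ.length ≤ M) :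
    (wedgeDetector n M hβ hγβ).expect (fun c _ => G c) σ =
      overHistory (fun h e => ∑ r : Bool × Fin n,
        normSqSum (detect β e r.1 r.2 (historyState γ M h)) * G (.done r.1)) [] σ := by
  have h0 : startKraus n () *ᵥ (fun _ => 1) = embed n (historyState γ M []) := by
    rw [startKraus_mulVec, one_smul]
    congr 1
    funext x
    rcases x with _ | p
    · have : (M : ℝ) ≠ 0 := by positivity
      simp [historyState, this]
    · simp [historyState, amplitude]
  refine (QuantumOperation.sum_ofContraction (qubits := detectorQubits n)
      (fun _ => .alive 0) (startKraus n) .junk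
      (startKraus_contraction n)
      (fun c ψ => (wedgeDetector n M hβ hγβ).expectFrom (fun c _ => G c) σ c ψ
        ((wedgeDetector n M hβ hγβ).space c))
      (fun φ => expectFrom_junk hβ hγβ hG' σ φ _) _).trans ?_
  refine (Fintype.sum_unique (ι := Unit) _).trans ?_
  refine (congrArg (fun v => (wedgeDetector n M hβ hγβ).expectFrom (fun c _ => G c) σ
        (.alive 0) v _) h0).trans ?_
  exact expectFrom_alive hβ hγβ hG hG' σ [] hσ 0 rfl (by simpa using hσM) _

/-- The quantum algorithm estimates the weighted number of triangles. -/
theorem estimates_wedgeDetector (hn : 2 ≤ Nat.size n) (hM : 0 < M) (hMn : M ≤ n ^ 2) (hβ' : 0 < β)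
    (σ : List (Sym2 (Fin n))) (hσ : ∀ e ∈ σ, ¬ e.IsDiag) (hσM : σ.length ≤ M) :
    (wedgeDetector n M hβ hγβ).Estimates σ
      (overHistory (fun h e => ∑ w, amplitude γ h e.out.1 w * amplitude γ h e.out.2 w) [] σ)
      ((M / β) ^ 2) (12 * Nat.size n : ℕ) := by
  have hM' : (M : ℝ) ≠ 0 := by positivity
  have hmean : (wedgeDetector n M hβ hγβ).expect
      (fun c _ => (wedgeDetector n M hβ hγβ).output c) σ =
      overHistory (fun h e => ∑ w, amplitude γ h e.out.1 w * amplitude γ h e.out.2 w) [] σ := by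
    refine (expect_wedgeDetector hβ hγβ hM (G := (wedgeDetector n M hβ hγβ).output)
      (fun _ => rfl) rfl σ hσ hσM).trans ?_
    congr 1
    funext h e
    rw [Fintype.sum_prod_type_right]
    refine Finset.sum_congr rfl fun w _ => ?_
    -- The two signs give the difference of `(a + b) ^ 2` and `(a - b) ^ 2`.
    simp only [Fintype.sum_bool, normSqSum_detect_historyState hβ, if_true, Bool.false_eq_true,
      if_false]
    field_simp
    ring
  refine ⟨hmean, ?_, ?_⟩
  · have hsq : ∀ c : DetectorMem M, (wedgeDetector n M hβ hγβ).output c ^ 2 ≤ (M / β) ^ 2 := by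
      rintro (_ | b | _)
      · exact (zero_pow two_ne_zero).trans_le (sq_nonneg _)
      · cases b <;> simp
      · exact (zero_pow two_ne_zero).trans_le (sq_nonneg _)
    set μ := overHistory (fun h e => ∑ w, amplitude γ h e.out.1 w * amplitude γ h e.out.2 w) [] σ
    have h1 := expect_affine_sq (A := wedgeDetector n M hβ hγβ) (σ := σ) μ μ
      (wedgeDetector n M hβ hγβ).output
    rw [hmean] at h1
    have h2 : (wedgeDetector n M hβ hγβ).expect
        (fun c _ => ((wedgeDetector n M hβ hγβ).output c - μ + μ) ^ 2) σ ≤ (M / β) ^ 2 := by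
      rw [← (wedgeDetector n M hβ hγβ).expect_const σ ((M / β) ^ 2)]
      refine expect_mono _ _ fun c _ => ?_
      rw [sub_add_cancel]
      exact hsq c
    nlinarith [sq_nonneg μ]
  · refine expectedSpace_le_of_space_le _ _ fun c => ?_
    have hpow : 2 ^ 2 ≤ 2 ^ (2 * Nat.size n) := Nat.pow_le_pow_right (by norm_num) (by omega)
    have hMpow : M < 2 ^ (2 * Nat.size n) := by
      refine hMn.trans_lt ?_
      rw [mul_comm 2, pow_mul]
      exact Nat.pow_lt_pow_left (Nat.lt_size_self n) (by norm_num)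
    have hlen : (encodeNats c.toNats).length ≤ (2 * (2 * Nat.size n) + 1) * c.toNats.length := by
      refine length_encodeNats_le fun k hk => ?_
      rcases c with j | b | _ <;> simp only [DetectorMem.toNats, List.mem_cons, List.not_mem_nil,
        or_false] at hk
      · rcases hk with rfl | rfl
        · omega
        · have := j.2; omega
      · have : b.toNat ≤ 1 := Bool.toNat_le b
        omega
    rcases c with j | b | _ <;> simp only [space, detectorQubits, registerSize] at hlen ⊢ <;>
      simp only [DetectorMem.toNats, List.length_cons, List.length_nil] at hlen ⊢ <;> omega

end detector

/-! ### Four-wise independent hashing -/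

section hashing

variable {P : ℕ} [Fact P.Prime]

/-- The cubic polynomial with coefficients `c`, evaluated at `x`. -/
def cubicHash (c : Fin 4 → ZMod P) (x : ZMod P) : ZMod P :=
  ∑ i : Fin 4, x ^ (i : ℕ) * c i

/-- The values of a uniformly random cubic polynomial at four distinct points are independent and
uniform. -/
lemma sum_prod_cubicHash {x : Fin 4 → ZMod P} (hx : Function.Injective x)
    (f : Fin 4 → ZMod P → ℝ) :
    ∑ c, ∏ j, f j (cubicHash c (x j)) = ∏ j, ∑ y, f j y := by
  have hV : ∀ c j, cubicHash c (x j) = (Matrix.vandermonde x *ᵥ c) j := fun c j => rfl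
  have hinj : Function.Injective (Matrix.vandermonde x).mulVec :=
    Matrix.mulVec_injective_of_isUnit ((Matrix.isUnit_iff_isUnit_det _).2
      (isUnit_iff_ne_zero.2 (Matrix.det_vandermonde_ne_zero_iff.2 hx)))
  have hbij := Finite.injective_iff_bijective.1 hinj
  simp only [hV]
  rw [hbij.sum_comp fun y : Fin 4 → ZMod P => ∏ j, f j (y j), Finset.prod_univ_sum,
    Fintype.piFinset_univ]

open Classical in
/-- At most four distinct keys are selected independently, each with probability `|S| / P`. -/
lemma sum_prod_selected {V : Type*} (hP : 4 ≤ P) (key : V → ZMod P)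
    (hkey : Function.Injective key) (S : Finset (ZMod P)) {s : Finset V} (hs : s.card ≤ 4) :
    ∑ c : Fin 4 → ZMod P, ((P : ℝ) ^ 4)⁻¹ *
        ∏ v ∈ s, (if cubicHash c (key v) ∈ S then (1 : ℝ) else 0) =
      ((S.card : ℝ) / P) ^ s.card := by
  have hP0 : (P : ℝ) ≠ 0 := by positivity
  obtain ⟨t, hst, ht⟩ := Finset.exists_superset_card_eq (s := s.image key) (n := 4)
    (by rwa [Finset.card_image_of_injective _ hkey]) (by rwa [ZMod.card])
  obtain ⟨x⟩ : Nonempty (Fin 4 ≃ t) := ⟨(Finset.equivFinOfCardEq ht).symm⟩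
  have hxi : Function.Injective fun j => (x j : ZMod P) :=
    Subtype.val_injective.comp x.injective
  set f : ZMod P → ZMod P → ℝ := fun z y =>
    if z ∈ s.image key then (if y ∈ S then 1 else 0) else 1 with hf
  have h1 : ∀ c, ∏ v ∈ s, (if cubicHash c (key v) ∈ S then (1 : ℝ) else 0) =
      ∏ j, f (x j) (cubicHash c (x j)) := by
    intro c
    rw [x.prod_comp fun z : t => f z (cubicHash c z),
      Finset.prod_coe_sort t fun z => f z (cubicHash c z), Finset.prod_ite_mem,
      Finset.inter_eq_right.2 hst, Finset.prod_image fun a _ b _ h => hkey h]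
  have h2 : ∏ j, ∑ y, f (x j) y = (S.card : ℝ) ^ s.card * P ^ (4 - s.card) := by
    have h3 : ∀ z, ∑ y, f z y = if z ∈ s.image key then (S.card : ℝ) else P := by
      intro z
      by_cases hz : z ∈ s.image key
      · simp only [hf, if_pos hz]; simp
      · simp only [hf, if_neg hz]; simp [ZMod.card]
    simp only [h3]
    rw [x.prod_comp fun z : t => if (z : ZMod P) ∈ s.image key then (S.card : ℝ) else P,
      Finset.prod_coe_sort t fun z => if z ∈ s.image key then (S.card : ℝ) else P,
      Finset.prod_ite, Finset.prod_const, Finset.prod_const, Finset.filter_mem_eq_inter,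
      Finset.inter_eq_right.2 hst, Finset.filter_notMem_eq_sdiff,
      Finset.card_sdiff_of_subset hst, ht, Finset.card_image_of_injective _ hkey]
  simp only [h1]
  rw [← Finset.mul_sum, sum_prod_cubicHash hxi fun j => f (x j), h2, div_pow,
    ← pow_sub_mul_pow (P : ℝ) hs]
  field_simp

end hashing

/-! ### The classical data structure -/

/-- A directed edge `(x, w)` with its age. -/
abbrev Entry (n : ℕ) : Type := Fin n × Fin n × ℕ

section recorder

variable {n : ℕ} (keep : Fin n → Fin n → Prop) (g : ℕ)

open Classical in
/-- The update of the classical algorithm. The state is a counter and a list of directed edges with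
their ages. At the update `uv` the counter goes up by the number of `w` such that both `uw` and `vw`
are in the list, with total age at least `g`. Then the ages are updated, and those directions of the
new edge that satisfy `keep` are put on the list. -/
def recordStep (q : ℕ × List (Entry n)) (e : Sym2 (Fin n)) : ℕ × List (Entry n) :=
  (q.1 + (Finset.univ.filter fun w => ∃ d d', (e.out.1, w, d) ∈ q.2 ∧ (e.out.2, w, d') ∈ q.2 ∧
      g ≤ d + d').card,
    (if keep e.out.1 e.out.2 then [(e.out.1, e.out.2, 0)] else []) ++
    (if keep e.out.2 e.out.1 then [(e.out.2, e.out.1, 0)] else []) ++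
    q.2.map fun t => (t.1, t.2.1, t.2.2 + if t.1 ∈ e then 1 else 0))

/-- The state of the classical algorithm after the history `h`. -/
def recordState : List (Sym2 (Fin n)) → ℕ × List (Entry n)
  | [] => (0, [])
  | e :: h => recordStep keep g (recordState h) e

lemma foldl_recordStep (us h : List (Sym2 (Fin n))) :
    us.foldl (recordStep keep g) (recordState keep g h) = recordState keep g (us.reverse ++ h) := by
  induction us generalizing h with
  | nil => rfl
  | cons e us ih =>
    rw [List.foldl_cons, List.reverse_cons, List.append_assoc]
    exact ih (e :: h)

open Classical in
lemma mem_recordState {h : List (Sym2 (Fin n))} (hnd : h.Nodup)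
    (x w : Fin n) (d : ℕ) :
    (x, w, d) ∈ (recordState keep g h).2 ↔ s(x, w) ∈ h ∧ keep x w ∧ d = age h x w := by
  induction h generalizing x w d with
  | nil => simp [recordState]
  | cons e h ih =>
    obtain ⟨heh, hnd⟩ := List.nodup_cons.1 hnd
    have ih := ih hnd
    have hmap : (x, w, d) ∈ ((recordState keep g h).2.map
        fun t => (t.1, t.2.1, t.2.2 + if t.1 ∈ e then 1 else 0)) ↔
        s(x, w) ∈ h ∧ keep x w ∧ d = age h x w + if x ∈ e then 1 else 0 := by
      constructor
      · intro hm
        obtain ⟨⟨x', w', d'⟩, ht, he⟩ := List.mem_map.1 hm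
        simp only [Prod.mk.injEq] at he
        obtain ⟨rfl, rfl, rfl⟩ := he
        obtain ⟨h1, h2, rfl⟩ := (ih _ _ _).1 ht
        exact ⟨h1, h2, rfl⟩
      · rintro ⟨h1, h2, rfl⟩
        exact List.mem_map.2 ⟨(x, w, age h x w), (ih _ _ _).2 ⟨h1, h2, rfl⟩, rfl⟩
    have hnew : (x, w, d) ∈ (if keep e.out.1 e.out.2 then [(e.out.1, e.out.2, 0)] else []) ++
        (if keep e.out.2 e.out.1 then [(e.out.2, e.out.1, 0)] else []) ↔
        e = s(x, w) ∧ keep x w ∧ d = 0 := by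
      rw [show (e = s(x, w)) ↔ (s(e.out.1, e.out.2) = s(x, w)) by rw [mk_out], Sym2.eq_iff]
      constructor
      · intro hm
        rcases List.mem_append.1 hm with hm | hm <;> split_ifs at hm with hk
        · simp only [List.mem_singleton, Prod.mk.injEq] at hm
          obtain ⟨rfl, rfl, rfl⟩ := hm
          exact ⟨.inl ⟨rfl, rfl⟩, hk, rfl⟩
        · simp at hm
        · simp only [List.mem_singleton, Prod.mk.injEq] at hm
          obtain ⟨rfl, rfl, rfl⟩ := hm
          exact ⟨.inr ⟨rfl, rfl⟩, hk, rfl⟩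
        · simp at hm
      · rintro ⟨⟨rfl, rfl⟩ | ⟨rfl, rfl⟩, hk, rfl⟩ <;> simp [hk]
    have hrec : (recordState keep g (e :: h)).2 =
        (if keep e.out.1 e.out.2 then [(e.out.1, e.out.2, 0)] else []) ++
        (if keep e.out.2 e.out.1 then [(e.out.2, e.out.1, 0)] else []) ++
        (recordState keep g h).2.map fun t => (t.1, t.2.1, t.2.2 + if t.1 ∈ e then 1 else 0) := by
      simp only [recordState, recordStep]
    rw [hrec, List.mem_append, hnew, hmap, age, List.mem_cons]
    by_cases he : e = s(x, w)
    · subst he; simp [heh]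
    · simp [he, Ne.symm he]

open Classical in
/-- The triangles that the update `e` completes and the classical algorithm notices. -/
def noticed (h : List (Sym2 (Fin n))) (e : Sym2 (Fin n)) : Finset (Fin n) :=
  Finset.univ.filter fun w => s(e.out.1, w) ∈ h ∧ s(e.out.2, w) ∈ h ∧ keep e.out.1 w ∧
    keep e.out.2 w ∧ g ≤ age h e.out.1 w + age h e.out.2 w

lemma recordState_cons_fst {h : List (Sym2 (Fin n))} (hnd : h.Nodup) (e : Sym2 (Fin n)) :
    (recordState keep g (e :: h)).1 = (recordState keep g h).1 + (noticed keep g h e).card := by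
  simp only [recordState, recordStep, noticed]
  congr 2
  ext w
  simp only [Finset.mem_filter, Finset.mem_univ, true_and, mem_recordState keep g hnd]
  constructor
  · rintro ⟨d, d', ⟨h1, h2, rfl⟩, ⟨h3, h4, rfl⟩, h5⟩
    exact ⟨h1, h3, h2, h4, h5⟩
  · rintro ⟨h1, h3, h2, h4, h5⟩
    exact ⟨_, _, ⟨h1, h2, rfl⟩, ⟨h3, h4, rfl⟩, h5⟩

lemma recordState_fst_eq_overHistory (us h : List (Sym2 (Fin n))) (hnd : (us.reverse ++ h).Nodup) :
    (recordState keep g (us.reverse ++ h)).1 = (recordState keep g h).1 +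
      overHistory (fun h e => (noticed keep g h e).card) h us := by
  induction us generalizing h with
  | nil => rfl
  | cons e us ih =>
    rw [List.reverse_cons, List.append_assoc] at hnd ⊢
    have h1 := ih (e :: h) hnd
    have h2 : h.Nodup := (List.nodup_cons.1 (List.nodup_append.1 hnd).2.1).2
    rw [List.singleton_append, h1, recordState_cons_fst keep g h2, overHistory, add_assoc]

open Classical in
lemma recordState_fst_le (h : List (Sym2 (Fin n))) :
    (recordState keep g h).1 ≤ h.length * n := by
  induction h with
  | nil => simp [recordState]
  | cons e h ih =>
    simp only [recordState, recordStep, List.length_cons]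
    have := Finset.card_filter_le (Finset.univ : Finset (Fin n)) fun w =>
      ∃ d d', (e.out.1, w, d) ∈ (recordState keep g h).2 ∧
        (e.out.2, w, d') ∈ (recordState keep g h).2 ∧ g ≤ d + d'
    rw [Finset.card_univ, Fintype.card_fin] at this
    rw [add_one_mul]
    exact add_le_add ih (by convert this)

lemma age_le_length (h : List (Sym2 (Fin n))) (x w : Fin n) : age h x w ≤ h.length := by
  induction h with
  | nil => simp [age]
  | cons e h ih => rw [age, List.length_cons]; split_ifs <;> omega

lemma le_length_of_mem_recordState {h : List (Sym2 (Fin n))} {t : Entry n}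
    (ht : t ∈ (recordState keep g h).2) : t.2.2 ≤ h.length := by
  induction h generalizing t with
  | nil => simp [recordState] at ht
  | cons e h ih =>
    simp only [recordState, recordStep] at ht
    rw [List.mem_append, List.mem_append] at ht
    rcases ht with (ht | ht) | ht
    · split_ifs at ht <;> simp at ht
      simp [ht]
    · split_ifs at ht <;> simp at ht
      simp [ht]
    · obtain ⟨t', ht', rfl⟩ := List.mem_map.1 ht
      have := ih ht'
      dsimp only
      rw [List.length_cons]
      split_ifs <;> omega

open Classical in
lemma length_recordState (h : List (Sym2 (Fin n))) :
    (recordState keep g h).2.length = (h.map fun e => (if keep e.out.1 e.out.2 then 1 else 0) +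
      if keep e.out.2 e.out.1 then 1 else 0).sum := by
  induction h with
  | nil => simp [recordState]
  | cons e h ih =>
    simp only [recordState, recordStep, List.length_append, List.length_map, ih, List.map_cons,
      List.sum_cons]
    congr 1
    congr 1 <;> split_ifs <;> rfl

end recorder

lemma flatMap_entry_injective {n : ℕ} : Function.Injective fun l : List (Entry n) =>
    l.flatMap fun t => [t.1.val, t.2.1.val, t.2.2] := by
  intro l l' h
  induction l generalizing l' with
  | nil =>
    cases l' with
    | nil => rfl
    | cons b l' => simp at h
  | cons a l ih =>
    cases l' with
    | nil => simp at h
    | cons b l' =>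
      simp only [List.flatMap_cons, List.cons_append, List.nil_append, List.cons.injEq] at h
      obtain ⟨h1, h2, h3, h4⟩ := h
      rw [ih h4, Prod.ext (Fin.ext h1) (Prod.ext (Fin.ext h2) h3)]

/-! ### Triangles in the order in which a stream completes them -/

section order

variable {U : Type*} [DecidableEq U]

/-- The history at the update `e` of the stream `σ`. -/
def before (σ : List U) (e : U) : List U := (σ.takeWhile fun a => a ≠ e).reverse

lemma before_cons_self (e : U) (us : List U) : before (e :: us) e = [] := by simp [before]

lemma before_cons_of_ne {a e : U} (h : a ≠ e) (us : List U) :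
    before (a :: us) e = before us e ++ [a] := by simp [before, h]

lemma mem_of_mem_before {σ : List U} {a e : U} (h : a ∈ before σ e) : a ∈ σ :=
  (List.takeWhile_sublist _).subset (List.mem_reverse.1 h)

lemma overHistory_eq_sum {R : Type*} [AddCommMonoid R] (f : List U → U → R) (us h : List U)
    (hnd : us.Nodup) : overHistory f h us = ∑ e ∈ us.toFinset, f (before us e ++ h) e := by
  induction us generalizing h with
  | nil => rfl
  | cons a us ih =>
    obtain ⟨ha, hnd⟩ := List.nodup_cons.1 hnd
    rw [overHistory, ih _ hnd, List.toFinset_cons, Finset.sum_insert (by simpa using ha),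
      before_cons_self, List.nil_append]
    congr 1
    refine Finset.sum_congr rfl fun e he => ?_
    have : a ≠ e := fun h => ha (by rw [h]; simpa using he)
    rw [before_cons_of_ne this, List.append_assoc, List.singleton_append]

end order

variable {n : ℕ}

/-- The third vertices of the triangles that the update `e` completes. -/
def apexes (h : List (Sym2 (Fin n))) (e : Sym2 (Fin n)) : Finset (Fin n) :=
  Finset.univ.filter fun w => s(e.out.1, w) ∈ h ∧ s(e.out.2, w) ∈ h

/-- The triangles of a stream, each given by its last edge and the vertex opposite to it. -/
def triangles (σ : List (Sym2 (Fin n))) : Finset (Sym2 (Fin n) × Fin n) :=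
  (σ.toFinset ×ˢ Finset.univ).filter fun τ => τ.2 ∈ apexes (before σ τ.1) τ.1

/-- The two earlier edges of a triangle, directed to the vertex opposite to the last one. -/
def wedge (τ : Sym2 (Fin n) × Fin n) : Finset (Fin n × Fin n) :=
  {(τ.1.out.1, τ.2), (τ.1.out.2, τ.2)}

/-- The total age of the two earlier edges of a triangle when its last edge arrives. -/
def totalAge (σ : List (Sym2 (Fin n))) (τ : Sym2 (Fin n) × Fin n) : ℕ :=
  age (before σ τ.1) τ.1.out.1 τ.2 + age (before σ τ.1) τ.1.out.2 τ.2

lemma overHistory_apexes {R : Type*} [AddCommMonoid R] {σ : List (Sym2 (Fin n))} (hnd : σ.Nodup)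
    (f : List (Sym2 (Fin n)) → Sym2 (Fin n) → Fin n → R) :
    overHistory (fun h e => ∑ w ∈ apexes h e, f h e w) [] σ =
      ∑ τ ∈ triangles σ, f (before σ τ.1) τ.1 τ.2 := by
  rw [overHistory_eq_sum _ _ _ hnd, triangles, Finset.sum_filter, Finset.sum_product]
  refine Finset.sum_congr rfl fun e _ => ?_
  rw [List.append_nil, ← Finset.sum_filter]
  exact Finset.sum_congr (by ext; simp) fun _ _ => rfl

lemma mem_wedge {τ : Sym2 (Fin n) × Fin n} {p : Fin n × Fin n} :
    p ∈ wedge τ ↔ p.1 ∈ τ.1 ∧ p.2 = τ.2 := by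
  obtain ⟨x, w⟩ := p
  simp only [wedge, Finset.mem_insert, Finset.mem_singleton, Prod.mk.injEq, mem_iff_out]
  tauto

lemma wedge_injective : Function.Injective (wedge (n := n)) := by
  rintro ⟨e, w⟩ ⟨e', w'⟩ h
  have h1 : ∀ x z, (x ∈ e ∧ z = w) ↔ (x ∈ e' ∧ z = w') := fun x z => by
    have := congrArg (fun s => (x, z) ∈ s) h
    simpa [mem_wedge] using this
  have hw : w = w' := ((h1 e.out.1 w).1 ⟨Sym2.out_fst_mem e, rfl⟩).2
  subst hw
  have : e = e' := Sym2.ext fun x => by simpa using h1 x w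
  rw [this]

lemma card_wedge {τ : Sym2 (Fin n) × Fin n} (h : ¬ τ.1.IsDiag) : (wedge τ).card = 2 := by
  rw [wedge, Finset.card_pair]
  simpa using out_ne h

section bounds

variable {σ : List (Sym2 (Fin n))} {D : ℕ}

lemma mem_triangles {τ : Sym2 (Fin n) × Fin n} : τ ∈ triangles σ ↔ τ.1 ∈ σ ∧
    s(τ.1.out.1, τ.2) ∈ before σ τ.1 ∧ s(τ.1.out.2, τ.2) ∈ before σ τ.1 := by
  simp [triangles, apexes]

lemma mem_of_mem_wedge {τ : Sym2 (Fin n) × Fin n} (hτ : τ ∈ triangles σ) {x w : Fin n}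
    (h : (x, w) ∈ wedge τ) : s(x, w) ∈ σ := by
  obtain ⟨_, h1, h2⟩ := mem_triangles.1 hτ
  simp only [wedge, Finset.mem_insert, Finset.mem_singleton, Prod.mk.injEq] at h
  rcases h with ⟨rfl, rfl⟩ | ⟨rfl, rfl⟩
  exacts [mem_of_mem_before h1, mem_of_mem_before h2]

lemma card_triangles_le (hD : ∀ a b, s(a, b) ∈ σ →
    (Finset.univ.filter fun x => s(a, x) ∈ σ ∧ s(b, x) ∈ σ).card ≤ D)
    (hnd : σ.Nodup) : (triangles σ).card ≤ σ.length * D := by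
  have h := overHistory_apexes hnd fun _ _ _ => 1
  rw [Finset.sum_const, smul_eq_mul, mul_one] at h
  rw [← h, overHistory_eq_sum _ _ _ hnd, ← List.toFinset_card_of_nodup hnd, ← smul_eq_mul]
  refine Finset.sum_le_card_nsmul _ _ _ fun e he => ?_
  rw [Finset.sum_const, smul_eq_mul, mul_one, List.append_nil]
  refine (Finset.card_le_card fun w hw => ?_).trans
    (hD e.out.1 e.out.2 (by rw [mk_out]; simpa using he))
  simp only [apexes, Finset.mem_filter, Finset.mem_univ, true_and] at hw ⊢
  exact ⟨mem_of_mem_before hw.1, mem_of_mem_before hw.2⟩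

lemma card_triangles_wedge_le (hD : ∀ a b, s(a, b) ∈ σ →
    (Finset.univ.filter fun x => s(a, x) ∈ σ ∧ s(b, x) ∈ σ).card ≤ D)
    (p : Fin n × Fin n) :
    ((triangles σ).filter fun τ => p ∈ wedge τ).card ≤ D := by
  obtain ⟨x, w⟩ := p
  rcases Finset.eq_empty_or_nonempty ((triangles σ).filter fun τ => (x, w) ∈ wedge τ) with h | h
  · simp [h]
  obtain ⟨τ₀, hτ₀⟩ := h
  rw [Finset.mem_filter] at hτ₀
  refine le_trans ?_ (hD x w (mem_of_mem_wedge hτ₀.1 hτ₀.2))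
  refine (Finset.card_le_card (t := (Finset.univ.filter fun y => s(x, y) ∈ σ ∧ s(w, y) ∈ σ).image
    fun y => (s(x, y), w)) fun τ hτ => ?_).trans Finset.card_image_le
  obtain ⟨hτ, hp⟩ := Finset.mem_filter.1 hτ
  obtain ⟨hx, hw⟩ := mem_wedge.1 hp
  obtain ⟨h1, -, -⟩ := mem_triangles.1 hτ
  have hy : s(x, Sym2.Mem.other hx) = τ.1 := Sym2.other_spec hx
  have hyw : (Sym2.Mem.other hx, τ.2) ∈ wedge τ := mem_wedge.2 ⟨Sym2.other_mem hx, rfl⟩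
  refine Finset.mem_image.2 ⟨Sym2.Mem.other hx, ?_, ?_⟩
  · simp only [Finset.mem_filter, Finset.mem_univ, true_and]
    refine ⟨by rwa [hy], ?_⟩
    have := mem_of_mem_wedge hτ hyw
    rw [Sym2.eq_swap, show w = τ.2 from hw]
    exact this
  · rw [hy, show w = τ.2 from hw]

lemma card_triangles_sharing_le (hD : ∀ a b, s(a, b) ∈ σ →
    (Finset.univ.filter fun x => s(a, x) ∈ σ ∧ s(b, x) ∈ σ).card ≤ D)
    (τ : Sym2 (Fin n) × Fin n) :
    ((triangles σ).filter fun τ' => ¬ Disjoint (wedge τ) (wedge τ')).card ≤ 2 * D := by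
  have : ((triangles σ).filter fun τ' => ¬ Disjoint (wedge τ) (wedge τ')) ⊆
      (triangles σ).filter (fun τ' => (τ.1.out.1, τ.2) ∈ wedge τ') ∪
      (triangles σ).filter fun τ' => (τ.1.out.2, τ.2) ∈ wedge τ' := by
    intro τ' h
    simp only [Finset.mem_filter, Finset.not_disjoint_iff, Finset.mem_union] at h ⊢
    obtain ⟨h1, p, h2, h3⟩ := h
    simp only [wedge, Finset.mem_insert, Finset.mem_singleton] at h2
    rcases h2 with rfl | rfl
    exacts [.inl ⟨h1, h3⟩, .inr ⟨h1, h3⟩]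
  refine (Finset.card_le_card this).trans ((Finset.card_union_le _ _).trans ?_)
  have h1 := card_triangles_wedge_le hD (τ.1.out.1, τ.2)
  have h2 := card_triangles_wedge_le hD (τ.1.out.2, τ.2)
  omega

lemma age_le_countP (h : List (Sym2 (Fin n))) (x w : Fin n) :
    age h x w ≤ h.countP fun e => x ∈ e := by
  induction h with
  | nil => simp [age]
  | cons e h ih =>
    rw [age, List.countP_cons]
    by_cases h1 : e = s(x, w) <;> by_cases h2 : x ∈ e <;> simp [h1, h2] <;> omega

lemma age_before_le (x w : Fin n) (e : Sym2 (Fin n)) :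
    age (before σ e) x w ≤ σ.countP fun e => x ∈ e := by
  refine (age_le_countP _ _ _).trans ?_
  rw [before, List.countP_reverse]
  exact (List.takeWhile_sublist _).countP_le

lemma sum_countP_mem (hdiag : ∀ e ∈ σ, ¬ e.IsDiag) :
    ∑ x, σ.countP (fun e => x ∈ e) = 2 * σ.length := by
  induction σ with
  | nil => simp
  | cons e us ih =>
    simp only [List.countP_cons, Finset.sum_add_distrib, List.length_cons]
    rw [ih fun e he => hdiag e (by simp [he])]
    have : (∑ x, if decide (x ∈ e) = true then 1 else 0) = 2 := by
      simp only [decide_eq_true_eq, Finset.sum_boole, Nat.cast_id]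
      have h : (Finset.univ.filter fun x => x ∈ e) = {e.out.1, e.out.2} := by
        ext x; simp [mem_iff_out]
      rw [h, Finset.card_pair (out_ne (hdiag e (by simp)))]
    rw [this]; ring

/-- At each vertex `w` the total ages add up to at most `2 m D`: an edge `xw` is in at most `D`
triangles and its age is at most the degree of `x`. -/
lemma sum_totalAge_le (hD : ∀ a b, s(a, b) ∈ σ →
    (Finset.univ.filter fun x => s(a, x) ∈ σ ∧ s(b, x) ∈ σ).card ≤ D)
    (hdiag : ∀ e ∈ σ, ¬ e.IsDiag) (w : Fin n) :
    ∑ τ ∈ (triangles σ).filter (fun τ => τ.2 = w), totalAge σ τ ≤ 2 * σ.length * D := by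
  calc ∑ τ ∈ (triangles σ).filter (fun τ => τ.2 = w), totalAge σ τ
      ≤ ∑ τ ∈ (triangles σ).filter (fun τ => τ.2 = w),
          ∑ x, if (x, w) ∈ wedge τ then σ.countP (fun e => x ∈ e) else 0 := by
        refine Finset.sum_le_sum fun τ hτ => ?_
        obtain ⟨hτ', rfl⟩ := Finset.mem_filter.1 hτ
        have hne := out_ne (hdiag _ (mem_triangles.1 hτ').1)
        have h : (Finset.univ.filter fun x => (x, τ.2) ∈ wedge τ) = {τ.1.out.1, τ.1.out.2} := by
          ext x; simp [wedge]
        rw [← Finset.sum_filter, h, Finset.sum_pair hne]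
        exact add_le_add (age_before_le _ _ _) (age_before_le _ _ _)
    _ = ∑ x, ((triangles σ).filter fun τ => τ.2 = w ∧ (x, w) ∈ wedge τ).card *
          σ.countP (fun e => x ∈ e) := by
        rw [Finset.sum_comm]
        refine Finset.sum_congr rfl fun x _ => ?_
        rw [← Finset.sum_filter, Finset.filter_filter, Finset.sum_const, smul_eq_mul]
    _ ≤ ∑ x, D * σ.countP (fun e => x ∈ e) := by
        refine Finset.sum_le_sum fun x _ => Nat.mul_le_mul_right _ ?_
        refine (Finset.card_le_card fun τ hτ => ?_).trans (card_triangles_wedge_le hD (x, w))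
        simp only [Finset.mem_filter] at hτ ⊢
        exact ⟨hτ.1, hτ.2.2⟩
    _ = 2 * σ.length * D := by rw [← Finset.mul_sum, sum_countP_mem hdiag, mul_comm]

end bounds

/-! ### Triangles of a graph and of its streams -/

section graph

/-- The triangles of the graph whose edges are listed by `h`. -/
def triangleSets (h : List (Sym2 (Fin n))) : Finset (Finset (Fin n)) :=
  Finset.univ.filter fun t => t.card = 3 ∧ ∀ x ∈ t, ∀ y ∈ t, x ≠ y → s(x, y) ∈ h

lemma triangleSets_cons {e : Sym2 (Fin n)} {h : List (Sym2 (Fin n))} (he : e ∉ h)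
    (hdiag : ∀ e' ∈ e :: h, ¬ e'.IsDiag) :
    (triangleSets (e :: h)).card = (triangleSets h).card + (apexes h e).card := by
  have hne := out_ne (hdiag e (by simp))
  have hw : ∀ w ∈ apexes h e, w ≠ e.out.1 ∧ w ≠ e.out.2 := by
    intro w hw
    simp only [apexes, Finset.mem_filter, Finset.mem_univ, true_and] at hw
    refine ⟨?_, ?_⟩
    · rintro rfl; exact hdiag _ (List.mem_cons_of_mem _ hw.1) rfl
    · rintro rfl; exact hdiag _ (List.mem_cons_of_mem _ hw.2) rfl
  have hinj : Set.InjOn (fun w => ({e.out.1, e.out.2, w} : Finset (Fin n))) (apexes h e) := by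
    intro w h1 w' h2 heq
    have h3 : w ∈ ({e.out.1, e.out.2, w'} : Finset (Fin n)) := by
      have h4 : w ∈ ({e.out.1, e.out.2, w} : Finset (Fin n)) := by simp
      rwa [show ({e.out.1, e.out.2, w} : Finset (Fin n)) = _ from heq] at h4
    simpa [hw w h1] using h3
  have hdisj : Disjoint (triangleSets h)
      ((apexes h e).image fun w => ({e.out.1, e.out.2, w} : Finset (Fin n))) := by
    rw [Finset.disjoint_left]
    intro t ht ht'
    obtain ⟨w, -, rfl⟩ := Finset.mem_image.1 ht'
    simp only [triangleSets, Finset.mem_filter, Finset.mem_univ, true_and] at ht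
    have := ht.2 e.out.1 (by simp) e.out.2 (by simp) hne
    rw [mk_out] at this
    exact he this
  rw [← Finset.card_image_of_injOn hinj, ← Finset.card_union_of_disjoint hdisj]
  congr 1
  ext t
  simp only [Finset.mem_union, Finset.mem_image]
  constructor
  · intro ht
    simp only [triangleSets, Finset.mem_filter, Finset.mem_univ, true_and] at ht ⊢
    obtain ⟨hc, ht⟩ := ht
    by_cases hin : e.out.1 ∈ t ∧ e.out.2 ∈ t
    · right
      have h1 : ((t.erase e.out.1).erase e.out.2).card = 1 := by
        rw [Finset.card_erase_of_mem (Finset.mem_erase.2 ⟨hne.symm, hin.2⟩),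
          Finset.card_erase_of_mem hin.1, hc]
      obtain ⟨w, hw'⟩ := Finset.card_eq_one.1 h1
      have hwt : w ∈ (t.erase e.out.1).erase e.out.2 := by rw [hw']; simp
      simp only [Finset.mem_erase] at hwt
      refine ⟨w, ?_, ?_⟩
      · simp only [apexes, Finset.mem_filter, Finset.mem_univ, true_and]
        refine ⟨?_, ?_⟩
        · refine (List.mem_cons.1 (ht _ hin.1 _ hwt.2.2 hwt.2.1.symm)).resolve_left fun h => ?_
          have : w ∈ e := by rw [← h]; simp
          rcases mem_iff_out.1 this with h | h
          exacts [hwt.2.1 h, hwt.1 h]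
        · refine (List.mem_cons.1 (ht _ hin.2 _ hwt.2.2 hwt.1.symm)).resolve_left fun h => ?_
          have : w ∈ e := by rw [← h]; simp
          rcases mem_iff_out.1 this with h | h
          exacts [hwt.2.1 h, hwt.1 h]
      · rw [← hw', Finset.insert_erase (Finset.mem_erase.2 ⟨hne.symm, hin.2⟩),
          Finset.insert_erase hin.1]
    · left
      refine ⟨hc, fun x hx y hy hxy => (List.mem_cons.1 (ht x hx y hy hxy)).resolve_left ?_⟩
      intro h
      rw [← mk_out (e := e)] at h
      rcases Sym2.eq_iff.1 h with ⟨rfl, rfl⟩ | ⟨rfl, rfl⟩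
      exacts [hin ⟨hx, hy⟩, hin ⟨hy, hx⟩]
  · rintro (ht | ⟨w, hwm, rfl⟩)
    · simp only [triangleSets, Finset.mem_filter, Finset.mem_univ, true_and] at ht ⊢
      exact ⟨ht.1, fun x hx y hy hxy => List.mem_cons_of_mem _ (ht.2 x hx y hy hxy)⟩
    · obtain ⟨hw1, hw2⟩ := hw w hwm
      simp only [triangleSets, apexes, Finset.mem_filter, Finset.mem_univ, true_and] at hwm ⊢
      refine ⟨Finset.card_eq_three.2 ⟨_, _, _, hne, hw1.symm, hw2.symm, rfl⟩, ?_⟩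
      have he' : s(e.out.1, e.out.2) = e := mk_out
      intro x hx y hy hxy
      simp only [Finset.mem_insert, Finset.mem_singleton] at hx hy
      rcases hx with rfl | rfl | rfl <;> rcases hy with rfl | rfl | rfl <;>
        simp_all [Sym2.eq_swap]

lemma card_triangleSets (us h : List (Sym2 (Fin n))) (hnd : (us.reverse ++ h).Nodup)
    (hdiag : ∀ e ∈ us.reverse ++ h, ¬ e.IsDiag) :
    (triangleSets (us.reverse ++ h)).card = (triangleSets h).card +
      overHistory (fun h e => (apexes h e).card) h us := by
  induction us generalizing h with
  | nil => rfl
  | cons e us ih =>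
    rw [List.reverse_cons, List.append_assoc, List.singleton_append] at hnd hdiag ⊢
    have h2 := List.nodup_cons.1 (List.nodup_append.1 hnd).2.1
    rw [ih (e :: h) hnd hdiag, triangleSets_cons h2.1 fun e' he' => hdiag e'
      (List.mem_append_right _ he'), overHistory, add_assoc]

variable {G : SimpleGraph (Fin n)} {σ : List (Sym2 (Fin n))}

lemma IsGraphStream.not_isDiag (hG : IsGraphStream G σ) : ∀ e ∈ σ, ¬ e.IsDiag :=
  fun e he => G.not_isDiag_of_mem_edgeSet ((hG.2 e).1 he)

lemma IsGraphStream.mem_iff (hG : IsGraphStream G σ) {a b : Fin n} : s(a, b) ∈ σ ↔ G.Adj a b :=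
  hG.2 _

lemma IsGraphStream.card_triangles (hG : IsGraphStream G σ) :
    (triangles σ).card = triangleCount G := by
  have h := overHistory_apexes hG.1 fun _ _ _ => 1
  simp only [Finset.sum_const, smul_eq_mul, mul_one] at h
  have hnd : (σ.reverse ++ []).Nodup := by rw [List.append_nil]; exact List.nodup_reverse.2 hG.1
  have h0 : (triangleSets ([] : List (Sym2 (Fin n)))).card = 0 := by
    rw [Finset.card_eq_zero, Finset.eq_empty_iff_forall_notMem]
    intro t ht
    simp only [triangleSets, Finset.mem_filter, Finset.mem_univ, true_and, List.not_mem_nil] at ht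
    obtain ⟨x, y, z, hxy, -, -, rfl⟩ := Finset.card_eq_three.1 ht.1
    exact ht.2 x (by simp) y (by simp) hxy
  have h1 := card_triangleSets σ [] hnd fun e he => hG.not_isDiag e (by simpa using he)
  rw [h0, zero_add, h] at h1
  rw [← h1, triangleCount]
  congr 1
  ext t
  simp only [triangleSets, Finset.mem_filter, Finset.mem_univ, true_and, List.append_nil,
    List.mem_reverse, hG.mem_iff, SimpleGraph.mem_cliqueFinset_iff, SimpleGraph.isNClique_iff,
    SimpleGraph.isClique_iff, Set.Pairwise, Finset.mem_coe]
  exact and_comm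

lemma IsGraphStream.card_common_le (hG : IsGraphStream G σ) {a b : Fin n} (hab : s(a, b) ∈ σ) :
    (Finset.univ.filter fun x => s(a, x) ∈ σ ∧ s(b, x) ∈ σ).card ≤ maxTrianglesPerEdge G := by
  classical
  have hadj := hG.mem_iff.1 hab
  simp only [hG.mem_iff]
  refine le_trans ?_ (Finset.le_sup (f := fun e =>
    ((G.cliqueFinset 3).filter fun t => ∀ v ∈ e, v ∈ t).card)
    (SimpleGraph.mem_edgeFinset.2 ((G.mem_edgeSet (v := a) (w := b)).2 hadj)))
  refine Finset.card_le_card_of_injOn (fun x => {a, b, x}) ?_ ?_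
  · intro x hx
    simp only [Finset.coe_filter, Finset.mem_univ, true_and, Set.mem_ofPred_eq] at hx
    simp only [Finset.coe_filter, Set.mem_ofPred_eq, SimpleGraph.mem_cliqueFinset_iff,
      SimpleGraph.is3Clique_triple_iff]
    refine ⟨⟨hadj, hx.1, hx.2⟩, fun v hv => ?_⟩
    rcases Sym2.mem_iff.1 hv with rfl | rfl <;> simp
  · intro x hx y hy hxy
    simp only [Finset.coe_filter, Finset.mem_univ, true_and, Set.mem_ofPred_eq] at hx hy
    have h1 : x ∈ ({a, b, y} : Finset (Fin n)) := by
      have : x ∈ ({a, b, x} : Finset (Fin n)) := by simp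
      rwa [show ({a, b, x} : Finset (Fin n)) = _ from hxy] at this
    simpa [hx.1.ne', hx.2.ne'] using h1

lemma card_common_le_length (a b : Fin n) :
    (Finset.univ.filter fun x => s(a, x) ∈ σ ∧ s(b, x) ∈ σ).card ≤ σ.length := by
  refine le_trans ?_ (List.toFinset_card_le σ)
  refine Finset.card_le_card_of_injOn (fun x => s(a, x)) ?_ ?_
  · intro x hx
    simp only [Finset.coe_filter, Finset.mem_univ, true_and, Set.mem_ofPred_eq] at hx
    simpa using hx.1
  · intro x _ y _ hxy
    exact Sym2.congr_right.1 hxy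

lemma length_le_sq (hnd : σ.Nodup) : σ.length ≤ n ^ 2 := by
  rw [← List.toFinset_card_of_nodup hnd]
  refine (Finset.card_le_univ _).trans ?_
  have : Function.Surjective fun p : Fin n × Fin n => s(p.1, p.2) := Sym2.mk_surjective
  refine (Fintype.card_le_of_surjective _ this).trans ?_
  simp [sq]

end graph

/-! ### Moments of the classical algorithm -/

section moments

/-- The random seed of the classical algorithm: a threshold for the age and two cubic polynomials,
one to select vertices and one to select directed edges. -/
abbrev Seed (P N : ℕ) : Type := Fin (N + 1) × (Fin 4 → ZMod P) × (Fin 4 → ZMod P)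

/-- The distribution of the seed: the threshold has distribution `ν` and the polynomials are
uniform. -/
def seedWeight {P N : ℕ} (ν : Fin (N + 1) → ℝ) (ω : Seed P N) : ℝ :=
  ν ω.1 * (((P : ℝ) ^ 4)⁻¹ * ((P : ℝ) ^ 4)⁻¹)

lemma seedWeight_nonneg {P N : ℕ} {ν : Fin (N + 1) → ℝ} (hν : ∀ g, 0 ≤ ν g)
    (ω : Seed P N) : 0 ≤ seedWeight ν ω :=
  mul_nonneg (hν _) (by positivity)

/-- The probability that the threshold is at most `d`. -/
def thresholdCDF {N : ℕ} (ν : Fin (N + 1) → ℝ) (d : ℕ) : ℝ := ∑ g, ν g * if g.val ≤ d then 1 else 0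

variable {n P N : ℕ} [Fact P.Prime]

variable (key : Fin n × Fin n → ZMod P) (S₁ S₂ : Finset (ZMod P))

/-- A directed edge `xw` is kept if both the vertex `w` and the pair `(x, w)` are selected. -/
def keepEdge (ω : Seed P N) (x w : Fin n) : Prop :=
  cubicHash ω.2.1 (key (w, w)) ∈ S₁ ∧ cubicHash ω.2.2 (key (x, w)) ∈ S₂

variable {key} {ν : Fin (N + 1) → ℝ}

open Classical in
/-- The threshold, the selected vertices and the selected pairs are independent, and so are up to four
vertices and up to four pairs. -/
lemma sum_seedWeight_mul (hkey : Function.Injective key) (hP : 4 ≤ P) (A : Fin (N + 1) → ℝ)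
    {s : Finset (Fin n)} {t : Finset (Fin n × Fin n)} (hs : s.card ≤ 4) (ht : t.card ≤ 4) :
    ∑ ω : Seed P N, seedWeight ν ω * (A ω.1 *
      ((if ∀ v ∈ s, cubicHash ω.2.1 (key (v, v)) ∈ S₁ then 1 else 0) *
        if ∀ p ∈ t, cubicHash ω.2.2 (key p) ∈ S₂ then 1 else 0)) =
      (∑ g, ν g * A g) * (((S₁.card : ℝ) / P) ^ s.card * ((S₂.card : ℝ) / P) ^ t.card) := by
  have hdiag : Function.Injective fun v : Fin n => key (v, v) :=
    hkey.comp fun a b h => (Prod.mk.inj h).1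
  rw [← sum_prod_selected hP (fun v : Fin n => key (v, v)) hdiag S₁ hs,
    ← sum_prod_selected hP key hkey S₂ ht, Finset.sum_mul_sum, Finset.sum_mul_sum,
    Fintype.sum_prod_type]
  refine Finset.sum_congr rfl fun g _ => ?_
  rw [Fintype.sum_prod_type]
  refine Finset.sum_congr rfl fun c₁ _ => ?_
  rw [Finset.mul_sum]
  refine Finset.sum_congr rfl fun c₂ _ => ?_
  rw [Finset.prod_boole, Finset.prod_boole, seedWeight]
  ring_nf

lemma sum_seedWeight (hkey : Function.Injective key) (hP : 4 ≤ P) (hν : ∑ g, ν g = 1) :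
    ∑ ω : Seed P N, seedWeight ν ω = 1 := by
  have := sum_seedWeight_mul (ν := ν) ∅ ∅ hkey hP (fun _ => 1) (s := ∅) (t := ∅)
    (by simp) (by simp)
  simpa [hν] using this

open Classical in
/-- The contribution of the triangle `τ` to the counter of the classical algorithm. -/
def contribution (key : Fin n × Fin n → ZMod P) (σ : List (Sym2 (Fin n))) (ω : Seed P N)
    (τ : Sym2 (Fin n) × Fin n) : ℝ :=
  (if ω.1.val ≤ totalAge σ τ then 1 else 0) *
    ((if ∀ v ∈ ({τ.2} : Finset (Fin n)), cubicHash ω.2.1 (key (v, v)) ∈ S₁ then 1 else 0) *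
      if ∀ p ∈ wedge τ, cubicHash ω.2.2 (key p) ∈ S₂ then 1 else 0)

lemma recordState_fst_eq_sum {σ : List (Sym2 (Fin n))} (hnd : σ.Nodup) (ω : Seed P N) :
    ((recordState (keepEdge key S₁ S₂ ω) ω.1 σ.reverse).1 : ℝ) =
      ∑ τ ∈ triangles σ, contribution S₁ S₂ key σ ω τ := by
  classical
  have h1 := recordState_fst_eq_overHistory (keepEdge key S₁ S₂ ω) ω.1 σ []
    (by rw [List.append_nil]; exact List.nodup_reverse.2 hnd)
  rw [List.append_nil, show (recordState (keepEdge key S₁ S₂ ω) ω.1 []).1 = 0 from rfl,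
    zero_add] at h1
  have h2 : ∀ h e, (noticed (keepEdge key S₁ S₂ ω) ω.1 h e).card =
      ∑ w ∈ apexes h e, if keepEdge key S₁ S₂ ω e.out.1 w ∧ keepEdge key S₁ S₂ ω e.out.2 w ∧
        ω.1.val ≤ age h e.out.1 w + age h e.out.2 w then 1 else 0 := by
    intro h e
    rw [Finset.sum_boole, apexes, Finset.filter_filter, noticed]
    simp only [and_assoc, Nat.cast_id]
  simp only [h2] at h1
  rw [overHistory_apexes hnd] at h1
  rw [h1]
  push_cast
  refine Finset.sum_congr rfl fun τ _ => ?_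
  rw [contribution, ite_zero_mul_ite_zero, ite_zero_mul_ite_zero]
  simp only [mul_one, Finset.mem_singleton, forall_eq, wedge, Finset.mem_insert, forall_eq_or_imp,
    keepEdge, totalAge]
  congr 1
  refine propext ⟨fun h => ⟨h.2.2, h.1.1, h.1.2, h.2.1.2⟩,
    fun h => ⟨⟨h.2.1, h.2.2.1⟩, ⟨h.2.1, h.2.2.2⟩, h.1⟩⟩

variable {p q : ℝ} {σ : List (Sym2 (Fin n))}

lemma expect_contribution (hkey : Function.Injective key) (hP : 4 ≤ P)
    (hp : (S₁.card : ℝ) / P = p) (hq : (S₂.card : ℝ) / P = q)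
    {τ : Sym2 (Fin n) × Fin n} (hτ : ¬ τ.1.IsDiag) :
    ∑ ω : Seed P N, seedWeight ν ω * contribution S₁ S₂ key σ ω τ =
      thresholdCDF ν (totalAge σ τ) * (p * q ^ 2) := by
  refine (sum_seedWeight_mul S₁ S₂ hkey hP
    (fun g : Fin (N + 1) => if g.val ≤ totalAge σ τ then 1 else 0)
    (s := {τ.2}) (t := wedge τ) (by simp) (by rw [card_wedge hτ]; norm_num)).trans ?_
  rw [hp, hq, card_wedge hτ, Finset.card_singleton, pow_one, thresholdCDF]

/-- The expectation of a product of two contributions, compared with the bound `(p * q ^ 2) ^ 2` that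
holds for two triangles without a common apex. -/
lemma expect_contribution_mul_le (hkey : Function.Injective key) (hP : 4 ≤ P)
    (hp : (S₁.card : ℝ) / P = p) (hq : (S₂.card : ℝ) / P = q) (hp0 : 0 < p) (hq0 : 0 < q)
    (hν : ∀ g, 0 ≤ ν g) (hν1 : ∑ g, ν g = 1) {τ τ' : Sym2 (Fin n) × Fin n}
    (hτ : ¬ τ.1.IsDiag) (hτ' : ¬ τ'.1.IsDiag) :
    ∑ ω : Seed P N, seedWeight ν ω *
        (contribution S₁ S₂ key σ ω τ * contribution S₁ S₂ key σ ω τ') ≤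
      (p * q ^ 2) ^ 2 * (1 + ((if τ'.2 = τ.2 then thresholdCDF ν (totalAge σ τ') / p else 0) +
        ((if ¬ Disjoint (wedge τ) (wedge τ') then 1 / (p * q) else 0) +
          if τ = τ' then 1 / (p * q ^ 2) else 0))) := by
  classical
  have hw : (wedge τ).card = 2 := card_wedge hτ
  have hw' : (wedge τ').card = 2 := card_wedge hτ'
  set m := ∑ g, ν g * ((if g.val ≤ totalAge σ τ then 1 else 0) *
    if g.val ≤ totalAge σ τ' then 1 else 0) with hm
  have hm0 : 0 ≤ m := Finset.sum_nonneg fun g _ => mul_nonneg (hν g) (by split_ifs <;> norm_num)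
  have hm1 : m ≤ 1 := by
    rw [← hν1]
    refine Finset.sum_le_sum fun g _ => mul_le_of_le_one_right (hν g) ?_
    split_ifs <;> norm_num
  have hmc : m ≤ thresholdCDF ν (totalAge σ τ') := by
    refine Finset.sum_le_sum fun g _ => mul_le_mul_of_nonneg_left ?_ (hν g)
    split_ifs <;> norm_num
  have hc0 : 0 ≤ thresholdCDF ν (totalAge σ τ') := hm0.trans hmc
  have hexp : ∑ ω : Seed P N, seedWeight ν ω *
      (contribution S₁ S₂ key σ ω τ * contribution S₁ S₂ key σ ω τ') =
      m * (p ^ ({τ.2} ∪ {τ'.2} : Finset (Fin n)).card * q ^ (wedge τ ∪ wedge τ').card) := by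
    rw [← hp, ← hq]
    rw [← sum_seedWeight_mul S₁ S₂ hkey hP _ ((Finset.card_union_le _ _).trans (by simp))
      ((Finset.card_union_le _ _).trans (by omega))]
    refine Finset.sum_congr rfl fun ω _ => ?_
    simp only [contribution, Finset.mem_union, or_imp, forall_and, ite_and]
    split_ifs <;> simp
  rw [hexp]
  by_cases hww : τ'.2 = τ.2
  · have hcard1 : ({τ.2} ∪ {τ'.2} : Finset (Fin n)).card = 1 := by rw [hww]; simp
    rw [hcard1, if_pos hww, pow_one]
    by_cases hd : Disjoint (wedge τ) (wedge τ')
    · rw [Finset.card_union_of_disjoint hd, hw, hw', if_neg (not_not.2 hd)]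
      have h1 : m * (p * q ^ (2 + 2)) = (p * q ^ 2) ^ 2 * (m / p) := by field_simp
      rw [h1]
      refine mul_le_mul_of_nonneg_left ?_ (by positivity)
      have h2 : m / p ≤ thresholdCDF ν (totalAge σ τ') / p := by gcongr
      have h3 : (0 : ℝ) ≤ if τ = τ' then 1 / (p * q ^ 2) else 0 := by split_ifs <;> positivity
      linarith
    · rw [if_pos hd]
      have h3 : 0 ≤ thresholdCDF ν (totalAge σ τ') / p := by positivity
      by_cases he : τ = τ'
      · subst he
        rw [Finset.union_self, hw, if_pos rfl]
        have h1 : m * (p * q ^ 2) ≤ (p * q ^ 2) ^ 2 * (1 / (p * q ^ 2)) := by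
          have : (p * q ^ 2) ^ 2 * (1 / (p * q ^ 2)) = 1 * (p * q ^ 2) := by field_simp
          rw [this]; gcongr
        refine h1.trans (mul_le_mul_of_nonneg_left ?_ (by positivity))
        have : 0 ≤ 1 / (p * q) := by positivity
        linarith
      · have hcard : (wedge τ ∪ wedge τ').card = 3 := by
          have h4 : (wedge τ ∩ wedge τ').card = 1 := by
            have h5 : 0 < (wedge τ ∩ wedge τ').card :=
              Finset.card_pos.2 (Finset.not_disjoint_iff_nonempty_inter.1 hd)
            have h6 : (wedge τ ∩ wedge τ').card ≤ 2 :=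
              (Finset.card_le_card Finset.inter_subset_left).trans hw.le
            have h7 : (wedge τ ∩ wedge τ').card ≠ 2 := fun h8 => by
              have h9 := Finset.eq_of_subset_of_card_le
                (Finset.inter_subset_left (s₁ := wedge τ) (s₂ := wedge τ')) (by omega)
              have h10 := Finset.eq_of_subset_of_card_le
                (Finset.inter_subset_right (s₁ := wedge τ) (s₂ := wedge τ')) (by omega)
              exact he (wedge_injective (h9.symm.trans h10))
            omega
          have := Finset.card_union_add_card_inter (wedge τ) (wedge τ')
          omega
        rw [hcard, if_neg he]
        have h1 : m * (p * q ^ 3) ≤ (p * q ^ 2) ^ 2 * (1 / (p * q)) := by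
          have : (p * q ^ 2) ^ 2 * (1 / (p * q)) = 1 * (p * q ^ 3) := by field_simp
          rw [this]; gcongr
        refine h1.trans (mul_le_mul_of_nonneg_left ?_ (by positivity))
        linarith
  · have hd : Disjoint (wedge τ) (wedge τ') := by
      rw [Finset.disjoint_left]
      intro x hx hx'
      exact hww ((mem_wedge.1 hx').2.symm.trans (mem_wedge.1 hx).2)
    have hcard1 : ({τ.2} ∪ {τ'.2} : Finset (Fin n)).card = 2 :=
      Finset.card_pair (Ne.symm hww)
    have hne : τ ≠ τ' := fun h => hww (by rw [h])
    rw [hcard1, Finset.card_union_of_disjoint hd, hw, hw', if_neg hww, if_neg (not_not.2 hd),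
      if_neg hne]
    have h1 : m * (p ^ 2 * q ^ (2 + 2)) ≤ 1 * (p ^ 2 * q ^ (2 + 2)) := by gcongr
    refine h1.trans_eq ?_
    ring

/-- The second moment of the classical estimate is `O(T²)`, if no vertex is the apex of too many
triangles (counted with the probability that the threshold admits them) and the selection
probabilities are not too small. -/
lemma expect_sq_sum_contribution_le (hkey : Function.Injective key) (hP : 4 ≤ P)
    (hp : (S₁.card : ℝ) / P = p) (hq : (S₂.card : ℝ) / P = q) (hp0 : 0 < p) (hq0 : 0 < q)
    (hν : ∀ g, 0 ≤ ν g) (hν1 : ∑ g, ν g = 1) (hdiag : ∀ e ∈ σ, ¬ e.IsDiag) {D : ℕ}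
    (hD : ∀ a b, s(a, b) ∈ σ →
      (Finset.univ.filter fun x => s(a, x) ∈ σ ∧ s(b, x) ∈ σ).card ≤ D)
    {T : ℝ} (hT : ((triangles σ).card : ℝ) = T)
    (h1 : ∀ w, ∑ τ ∈ (triangles σ).filter (fun τ => τ.2 = w), thresholdCDF ν (totalAge σ τ) ≤ p * T)
    (h2 : min (D : ℝ) T ≤ p * q * T) (h3 : 1 ≤ p * q ^ 2 * T) :
    ∑ ω : Seed P N, seedWeight ν ω *
        ((∑ τ ∈ triangles σ, contribution S₁ S₂ key σ ω τ) / (p * q ^ 2)) ^ 2 ≤ 5 * T ^ 2 := by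
  classical
  have hT0 : 0 ≤ T := by rw [← hT]; positivity
  have hshare : ∀ τ, (((triangles σ).filter fun τ' => ¬ Disjoint (wedge τ) (wedge τ')).card : ℝ) ≤
      2 * (p * q * T) := by
    intro τ
    have h4 : (((triangles σ).filter fun τ' => ¬ Disjoint (wedge τ) (wedge τ')).card : ℝ) ≤ 2 * D :=
      mod_cast card_triangles_sharing_le hD τ
    have h5 : (((triangles σ).filter fun τ' => ¬ Disjoint (wedge τ) (wedge τ')).card : ℝ) ≤ T := by
      rw [← hT]; exact_mod_cast Finset.card_filter_le _ _
    rcases le_total (D : ℝ) T with h | h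
    · rw [min_eq_left h] at h2; linarith
    · rw [min_eq_right h] at h2; linarith
  have hrow : ∀ τ ∈ triangles σ, ∑ τ' ∈ triangles σ,
      (1 + ((if τ'.2 = τ.2 then thresholdCDF ν (totalAge σ τ') / p else 0) +
        ((if ¬ Disjoint (wedge τ) (wedge τ') then 1 / (p * q) else 0) +
          if τ = τ' then 1 / (p * q ^ 2) else 0))) ≤ 5 * T := by
    intro τ hτ
    rw [Finset.sum_add_distrib, Finset.sum_add_distrib, Finset.sum_add_distrib, Finset.sum_const,
      nsmul_eq_mul, mul_one, hT, ← Finset.sum_filter, ← Finset.sum_filter, ← Finset.sum_div,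
      Finset.sum_const, nsmul_eq_mul, Finset.sum_ite_eq, if_pos hτ]
    have e1 : (∑ τ' ∈ (triangles σ).filter (fun τ' => τ'.2 = τ.2),
        thresholdCDF ν (totalAge σ τ')) / p ≤ T := by
      rw [div_le_iff₀ hp0, mul_comm]; exact h1 τ.2
    have e2 : (((triangles σ).filter fun τ' => ¬ Disjoint (wedge τ) (wedge τ')).card : ℝ) *
        (1 / (p * q)) ≤ 2 * T := by
      rw [mul_one_div, div_le_iff₀ (by positivity)]
      linarith [hshare τ]
    have e3 : 1 / (p * q ^ 2) ≤ T := by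
      rw [div_le_iff₀ (by positivity), mul_comm]; exact h3
    linarith
  have hpq : 0 < (p * q ^ 2) ^ 2 := by positivity
  calc ∑ ω : Seed P N, seedWeight ν ω *
        ((∑ τ ∈ triangles σ, contribution S₁ S₂ key σ ω τ) / (p * q ^ 2)) ^ 2
      = (∑ τ ∈ triangles σ, ∑ τ' ∈ triangles σ, ∑ ω : Seed P N, seedWeight ν ω *
          (contribution S₁ S₂ key σ ω τ * contribution S₁ S₂ key σ ω τ')) /
          (p * q ^ 2) ^ 2 := by
        rw [Finset.sum_div]
        simp only [div_pow, sq (∑ τ ∈ triangles σ, contribution S₁ S₂ key σ _ τ),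
          Finset.sum_mul_sum, ← mul_div_assoc]
        rw [← Finset.sum_div, ← Finset.sum_div]
        congr 1
        simp only [Finset.mul_sum]
        rw [Finset.sum_comm]
        exact Finset.sum_congr rfl fun τ _ => Finset.sum_comm
    _ ≤ (∑ τ ∈ triangles σ, (p * q ^ 2) ^ 2 * (5 * T)) / (p * q ^ 2) ^ 2 := by
        gcongr with τ hτ
        refine le_trans (Finset.sum_le_sum fun τ' hτ' => expect_contribution_mul_le S₁ S₂ hkey hP
          hp hq hp0 hq0 hν hν1 (hdiag _ (mem_triangles.1 hτ).1)
          (hdiag _ (mem_triangles.1 hτ').1)) ?_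
        rw [← Finset.mul_sum]
        exact mul_le_mul_of_nonneg_left (hrow τ hτ) hpq.le
    _ = 5 * T ^ 2 := by
        rw [Finset.sum_const, nsmul_eq_mul, hT]
        field_simp

end moments

/-! ### The classical algorithm -/

section recorder

variable {n P N : ℕ} [Fact P.Prime]

/-- A list of numbers that determines the memory of the classical algorithm. -/
def recorderNats (c : Seed P N × (ℕ × List (Entry n))) : List ℕ :=
  [c.1.1.val, (c.1.2.1 0).val, (c.1.2.1 1).val, (c.1.2.1 2).val, (c.1.2.1 3).val,
    (c.1.2.2 0).val, (c.1.2.2 1).val, (c.1.2.2 2).val, (c.1.2.2 3).val, c.2.1] ++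
    c.2.2.flatMap fun t => [t.1.val, t.2.1.val, t.2.2]

lemma recorderNats_injective : Function.Injective (recorderNats (n := n) (P := P) (N := N)) := by
  rintro ⟨⟨g, c, d⟩, a, l⟩ ⟨⟨g', c', d'⟩, a', l'⟩ h
  simp only [recorderNats, List.cons_append, List.nil_append, List.cons.injEq] at h
  obtain ⟨hg, c0, c1, c2, c3, d0, d1, d2, d3, ha, hl⟩ := h
  have hc : c = c' := by
    funext i
    fin_cases i
    exacts [ZMod.val_injective P c0, ZMod.val_injective P c1, ZMod.val_injective P c2,
      ZMod.val_injective P c3]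
  have hd : d = d' := by
    funext i
    fin_cases i
    exacts [ZMod.val_injective P d0, ZMod.val_injective P d1, ZMod.val_injective P d2,
      ZMod.val_injective P d3]
  rw [Fin.ext hg, hc, hd, show a = a' from ha, flatMap_entry_injective hl]

lemma length_recorderNats {n P N : ℕ} (c : Seed P N × (ℕ × List (Entry n))) :
    (recorderNats c).length = 10 + 3 * c.2.2.length := by
  simp [recorderNats]
  omega

variable {key : Fin n × Fin n → ZMod P}

/-- The classical algorithm. It selects vertices with probability `p = |S₁| / P` and pairs with
probability `q = |S₂| / P`, so that each triangle is noticed with probability `p * q ^ 2`, provided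
that its total age is at least the threshold. -/
abbrev recorder (S₁ S₂ : Finset (ZMod P)) (hkey : Function.Injective key) (hP : 4 ≤ P)
    {ν : Fin (N + 1) → ℝ} (hν : ∀ g, 0 ≤ ν g) (hν1 : ∑ g, ν g = 1) :
    QuantumStreamingAlgorithm (Sym2 (Fin n)) :=
  seeded (Ω := Seed P N) (Q := ℕ × List (Entry n)) (seedWeight ν) (seedWeight_nonneg hν)
    (sum_seedWeight hkey hP hν1)
    (0, []) (fun ω => recordStep (keepEdge key S₁ S₂ ω) ω.1)
    (fun c => encodeNats (recorderNats c)) (encodeNats_injective.comp recorderNats_injective)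
    (fun c => c.2.1 / ((S₁.card : ℝ) / P * ((S₂.card : ℝ) / P) ^ 2))

variable {S₁ S₂ : Finset (ZMod P)} {σ : List (Sym2 (Fin n))}

lemma foldl_recordStep_start (keep : Fin n → Fin n → Prop) (g : ℕ) (us : List (Sym2 (Fin n))) :
    us.foldl (recordStep keep g) (0, []) = recordState keep g us.reverse := by
  have := foldl_recordStep keep g us []
  rwa [List.append_nil] at this

open Classical in
lemma expect_keepEdge (hkey : Function.Injective key) (hP : 4 ≤ P) {ν : Fin (N + 1) → ℝ}
    (hν1 : ∑ g, ν g = 1) (x w : Fin n) :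
    ∑ ω : Seed P N, seedWeight ν ω * (if keepEdge key S₁ S₂ ω x w then 1 else 0) =
      (S₁.card : ℝ) / P * ((S₂.card : ℝ) / P) := by
  have := sum_seedWeight_mul (ν := ν) S₁ S₂ hkey hP (fun _ => 1) (s := {w}) (t := {(x, w)})
    (by simp) (by simp)
  simp only [Finset.card_singleton, pow_one, mul_one, hν1, one_mul] at this
  rw [← this]
  refine Finset.sum_congr rfl fun ω _ => ?_
  rw [ite_zero_mul_ite_zero, mul_one]
  simp only [Finset.mem_singleton, forall_eq, keepEdge]
  congr

open Classical in
/-- The expected number of directed edges that the classical algorithm stores. -/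
lemma expect_length_recordState (hkey : Function.Injective key) (hP : 4 ≤ P) {ν : Fin (N + 1) → ℝ}
    (hν1 : ∑ g, ν g = 1) (h : List (Sym2 (Fin n))) :
    ∑ ω : Seed P N, seedWeight ν ω *
        ((recordState (keepEdge key S₁ S₂ ω) ω.1 h).2.length : ℝ) =
      2 * h.length * ((S₁.card : ℝ) / P * ((S₂.card : ℝ) / P)) := by
  simp only [length_recordState]
  induction h with
  | nil => simp
  | cons e h ih =>
    simp only [List.map_cons, List.sum_cons, Nat.cast_add, mul_add, Finset.sum_add_distrib, ih,
      List.length_cons, Nat.cast_ite, Nat.cast_one, Nat.cast_zero, expect_keepEdge hkey hP hν1]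
    ring

/-- All numbers that the classical algorithm stores are polynomially bounded. -/
lemma length_encodeNats_recorderNats_le {L : ℕ} (hn : n < 2 ^ L) (hL : 2 ≤ L)
    (hN : N ≤ 2 * n ^ 2 + 1) (hPn : P ≤ 2 * n ^ 2) (S₁ S₂ : Finset (ZMod P)) (ω : Seed P N)
    {τ : List (Sym2 (Fin n))} (hτ : τ.length ≤ n ^ 2) :
    (encodeNats (recorderNats (ω, recordState (keepEdge key S₁ S₂ ω) ω.1 τ))).length ≤
      (8 * L + 1) * (10 + 3 * (recordState (keepEdge key S₁ S₂ ω) ω.1 τ).2.length) := by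
  have h4 : 4 ≤ 2 ^ L := (Nat.pow_le_pow_right (n := 2) (by norm_num) hL)
  have hpow : 2 ^ (4 * L) = (2 ^ L) ^ 4 := by rw [mul_comm, pow_mul]
  set Y := 2 ^ L with hY
  have hn2 : n ^ 2 < Y ^ 2 := Nat.pow_lt_pow_left hn (by norm_num)
  have hY4 : Y ^ 2 * 16 ≤ Y ^ 4 := by
    have : 16 ≤ Y ^ 2 := by nlinarith
    calc Y ^ 2 * 16 ≤ Y ^ 2 * Y ^ 2 := Nat.mul_le_mul_left _ this
      _ = Y ^ 4 := by ring
  have hlen := length_recorderNats (ω, recordState (keepEdge key S₁ S₂ ω) ω.1 τ)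
  dsimp only at hlen
  rw [← hlen, show 8 * L + 1 = 2 * (4 * L) + 1 by ring]
  refine length_encodeNats_le fun k hk => ?_
  rw [hpow]
  have hval : ∀ z : ZMod P, z.val < Y ^ 4 := fun z => by have := ZMod.val_lt z; omega
  have hacc : (recordState (keepEdge key S₁ S₂ ω) ω.1 τ).1 < Y ^ 4 := by
    refine (recordState_fst_le _ _ τ).trans_lt ?_
    calc τ.length * n ≤ n ^ 2 * n := Nat.mul_le_mul_right _ hτ
      _ ≤ Y ^ 2 * Y := Nat.mul_le_mul hn2.le hn.le
      _ < Y ^ 4 := by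
        have : 0 < Y ^ 3 := by positivity
        nlinarith
  have hg := ω.1.2
  simp only [recorderNats, List.mem_append, List.mem_cons, List.not_mem_nil, or_false,
    List.mem_flatMap] at hk
  rcases hk with (rfl | rfl | rfl | rfl | rfl | rfl | rfl | rfl | rfl | rfl) | ⟨t, ht, rfl | rfl | rfl⟩
  · omega
  any_goals exact hval _
  · exact hacc
  · have := t.1.2; nlinarith
  · have := t.2.1.2; nlinarith
  · have := le_length_of_mem_recordState _ _ ht; omega

/-- The classical algorithm estimates the number of triangles, each weighted by the probability that
the threshold is at most its total age. -/
theorem estimates_recorder (hkey : Function.Injective key) (hP : 4 ≤ P)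
    {ν : Fin (N + 1) → ℝ} (hν : ∀ g, 0 ≤ ν g) (hν1 : ∑ g, ν g = 1) {p q : ℝ}
    (hp : (S₁.card : ℝ) / P = p) (hq : (S₂.card : ℝ) / P = q) (hp0 : 0 < p) (hq0 : 0 < q)
    (hnd : σ.Nodup) (hdiag : ∀ e ∈ σ, ¬ e.IsDiag) {D : ℕ}
    (hD : ∀ a b, s(a, b) ∈ σ →
      (Finset.univ.filter fun x => s(a, x) ∈ σ ∧ s(b, x) ∈ σ).card ≤ D)
    {T : ℝ} (hT : ((triangles σ).card : ℝ) = T)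
    (h1 : ∀ w, ∑ τ ∈ (triangles σ).filter (fun τ => τ.2 = w), thresholdCDF ν (totalAge σ τ) ≤ p * T)
    (h2 : min (D : ℝ) T ≤ p * q * T) (h3 : 1 ≤ p * q ^ 2 * T)
    {L : ℕ} (hn : n < 2 ^ L) (hL : 2 ≤ L) (hN : N ≤ 2 * n ^ 2 + 1) (hPn : P ≤ 2 * n ^ 2) :
    (recorder S₁ S₂ hkey hP hν hν1).Estimates σ
      (∑ τ ∈ triangles σ, thresholdCDF ν (totalAge σ τ)) (5 * T ^ 2)
      ((8 * L + 1) * (10 + 6 * (σ.length * (p * q)))) := by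
  have hout : ∀ ω : Seed P N, ((ω, σ.foldl (recordStep (keepEdge key S₁ S₂ ω) ω.1) (0, [])) :
      Seed P N × (ℕ × List (Entry n))).2.1 / ((S₁.card : ℝ) / P * ((S₂.card : ℝ) / P) ^ 2) =
      (∑ τ ∈ triangles σ, contribution S₁ S₂ key σ ω τ) / (p * q ^ 2) := by
    intro ω
    dsimp only
    rw [foldl_recordStep_start, recordState_fst_eq_sum S₁ S₂ hnd, hp, hq]
  have hpq : 0 < p * q ^ 2 := by positivity
  have hmean : (recorder S₁ S₂ hkey hP hν hν1).expect
      (fun c _ => (recorder S₁ S₂ hkey hP hν hν1).output c) σ =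
      ∑ τ ∈ triangles σ, thresholdCDF ν (totalAge σ τ) := by
    refine (expect_seeded _ _ _ _ _ _ _ _ (recorder S₁ S₂ hkey hP hν hν1).output σ).trans ?_
    calc _ = ∑ ω : Seed P N, seedWeight ν ω *
          ((∑ τ ∈ triangles σ, contribution S₁ S₂ key σ ω τ) / (p * q ^ 2)) :=
          Finset.sum_congr rfl fun ω _ => congrArg (_ * ·) (hout ω)
      _ = (∑ τ ∈ triangles σ, ∑ ω : Seed P N, seedWeight ν ω *
            contribution S₁ S₂ key σ ω τ) / (p * q ^ 2) := by
          simp only [← mul_div_assoc, Finset.mul_sum]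
          rw [← Finset.sum_div, Finset.sum_comm]
      _ = (∑ τ ∈ triangles σ, thresholdCDF ν (totalAge σ τ) * (p * q ^ 2)) / (p * q ^ 2) := by
          congr 1
          exact Finset.sum_congr rfl fun τ hτ => expect_contribution S₁ S₂ hkey hP hp hq
            (hdiag _ (mem_triangles.1 hτ).1)
      _ = _ := by rw [← Finset.sum_mul, mul_div_cancel_right₀ _ hpq.ne']
  refine ⟨hmean, ?_, ?_⟩
  · set μ := ∑ τ ∈ triangles σ, thresholdCDF ν (totalAge σ τ)
    have e1 := expect_affine_sq (A := recorder S₁ S₂ hkey hP hν hν1) (σ := σ) μ μ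
      (recorder S₁ S₂ hkey hP hν hν1).output
    rw [hmean] at e1
    have e2 : (recorder S₁ S₂ hkey hP hν hν1).expect
        (fun c _ => ((recorder S₁ S₂ hkey hP hν hν1).output c - μ + μ) ^ 2) σ ≤ 5 * T ^ 2 := by
      simp only [sub_add_cancel]
      refine (expect_seeded _ _ _ _ _ _ _ _
        (fun c => (recorder S₁ S₂ hkey hP hν hν1).output c ^ 2) σ).trans_le ?_
      refine le_trans (le_of_eq ?_) (expect_sq_sum_contribution_le S₁ S₂ hkey hP hp hq hp0 hq0 hν
        hν1 hdiag hD hT h1 h2 h3)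
      exact Finset.sum_congr rfl fun ω _ => congrArg (fun z => _ * z ^ 2) (hout ω)
    nlinarith [sq_nonneg μ]
  · refine (expectedSpace_seeded_le _ _ _ _ _ _ _ _ (fun ω => (8 * L + 1) * (10 + 3 *
      (recordState (keepEdge key S₁ S₂ ω) ω.1 σ.reverse).2.length)) σ fun ω τ hτ => ?_).trans_eq ?_
    · have hlen : τ.reverse.length ≤ n ^ 2 := by
        rw [List.length_reverse]; exact hτ.length_le.trans (length_le_sq hnd)
      rw [foldl_recordStep_start]
      refine (length_encodeNats_recorderNats_le hn hL hN hPn S₁ S₂ ω hlen).trans ?_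
      refine Nat.mul_le_mul_left _ (Nat.add_le_add_left (Nat.mul_le_mul_left _ ?_) _)
      obtain ⟨τ', rfl⟩ := hτ
      rw [length_recordState, length_recordState, List.reverse_append, List.map_append,
        List.sum_append]
      exact Nat.le_add_left _ _
    · have e1 := expect_length_recordState (S₁ := S₁) (S₂ := S₂) hkey hP hν1 σ.reverse
      rw [hp, hq, List.length_reverse] at e1
      have e2 : ∀ ω : Seed P N, seedWeight ν ω * (((8 * L + 1) * (10 + 3 *
          (recordState (keepEdge key S₁ S₂ ω) ω.1 σ.reverse).2.length) : ℕ) : ℝ) =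
          (8 * L + 1) * 10 * seedWeight ν ω + (8 * L + 1) * 3 * (seedWeight ν ω *
            ((recordState (keepEdge key S₁ S₂ ω) ω.1 σ.reverse).2.length : ℝ)) := by
        intro ω; push_cast; ring
      simp only [e2]
      rw [Finset.sum_add_distrib, ← Finset.mul_sum, ← Finset.mul_sum, e1,
        sum_seedWeight hkey hP hν1]
      ring

end recorder

/-! ### The geometric threshold -/

section threshold

/-- A threshold that is at most `d` with probability `1 - γ ^ d`, for `d ≤ N`. -/
def geometricThreshold (N : ℕ) (γ : ℝ) : Fin (N + 1 + 1) → ℝ :=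
  Fin.cons 0 (Fin.snoc (fun i : Fin N => γ ^ (i : ℕ) * (1 - γ)) (γ ^ N) : Fin (N + 1) → ℝ)

variable {N : ℕ} {γ : ℝ}

lemma geometricThreshold_nonneg (h0 : 0 ≤ γ) (h1 : γ ≤ 1) (g : Fin (N + 1 + 1)) :
    0 ≤ geometricThreshold N γ g := by
  unfold geometricThreshold
  refine Fin.cases ?_ (fun i => ?_) g
  · simp
  · rw [Fin.cons_succ]
    refine Fin.lastCases ?_ (fun i => ?_) i
    · rw [Fin.snoc_last]; positivity
    · rw [Fin.snoc_castSucc]; exact mul_nonneg (by positivity) (by linarith)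

lemma sum_geometricThreshold : ∑ g, geometricThreshold N γ g = 1 := by
  rw [Fin.sum_univ_succ, Fin.sum_univ_castSucc]
  simp only [geometricThreshold, Fin.cons_zero, Fin.cons_succ, Fin.snoc_castSucc, Fin.snoc_last]
  rw [← Finset.sum_mul, Fin.sum_univ_eq_sum_range fun i => γ ^ i, mul_comm, mul_neg_geom_sum]
  ring

lemma thresholdCDF_geometricThreshold {d : ℕ} (hd : d ≤ N) :
    thresholdCDF (geometricThreshold N γ) d = 1 - γ ^ d := by
  rw [thresholdCDF, Fin.sum_univ_succ, Fin.sum_univ_castSucc]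
  simp only [geometricThreshold, Fin.cons_zero, Fin.cons_succ, Fin.snoc_castSucc, Fin.snoc_last]
  have h1 : ¬ (Fin.last N).succ.val ≤ d := by simp; omega
  rw [if_neg h1, mul_zero, zero_mul, zero_add, add_zero]
  have h2 : ∀ i : Fin N, (γ ^ (i : ℕ) * (1 - γ) * if i.castSucc.succ.val ≤ d then 1 else 0) =
      (fun i : ℕ => if i < d then γ ^ i * (1 - γ) else 0) i := by
    intro i
    simp
  simp only [h2]
  rw [Fin.sum_univ_eq_sum_range fun i : ℕ => if i < d then γ ^ i * (1 - γ) else 0,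
    ← Finset.sum_filter]
  have h3 : (Finset.range N).filter (fun i => i < d) = Finset.range d := by
    ext i; simp; omega
  rw [h3, ← Finset.sum_mul, mul_comm, mul_neg_geom_sum]

lemma one_sub_pow_le (h0 : 0 ≤ γ) (d : ℕ) : 1 - γ ^ d ≤ d * (1 - γ) := by
  have := one_add_mul_le_pow (a := γ - 1) (by linarith) d
  rw [add_sub_cancel] at this
  linarith

end threshold

/-! ### The choice of the parameters -/

lemma size_le_three_mul_log {n : ℕ} (hn : 3 ≤ n) :
    2 ≤ Nat.size n ∧ (Nat.size n : ℝ) ≤ 3 * Real.log n ∧ 1 ≤ Real.log n := by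
  have h1 : 1 ≤ Real.log n := by
    rw [Real.le_log_iff_exp_le (by positivity)]
    have h3 : (3 : ℝ) ≤ n := by exact_mod_cast hn
    linarith [Real.exp_one_lt_d9]
  have h2 : 2 ≤ Nat.size n := Nat.lt_size.2 (by omega)
  refine ⟨h2, ?_, h1⟩
  have h3 : 2 ^ (Nat.size n - 1) ≤ n := Nat.lt_size.1 (by omega)
  have h4 : ((Nat.size n - 1 : ℕ) : ℝ) * Real.log 2 ≤ Real.log n := by
    rw [← Real.log_pow]
    exact Real.log_le_log (by positivity) (by exact_mod_cast h3)
  rw [Nat.cast_sub (by omega), Nat.cast_one] at h4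
  have h5 := Real.log_two_gt_d9
  have h6 : (2 : ℝ) ≤ Nat.size n := by exact_mod_cast h2
  nlinarith

/-- A set of residues with about a fraction `p` of them. -/
lemma exists_finset_fraction {P : ℕ} [Fact P.Prime] {p : ℝ} (hp0 : 0 ≤ p) (hp1 : p ≤ 1) :
    ∃ S : Finset (ZMod P), p ≤ (S.card : ℝ) / P ∧ (S.card : ℝ) / P ≤ p + 1 / P ∧
      (S.card : ℝ) / P ≤ 1 := by
  have hP : (0 : ℝ) < P := by exact_mod_cast (Fact.out : P.Prime).pos
  have hle : ⌈p * P⌉₊ ≤ (Finset.univ : Finset (ZMod P)).card := by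
    rw [Finset.card_univ, ZMod.card, Nat.ceil_le]
    nlinarith
  obtain ⟨S, -, hS⟩ := Finset.exists_subset_card_eq hle
  refine ⟨S, ?_, ?_, ?_⟩
  · rw [le_div_iff₀ hP, hS]; exact Nat.le_ceil _
  · rw [div_le_iff₀ hP, add_mul, one_div_mul_cancel hP.ne', hS]
    exact (Nat.ceil_lt_add_one (by positivity)).le
  · rw [div_le_one hP]
    have := Finset.card_le_univ S
    rw [ZMod.card] at this
    exact_mod_cast this

/-- The selection probabilities `p = R / T₀` for vertices and `q = min 1 √(D / R)` for directed
edges, where `R = min H T₀`. -/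
lemma exists_probabilities {D T₀ H : ℝ} (hD : 1 ≤ D) (hT₀ : 1 ≤ T₀) (hDH : D ≤ H) :
    ∃ p q : ℝ, 0 < p ∧ p ≤ 1 ∧ 0 < q ∧ q ≤ 1 ∧ (p * q) ^ 2 ≤ D * H / T₀ ^ 2 ∧
      ∀ T, T₀ ≤ T → min H T ≤ p * T ∧ min D T ≤ p * q * T ∧ 1 ≤ p * q ^ 2 * T := by
  set R := min H T₀ with hR
  have hR1 : 1 ≤ R := le_min (hD.trans hDH) hT₀
  have hRT : R ≤ T₀ := min_le_right _ _
  have hRH : R ≤ H := min_le_left _ _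
  rcases le_total D R with hDR | hDR
  · have hsq : Real.sqrt (D / R) ^ 2 = D / R := Real.sq_sqrt (by positivity)
    refine ⟨R / T₀, Real.sqrt (D / R), by positivity, (div_le_one (by positivity)).2 hRT,
      Real.sqrt_pos.2 (by positivity), ?_, ?_, fun T hT => ⟨?_, ?_, ?_⟩⟩
    · rw [Real.sqrt_le_one]; exact (div_le_one (by positivity)).2 hDR
    · rw [mul_pow, hsq, div_pow]
      have : R ^ 2 / T₀ ^ 2 * (D / R) = D * R / T₀ ^ 2 := by field_simp
      rw [this]; gcongr
    · rw [div_mul_eq_mul_div, le_div_iff₀ (by positivity)]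
      rcases le_total H T₀ with h | h
      · rw [hR, min_eq_left h]
        exact mul_le_mul (min_le_left _ _) hT (by positivity) (by linarith)
      · rw [hR, min_eq_right h, mul_comm]
        exact mul_le_mul_of_nonneg_left (min_le_right _ _) (by positivity)
    · have h1 : D / R ≤ Real.sqrt (D / R) := by
        rw [Real.le_sqrt (by positivity) (by positivity), sq]
        exact mul_le_of_le_one_left (by positivity) ((div_le_one (by positivity)).2 hDR)
      have hT0 : 0 ≤ T := by linarith
      calc min D T ≤ D := min_le_left _ _
        _ ≤ D * (T / T₀) := le_mul_of_one_le_right (by linarith) ((one_le_div (by positivity)).2 hT)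
        _ = R / T₀ * (D / R) * T := by field_simp
        _ ≤ R / T₀ * Real.sqrt (D / R) * T := by gcongr
    · rw [hsq]
      calc 1 ≤ D * (T / T₀) := by nlinarith [(one_le_div (by positivity)).2 hT]
        _ = R / T₀ * (D / R) * T := by field_simp
  · have hRT' : R = T₀ ∨ R = D := by
      rcases le_total H T₀ with h | h
      · right; rw [hR, min_eq_left h] at hDR ⊢; exact le_antisymm hDR hDH
      · left; exact min_eq_right h
    refine ⟨R / T₀, 1, by positivity, (div_le_one (by positivity)).2 hRT, one_pos, le_rfl, ?_,
      fun T hT => ⟨?_, ?_, ?_⟩⟩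
    · rw [mul_one, div_pow]
      gcongr
      nlinarith
    · rw [div_mul_eq_mul_div, le_div_iff₀ (by positivity)]
      rcases le_total H T₀ with h | h
      · rw [hR, min_eq_left h]
        exact mul_le_mul (min_le_left _ _) hT (by positivity) (by linarith)
      · rw [hR, min_eq_right h, mul_comm]
        exact mul_le_mul_of_nonneg_left (min_le_right _ _) (by positivity)
    · rw [mul_one, div_mul_eq_mul_div, le_div_iff₀ (by positivity)]
      rcases hRT' with h | h
      · rw [h, mul_comm]
        exact mul_le_mul_of_nonneg_left (min_le_right _ _) (by positivity)
      · rw [h]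
        exact mul_le_mul (min_le_left _ _) hT (by positivity) (by linarith)
    · rw [one_pow, mul_one, div_mul_eq_mul_div, le_div_iff₀ (by positivity), one_mul]
      nlinarith

/-- The scale `k` on which the quantum algorithm lets amplitudes decay: `k ^ 5 = T² D² / M`. With
this choice `(k M / T)²` is the space bound, and it balances the two algorithms. -/
lemma exists_decayScale {M T D : ℝ} (hM : 1 ≤ M) (hT : 1 ≤ T) (hD : 1 ≤ D) (hDM : D ≤ M)
    (hTM : T ≤ M * D) :
    ∃ k : ℝ, 0 < k ∧ k ^ 5 * M = T ^ 2 * D ^ 2 ∧ k ≤ M ∧ T ≤ k * M ∧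
      (k * M / T) ^ 2 = M ^ (8 / 5 : ℝ) / T ^ (6 / 5 : ℝ) * D ^ (4 / 5 : ℝ) := by
  have hk5 : ((T ^ 2 * D ^ 2 / M) ^ (1 / 5 : ℝ)) ^ 5 = T ^ 2 * D ^ 2 / M := by
    rw [← Real.rpow_natCast, ← Real.rpow_mul (by positivity)]
    norm_num
  set k := (T ^ 2 * D ^ 2 / M) ^ (1 / 5 : ℝ) with hk
  have hk0 : 0 < k := by positivity
  have hkM : k ^ 5 * M = T ^ 2 * D ^ 2 := by rw [hk5]; field_simp
  refine ⟨k, hk0, hkM, ?_, ?_, ?_⟩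
  · rw [← pow_le_pow_iff_left₀ hk0.le (by linarith) (show 5 ≠ 0 by norm_num), hk5,
      div_le_iff₀ (by linarith)]
    calc T ^ 2 * D ^ 2 ≤ (M * D) ^ 2 * D ^ 2 := by gcongr
      _ = M ^ 2 * D ^ 4 := by ring
      _ ≤ M ^ 2 * M ^ 4 := by gcongr
      _ = M ^ 5 * M := by ring
  · rw [← pow_le_pow_iff_left₀ (by linarith) (by positivity) (show 5 ≠ 0 by norm_num)]
    calc T ^ 5 = T ^ 2 * (T ^ 2 * T) := by ring
      _ ≤ T ^ 2 * ((M * D) ^ 2 * (M * M)) := by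
          gcongr
          exact hTM.trans (by gcongr)
      _ = (T ^ 2 * D ^ 2) * M ^ 4 := by ring
      _ = (k * M) ^ 5 := by rw [← hkM]; ring
  · rw [← pow_left_inj₀ (by positivity) (by positivity) (show 5 ≠ 0 by norm_num)]
    have e : ∀ (x : ℝ) (j : ℕ), 0 < x → (x ^ ((j : ℝ) / 5)) ^ 5 = x ^ j := by
      intro x j hx
      rw [← Real.rpow_natCast, ← Real.rpow_mul hx.le, ← Real.rpow_natCast]
      congr 1
      push_cast
      ring
    have e1 := e M 8 (by linarith)
    have e2 := e T 6 (by linarith)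
    have e3 := e D 4 (by linarith)
    push_cast at e1 e2 e3
    have : ((k * M / T) ^ 2) ^ 5 = (k ^ 5 * M) ^ 2 * M ^ 8 / T ^ 10 := by
      field_simp
    rw [this, hkM, mul_pow (M ^ (8 / 5 : ℝ) / T ^ (6 / 5 : ℝ)), div_pow (M ^ (8 / 5 : ℝ)), e1, e2,
      e3]
    field_simp

/-! ### The two parts for streams within given bounds -/

lemma QuantumStreamingAlgorithm.Estimates.mono {U : Type} {A : QuantumStreamingAlgorithm U}
    {σ : List U} {μ V V' S S' : ℝ} (h : A.Estimates σ μ V S) (hV : V ≤ V') (hS : S ≤ S') :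
    A.Estimates σ μ V' S' :=
  ⟨h.mean, h.variance.trans hV, h.space.trans hS⟩

/-- The stream lists at most `M` edges of a simple graph with at least `T₀` triangles in which every
edge lies in at most `D` triangles. -/
structure WithinBounds {n : ℕ} (σ : List (Sym2 (Fin n))) (M T₀ D : ℕ) : Prop where
  nodup : σ.Nodup
  not_isDiag : ∀ e ∈ σ, ¬ e.IsDiag
  length_le : σ.length ≤ M
  card_common_le : ∀ a b, s(a, b) ∈ σ →
    (Finset.univ.filter fun x => s(a, x) ∈ σ ∧ s(b, x) ∈ σ).card ≤ D
  le_card : T₀ ≤ (triangles σ).card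

variable {n : ℕ}

/-- A prime modulus for hashing pairs of vertices. -/
lemma exists_key (hn : 3 ≤ n) : ∃ P : ℕ, P.Prime ∧ n ^ 2 < P ∧ P ≤ 2 * n ^ 2 ∧
    ∃ key : Fin n × Fin n → ZMod P, Function.Injective key := by
  obtain ⟨P, hP, h1, h2⟩ := Nat.exists_prime_lt_and_le_two_mul (n ^ 2) (by positivity)
  have : Fact P.Prime := ⟨hP⟩
  obtain ⟨f⟩ := Function.Embedding.nonempty_of_card_le (α := Fin n × Fin n) (β := ZMod P)
    (by rw [Fintype.card_prod, Fintype.card_fin, ZMod.card, ← sq]; exact h1.le)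
  exact ⟨P, hP, h1, h2, f, f.injective⟩

/-- Storing the whole graph: everything is selected and the threshold is `0`. -/
lemma exists_estimates_linear {M T₀ D : ℕ} (hn : 3 ≤ n) (hT₀ : 1 ≤ T₀) :
    ∃ A : QuantumStreamingAlgorithm (Sym2 (Fin n)), ∀ σ, WithinBounds σ M T₀ D →
      A.Estimates σ (triangles σ).card (5 * ((triangles σ).card : ℝ) ^ 2)
        ((8 * (Nat.size n : ℕ) + 1) * (10 + 6 * M)) := by
  obtain ⟨P, hP, hP1, hP2, key, hkey⟩ := exists_key hn
  have : Fact P.Prime := ⟨hP⟩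
  have hP4 : 4 ≤ P := by nlinarith
  have hν1 : ∑ _g : Fin (0 + 1), (1 : ℝ) = 1 := by simp
  refine ⟨recorder Finset.univ Finset.univ hkey hP4 (fun _ => zero_le_one) hν1, fun σ h => ?_⟩
  have hcdf : ∀ d, thresholdCDF (fun _ : Fin (0 + 1) => (1 : ℝ)) d = 1 := by
    intro d; simp [thresholdCDF]
  have hone : ((Finset.univ : Finset (ZMod P)).card : ℝ) / P = 1 := by
    rw [Finset.card_univ, ZMod.card]
    exact div_self (by exact_mod_cast hP.ne_zero)
  have hT : (1 : ℝ) ≤ (triangles σ).card := by exact_mod_cast hT₀.trans h.le_card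
  have := estimates_recorder hkey hP4 (fun _ => zero_le_one) hν1 hone hone one_pos one_pos
    h.nodup h.not_isDiag h.card_common_le rfl ?_ ?_ ?_ (Nat.lt_size_self n)
    (size_le_three_mul_log hn).1 (by omega) hP2
  · simp only [hcdf, Finset.sum_const, nsmul_eq_mul, mul_one] at this
    refine this.mono le_rfl ?_
    have : (σ.length : ℝ) ≤ M := by exact_mod_cast h.length_le
    gcongr
  · intro w
    simp only [hcdf, Finset.sum_const, nsmul_eq_mul, mul_one, one_mul]
    exact_mod_cast Finset.card_filter_le _ _
  · rw [one_mul, one_mul]; exact min_le_right _ _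
  · rw [one_pow, one_mul, one_mul]; exact hT

lemma totalAge_le (σ : List (Sym2 (Fin n))) (τ : Sym2 (Fin n) × Fin n) :
    totalAge σ τ ≤ 2 * σ.length := by
  have h : (before σ τ.1).length ≤ σ.length := by
    rw [before, List.length_reverse]
    exact (List.takeWhile_sublist _).length_le
  have h1 := age_le_length (before σ τ.1) τ.1.out.1 τ.2
  have h2 := age_le_length (before σ τ.1) τ.1.out.2 τ.2
  unfold totalAge
  omega

/-- The quantum estimate of the number of triangles, each discounted by its total age. -/
lemma exists_estimates_quantum {M T₀ D : ℕ} (hn : 3 ≤ n) (hM : 1 ≤ M) (hMn : M ≤ n ^ 2)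
    (hT₀ : 1 ≤ T₀) {k γ : ℝ} (hk : 1 ≤ k) (hγ : γ ^ 2 + 1 / k = 1) {S : ℝ}
    (hS : S = (k * M / T₀) ^ 2) (hS1 : 1 ≤ S) :
    ∃ A : QuantumStreamingAlgorithm (Sym2 (Fin n)), ∀ σ, WithinBounds σ M T₀ D →
      A.Estimates σ (∑ τ ∈ triangles σ, γ ^ totalAge σ τ) ((triangles σ).card ^ 2)
        (2 * S * (2 * (12 * (Nat.size n : ℕ)) + 1)) := by
  have hk0 : 0 < k := by linarith
  have hβ : 0 < 1 / k := by positivity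
  have hr : 0 < ⌈S⌉₊ := Nat.ceil_pos.2 (by linarith)
  refine ⟨((wedgeDetector n M hβ.le hγ).nsum ⌈S⌉₊).scale (⌈S⌉₊ : ℝ)⁻¹, fun σ h => ?_⟩
  have key := (estimates_wedgeDetector hβ.le hγ (size_le_three_mul_log hn).1 hM hMn hβ σ
    h.not_isDiag h.length_le).average hr
  have hsum : (fun (hist : List (Sym2 (Fin n))) e =>
      ∑ w, amplitude γ hist e.out.1 w * amplitude γ hist e.out.2 w) =
      fun hist e => ∑ w ∈ apexes hist e, γ ^ (age hist e.out.1 w + age hist e.out.2 w) := by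
    funext hist e
    rw [apexes, Finset.sum_filter]
    refine Finset.sum_congr rfl fun w _ => ?_
    by_cases h1 : s(e.out.1, w) ∈ hist <;> by_cases h2 : s(e.out.2, w) ∈ hist <;>
      simp [amplitude, h1, h2, pow_add]
  rw [hsum, overHistory_apexes h.nodup
    (fun hist e w => γ ^ (age hist e.out.1 w + age hist e.out.2 w))] at key
  refine key.mono ?_ ?_
  · have hT : (T₀ : ℝ) ≤ (triangles σ).card := by exact_mod_cast h.le_card
    have hT0 : (0 : ℝ) < T₀ := by exact_mod_cast hT₀
    have hr' : (0 : ℝ) < ⌈S⌉₊ := by exact_mod_cast hr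
    calc ((M : ℝ) / (1 / k)) ^ 2 / ⌈S⌉₊ ≤ (T₀ : ℝ) ^ 2 := by
          rw [div_le_iff₀ hr']
          calc ((M : ℝ) / (1 / k)) ^ 2 = (T₀ : ℝ) ^ 2 * S := by rw [hS]; field_simp
            _ ≤ _ := by gcongr; exact Nat.le_ceil S
      _ ≤ _ := by gcongr
  · have h1 : (⌈S⌉₊ : ℝ) ≤ 2 * S := by linarith [Nat.ceil_lt_add_one (show 0 ≤ S by linarith)]
    push_cast
    gcongr

/-- The classical estimate of the complementary sum. The weights of the triangles with a given apex
add up to at most `2 M D / k`, since `1 - γ ^ d ≤ d / k` and the total ages add up to at most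
`2 M D`. -/
lemma exists_estimates_classical {M T₀ D : ℕ} (hn : 3 ≤ n) (hM : 1 ≤ M) (hMn : M ≤ n ^ 2)
    (hT₀ : 1 ≤ T₀) (hD : 1 ≤ D) {k γ : ℝ} (hk : 1 ≤ k) (hkM : k ≤ M)
    (hk5 : k ^ 5 * M = T₀ ^ 2 * D ^ 2) (hγ0 : 0 ≤ γ) (hγ : γ ^ 2 + 1 / k = 1) {S : ℝ}
    (hS : S = (k * M / T₀) ^ 2) :
    ∃ A : QuantumStreamingAlgorithm (Sym2 (Fin n)), ∀ σ, WithinBounds σ M T₀ D →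
      A.Estimates σ (∑ τ ∈ triangles σ, (1 - γ ^ totalAge σ τ))
        (5 * ((triangles σ).card : ℝ) ^ 2)
        ((8 * (Nat.size n : ℕ) + 1) * (10 + 6 * (2 * S + 3))) := by
  obtain ⟨P, hP, hP1, hP2, key, hkey⟩ := exists_key hn
  have : Fact P.Prime := ⟨hP⟩
  have hP4 : 4 ≤ P := by nlinarith
  have hk0 : 0 < k := by linarith
  have hβ : 0 < 1 / k := by positivity
  have hγ1 : γ ≤ 1 := by nlinarith
  have hγβ : 1 - γ ≤ 1 / k := by nlinarith
  have hM' : (1 : ℝ) ≤ M := by exact_mod_cast hM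
  have hD' : (1 : ℝ) ≤ D := by exact_mod_cast hD
  have hT₀' : (1 : ℝ) ≤ T₀ := by exact_mod_cast hT₀
  have hDH : (D : ℝ) ≤ 2 * M * D / k := by
    rw [le_div_iff₀ hk0]; nlinarith
  obtain ⟨p, q, hp0, hp1, hq0, hq1, hpq, hall⟩ := exists_probabilities hD' hT₀' hDH
  obtain ⟨S₁, hp, hp', hp''⟩ := exists_finset_fraction (P := P) hp0.le hp1
  obtain ⟨S₂, hq, hq', hq''⟩ := exists_finset_fraction (P := P) hq0.le hq1
  refine ⟨recorder S₁ S₂ hkey hP4 (geometricThreshold_nonneg (N := 2 * n ^ 2) hγ0 hγ1)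
    sum_geometricThreshold, fun σ h => ?_⟩
  have hlen : (σ.length : ℝ) ≤ M := by exact_mod_cast h.length_le
  have hT : (T₀ : ℝ) ≤ (triangles σ).card := by exact_mod_cast h.le_card
  obtain ⟨hH, hDT, hpqT⟩ := hall _ hT
  set T : ℝ := ((triangles σ).card : ℝ) with hTdef
  have hT0 : 0 ≤ T := by positivity
  have hcdf : ∀ τ, thresholdCDF (geometricThreshold (2 * n ^ 2) γ) (totalAge σ τ) =
      1 - γ ^ totalAge σ τ := fun τ => thresholdCDF_geometricThreshold <|
    (totalAge_le σ τ).trans (by have := h.length_le; omega)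
  have := estimates_recorder hkey hP4 (geometricThreshold_nonneg (N := 2 * n ^ 2) hγ0 hγ1)
    sum_geometricThreshold (S₁ := S₁) (S₂ := S₂) rfl rfl (hp0.trans_le hp) (hq0.trans_le hq)
    h.nodup h.not_isDiag h.card_common_le hTdef.symm ?_ ?_ ?_ (Nat.lt_size_self n)
    (size_le_three_mul_log hn).1 le_rfl hP2
  · simp only [hcdf] at this
    refine this.mono le_rfl ?_
    -- This is where the choice of `k` makes the classical space match the quantum one.
    have hpqM : p * q * M ≤ 2 * S := by
      have hS0 : 0 ≤ S := by rw [hS]; positivity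
      rw [← pow_le_pow_iff_left₀ (by positivity) (by positivity) two_ne_zero]
      calc (p * q * M) ^ 2 = (p * q) ^ 2 * M ^ 2 := by ring
        _ ≤ D * (2 * M * D / k) / T₀ ^ 2 * M ^ 2 := by gcongr
        _ = 2 * (T₀ ^ 2 * D ^ 2) * M ^ 3 / (k * T₀ ^ 4) := by field_simp
        _ = 2 * S ^ 2 := by rw [← hk5, hS]; field_simp
        _ ≤ (2 * S) ^ 2 := by nlinarith [sq_nonneg S]
    have hP0 : (0 : ℝ) < P := by exact_mod_cast hP.pos
    have hMP : (M : ℝ) * (1 / P) ≤ 1 := by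
      rw [mul_one_div, div_le_one hP0]
      exact_mod_cast hMn.trans hP1.le
    have hP1' : (1 : ℝ) / P ≤ 1 := by
      rw [div_le_one hP0]; exact_mod_cast hP.one_lt.le
    -- Rounding the probabilities up to multiples of `1 / P` stores `O(1)` more edges, as `M < P`.
    have hmul : (σ.length : ℝ) * ((S₁.card : ℝ) / P * ((S₂.card : ℝ) / P)) ≤ 2 * S + 3 := by
      calc (σ.length : ℝ) * ((S₁.card : ℝ) / P * ((S₂.card : ℝ) / P))
          ≤ M * ((p + 1 / P) * (q + 1 / P)) := by gcongr
        _ = p * q * M + M * (1 / P) * (p + q + 1 / P) := by ring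
        _ ≤ 2 * S + 1 * (1 + 1 + 1) := by gcongr
        _ = 2 * S + 3 := by ring
    gcongr
  · intro w
    simp only [hcdf]
    refine le_trans (le_trans (le_min ?_ ?_) hH) (by gcongr)
    · calc ∑ τ ∈ (triangles σ).filter (fun τ => τ.2 = w), (1 - γ ^ totalAge σ τ)
          ≤ ∑ τ ∈ (triangles σ).filter (fun τ => τ.2 = w), (totalAge σ τ : ℝ) * (1 / k) :=
            Finset.sum_le_sum fun τ _ => (one_sub_pow_le hγ0 _).trans (by gcongr)
        _ = ((∑ τ ∈ (triangles σ).filter (fun τ => τ.2 = w), totalAge σ τ : ℕ) : ℝ) * (1 / k) := by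
            rw [← Finset.sum_mul]; push_cast; rfl
        _ ≤ ((2 * σ.length * D : ℕ) : ℝ) * (1 / k) := by
            gcongr
            exact sum_totalAge_le h.card_common_le h.not_isDiag w
        _ ≤ 2 * M * D / k := by
            push_cast
            rw [mul_one_div]
            gcongr
    · calc ∑ τ ∈ (triangles σ).filter (fun τ => τ.2 = w), (1 - γ ^ totalAge σ τ)
          ≤ ∑ τ ∈ (triangles σ).filter (fun τ => τ.2 = w), (1 : ℝ) :=
            Finset.sum_le_sum fun τ _ => by linarith [pow_nonneg hγ0 (totalAge σ τ)]
        _ ≤ T := by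
            rw [Finset.sum_const, nsmul_eq_mul, mul_one, hTdef]
            exact_mod_cast Finset.card_filter_le _ _
  · refine hDT.trans ?_
    gcongr
  · refine hpqT.trans ?_
    gcongr

/-- The two estimates add up to the number of triangles. If the decay scale `k` is below `1`, storing
the whole graph is cheap enough. -/
lemma exists_estimates {M T₀ D : ℕ} (hn : 3 ≤ n) (hM : 1 ≤ M) (hMn : M ≤ n ^ 2)
    (hT₀ : 1 ≤ T₀) (hD : 1 ≤ D) (hDM : D ≤ M) (hTM : T₀ ≤ M * D) :
    ∃ A : QuantumStreamingAlgorithm (Sym2 (Fin n)), ∀ σ, WithinBounds σ M T₀ D →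
      A.Estimates σ (triangles σ).card (6 * ((triangles σ).card : ℝ) ^ 2)
        (1400 * ((M : ℝ) ^ (8 / 5 : ℝ) / (T₀ : ℝ) ^ (6 / 5 : ℝ) * (D : ℝ) ^ (4 / 5 : ℝ) *
          Real.log n)) := by
  have hM' : (1 : ℝ) ≤ M := by exact_mod_cast hM
  have hD' : (1 : ℝ) ≤ D := by exact_mod_cast hD
  have hT₀' : (1 : ℝ) ≤ T₀ := by exact_mod_cast hT₀
  obtain ⟨hL2, hL3, hlog⟩ := size_le_three_mul_log hn
  obtain ⟨k, hk0, hk5, hkM, hTk, hkS⟩ := exists_decayScale hM' hT₀' hD' (by exact_mod_cast hDM)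
    (by exact_mod_cast hTM)
  rw [← hkS]
  set S := (k * M / T₀) ^ 2 with hS
  have hS1 : 1 ≤ S := one_le_pow₀ ((one_le_div (by linarith)).2 hTk)
  have hL2' : (2 : ℝ) ≤ (Nat.size n : ℕ) := by exact_mod_cast hL2
  have hSlog : 0 ≤ S * Real.log n := by positivity
  have hLS : (Nat.size n : ℕ) * S ≤ 3 * (S * Real.log n) := by
    calc (Nat.size n : ℕ) * S ≤ 3 * Real.log n * S := by gcongr
      _ = _ := by ring
  have hSL : 2 * S ≤ (Nat.size n : ℕ) * S := by gcongr
  rcases le_total 1 k with hk | hk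
  · have hβ : 0 ≤ 1 - 1 / k := by
      rw [sub_nonneg, div_le_one hk0]; exact hk
    have hγ : Real.sqrt (1 - 1 / k) ^ 2 + 1 / k = 1 := by rw [Real.sq_sqrt hβ]; ring
    obtain ⟨A, hA⟩ := exists_estimates_quantum (D := D) hn hM hMn hT₀ hk hγ hS hS1
    obtain ⟨B, hB⟩ := exists_estimates_classical hn hM hMn hT₀ hD hk hkM hk5
      (Real.sqrt_nonneg _) hγ hS
    refine ⟨A.add B, fun σ h => ?_⟩
    have hAB := (hA σ h).add (hB σ h)
    have hsum : ∑ τ ∈ triangles σ, Real.sqrt (1 - 1 / k) ^ totalAge σ τ +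
        ∑ τ ∈ triangles σ, (1 - Real.sqrt (1 - 1 / k) ^ totalAge σ τ) = (triangles σ).card := by
      rw [← Finset.sum_add_distrib]
      simp
    rw [hsum] at hAB
    refine hAB.mono (by linarith) ?_
    nlinarith
  · obtain ⟨A, hA⟩ := exists_estimates_linear (M := M) (D := D) hn hT₀
    refine ⟨A, fun σ h => (hA σ h).mono (by nlinarith [sq_nonneg ((triangles σ).card : ℝ)]) ?_⟩
    have hMS : (M : ℝ) ≤ S := by
      rw [hS, div_pow, le_div_iff₀ (by positivity)]
      calc (M : ℝ) * T₀ ^ 2 ≤ M * (T₀ ^ 2 * D ^ 2) := by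
            gcongr
            exact le_mul_of_one_le_right (by positivity) (one_le_pow₀ hD')
        _ = k ^ 5 * M ^ 2 := by rw [← hk5]; ring
        _ ≤ k ^ 2 * M ^ 2 := by
            gcongr ?_ * _
            exact pow_le_pow_of_le_one hk0.le hk (by norm_num)
        _ = (k * M) ^ 2 := by ring
    calc (8 * ((Nat.size n : ℕ) : ℝ) + 1) * (10 + 6 * M)
        ≤ (8 * (Nat.size n : ℕ) + 1) * (16 * S) := by gcongr; linarith
      _ ≤ _ := by nlinarith

/-! ### Arbitrary bounds -/

lemma three_le_of_triangleCount_pos {G : SimpleGraph (Fin n)} (h : 0 < triangleCount G) :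
    3 ≤ n := by
  classical
  obtain ⟨t, ht⟩ := Finset.card_pos.1 h
  have := Finset.card_le_univ t
  rwa [((SimpleGraph.mem_cliqueFinset_iff).1 ht).2, Fintype.card_fin] at this

/-- Bounds that some stream meets can be lowered until they satisfy the trivial relations. -/
lemma IsGraphStream.withinBounds {G : SimpleGraph (Fin n)} {σ : List (Sym2 (Fin n))}
    (hG : IsGraphStream G σ) {M T₀ D : ℕ} (hM : σ.length ≤ M) (hT : T₀ ≤ triangleCount G)
    (hD : maxTrianglesPerEdge G ≤ D) :
    WithinBounds σ (min M (n ^ 2)) T₀ (min D (min M (n ^ 2))) where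
  nodup := hG.1
  not_isDiag := hG.not_isDiag
  length_le := le_min hM (length_le_sq hG.1)
  card_common_le a b hab := le_min ((hG.card_common_le hab).trans hD) <|
    (card_common_le_length a b).trans (le_min hM (length_le_sq hG.1))
  le_card := by rwa [hG.card_triangles]

lemma WithinBounds.le_mul {σ : List (Sym2 (Fin n))} {M T₀ D : ℕ} (h : WithinBounds σ M T₀ D) :
    T₀ ≤ M * D :=
  h.le_card.trans <| (card_triangles_le h.card_common_le h.nodup).trans <|
    Nat.mul_le_mul_right _ h.length_le

/-- An algorithm whose standard deviation is of the order of the number of triangles. The space bound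
is at least `1`, so that later additive constants are absorbed. -/
lemma exists_estimates_triangleCount (n M : ℕ) {T₀ : ℕ} (D : ℕ) (hT₀ : 0 < T₀) :
    ∃ A : QuantumStreamingAlgorithm (Sym2 (Fin n)), ∀ (G : SimpleGraph (Fin n)) σ,
      IsGraphStream G σ → σ.length ≤ M → T₀ ≤ triangleCount G → maxTrianglesPerEdge G ≤ D →
        A.Estimates σ (triangleCount G) (6 * (triangleCount G : ℝ) ^ 2)
            (1400 * ((M : ℝ) ^ (8 / 5 : ℝ) / (T₀ : ℝ) ^ (6 / 5 : ℝ) * (D : ℝ) ^ (4 / 5 : ℝ) *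
              Real.log n)) ∧
          1 ≤ (M : ℝ) ^ (8 / 5 : ℝ) / (T₀ : ℝ) ^ (6 / 5 : ℝ) * (D : ℝ) ^ (4 / 5 : ℝ) *
            Real.log n := by
  by_cases hne : ∃ (G : SimpleGraph (Fin n)) (σ : List (Sym2 (Fin n))), IsGraphStream G σ ∧
      σ.length ≤ M ∧ T₀ ≤ triangleCount G ∧ maxTrianglesPerEdge G ≤ D
  swap
  -- If no stream meets the bounds, nothing is required of the algorithm.
  · exact ⟨null _, fun G σ h1 h2 h3 h4 => (hne ⟨G, σ, h1, h2, h3, h4⟩).elim⟩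
  obtain ⟨G₀, σ₀, hG, hM, hT, hD⟩ := hne
  have hn := three_le_of_triangleCount_pos (hT₀.trans_le hT)
  have hb := hG.withinBounds hM hT hD
  have hTM := hb.le_mul
  have hpos : 0 < min M (n ^ 2) * min D (min M (n ^ 2)) := hT₀.trans_le hTM
  have hM1 : 1 ≤ min M (n ^ 2) := Nat.pos_of_mul_pos_right hpos
  have hD1 : 1 ≤ min D (min M (n ^ 2)) := Nat.pos_of_mul_pos_left hpos
  have hDM : min D (min M (n ^ 2)) ≤ min M (n ^ 2) := min_le_right _ _
  obtain ⟨A, hA⟩ := exists_estimates hn hM1 (min_le_right _ _) hT₀ hD1 hDM hTM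
  obtain ⟨-, -, hlog⟩ := size_le_three_mul_log hn
  have hT₀' : (1 : ℝ) ≤ T₀ := by exact_mod_cast hT₀
  obtain ⟨k, -, -, -, hTk, hkS⟩ := exists_decayScale (M := (min M (n ^ 2) : ℕ))
    (D := (min D (min M (n ^ 2)) : ℕ)) (by exact_mod_cast hM1) hT₀' (by exact_mod_cast hD1)
    (by exact_mod_cast hDM) (by exact_mod_cast hTM)
  have hmono : ((min M (n ^ 2) : ℕ) : ℝ) ^ (8 / 5 : ℝ) / (T₀ : ℝ) ^ (6 / 5 : ℝ) *
      ((min D (min M (n ^ 2)) : ℕ) : ℝ) ^ (4 / 5 : ℝ) ≤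
      (M : ℝ) ^ (8 / 5 : ℝ) / (T₀ : ℝ) ^ (6 / 5 : ℝ) * (D : ℝ) ^ (4 / 5 : ℝ) := by
    have h1 : ((min M (n ^ 2) : ℕ) : ℝ) ≤ M := by exact_mod_cast min_le_left _ _
    have h2 : ((min D (min M (n ^ 2)) : ℕ) : ℝ) ≤ D := by exact_mod_cast min_le_left _ _
    gcongr
  refine ⟨A, fun G σ hG hM hT hD => ⟨?_, ?_⟩⟩
  · have h := hA σ (hG.withinBounds hM hT hD)
    rw [hG.card_triangles] at h
    refine h.mono le_rfl ?_
    gcongr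
  · refine one_le_mul_of_one_le_of_one_le (le_trans ?_ hmono) hlog
    rw [← hkS]
    exact one_le_pow₀ ((one_le_div (by linarith)).2 hTk)

theorem theorem1 :
    ∃ K : ℝ, 0 < K ∧
      ∀ (n M T₀ D : ℕ) (ε δ : ℝ), 0 < T₀ → 0 < ε → ε ≤ 1 → 0 < δ → δ ≤ 1 →
        ∃ A : QuantumStreamingAlgorithm (Sym2 (Fin n)),
          ∀ (G : SimpleGraph (Fin n)) (σ : List (Sym2 (Fin n))),
            IsGraphStream G σ → σ.length ≤ M → T₀ ≤ triangleCount G →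
            maxTrianglesPerEdge G ≤ D →
              1 - δ ≤ A.prob σ
                (fun x => |x - (triangleCount G : ℝ)| ≤ ε * (triangleCount G : ℝ)) ∧
              A.expectedSpace σ ≤
                K * ((M : ℝ) ^ (8 / 5 : ℝ) / (T₀ : ℝ) ^ (6 / 5 : ℝ) * (D : ℝ) ^ (4 / 5 : ℝ) *
                  Real.log (n : ℝ) * (1 / ε ^ 2) * Real.log (1 / δ)) := by
  refine ⟨3000000, by norm_num, fun n M T₀ D ε δ hT₀ hε hε1 hδ hδ1 => ?_⟩
  obtain ⟨A, hA⟩ := exists_estimates_triangleCount n M D hT₀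
  have hN : 0 < ⌈96 / ε ^ 2⌉₊ := Nat.ceil_pos.2 (by positivity)
  have hN' : (0 : ℝ) < ⌈96 / ε ^ 2⌉₊ := by exact_mod_cast hN
  -- `96 = 6 * 16`: the variance `6 T ^ 2` has to come down to `(ε T) ^ 2 / 16`.
  obtain ⟨B, hB⟩ := exists_amplification
    ((A.nsum ⌈96 / ε ^ 2⌉₊).scale (⌈96 / ε ^ 2⌉₊ : ℝ)⁻¹) hδ hδ1
  refine ⟨B, fun G σ hG hM hT hD => ?_⟩
  obtain ⟨hest, hS1⟩ := hA G σ hG hM hT hD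
  set S := (M : ℝ) ^ (8 / 5 : ℝ) / (T₀ : ℝ) ^ (6 / 5 : ℝ) * (D : ℝ) ^ (4 / 5 : ℝ) *
    Real.log (n : ℝ)
  have hT0 : (0 : ℝ) < triangleCount G := by exact_mod_cast hT₀.trans_le hT
  have havg := hest.average hN
  have hmiss := havg.expect_miss_le (r := ε * triangleCount G) (by positivity) <| by
    rw [div_le_iff₀ hN']
    calc 6 * (triangleCount G : ℝ) ^ 2
        = (ε * triangleCount G) ^ 2 / 16 * (96 / ε ^ 2) := by field_simp; norm_num
      _ ≤ _ := by gcongr; exact Nat.le_ceil _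
  obtain ⟨hprob, hspace⟩ := hB σ _ _ hmiss
  refine ⟨hprob, hspace.trans ?_⟩
  have hε2 : 1 ≤ 1 / ε ^ 2 := (one_le_div (by positivity)).2 (pow_le_one₀ hε.le hε1)
  have hNle : (⌈96 / ε ^ 2⌉₊ : ℝ) ≤ 97 * (1 / ε ^ 2) := by
    have := Nat.ceil_lt_add_one (show 0 ≤ 96 / ε ^ 2 by positivity)
    have h96 : 96 / ε ^ 2 = 96 * (1 / ε ^ 2) := by ring
    linarith
  have hδ2 : 0 ≤ Real.log (1 / δ) := Real.log_nonneg ((one_le_div hδ).2 hδ1)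
  rw [← mul_assoc 3000000]
  refine mul_le_mul_of_nonneg_right ?_ hδ2
  have hSε : 1 ≤ S * (1 / ε ^ 2) := one_le_mul_of_one_le_of_one_le hS1 hε2
  calc 8 * (((A.nsum ⌈96 / ε ^ 2⌉₊).scale (⌈96 / ε ^ 2⌉₊ : ℝ)⁻¹).expectedSpace σ + 1)
      ≤ 8 * (⌈96 / ε ^ 2⌉₊ * (2 * (1400 * S) + 1) + 1) := by gcongr; exact havg.space
    _ ≤ 8 * (97 * (1 / ε ^ 2) * (2801 * S) + S * (1 / ε ^ 2)) := by
        gcongr; linarith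
    _ ≤ 3000000 * (S * (1 / ε ^ 2)) := by nlinarith

end
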